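/- **Setting.** Let $D_1,\dots,D_k$ be unknown distributions on $[n]$ and $\varepsilon\in(0,1]$. Assume there is a hidden partition of $[k]$ into two non-empty clusters $\mathcal I_1,\mathcal I_2$ such that $D_a=D_b$ for $a,b$ in the same cluster and $d_{\mathrm{TV}}(D_a,D_b)=\frac12\sum_{x\in[n]}|D_a(x)-D_b(x)|\ge\varepsilon$ for $a,b$ in different clusters; both cluster distributions are unknown. Let $r=\min(|\mathcal I_1|,|\mathcal I_2|)$. An algorithm is randomized, knows $n,k,\varepsilon$, draws samples from the $D_i$ adaptively, and outputs a partition of $[k]$. **Two-stage algorithm** (which also knows $r$). *Stage 1 (Find-One-Unknown).* Choose a uniformly random subset of $\min(\lceil 9k/r\rceil,k)$ indices. Together with a fixed reference index, say $1$, they form $m$ indices. Put $s_1=\min\big(n,(nm/\varepsilon^2)^{2/3}\big)$, $\delta'=\frac1{30m}$, $b=\sqrt{30/s_1}$ and $s_2=\lceil C_1 n s_1^{-1/2}\log(1/\delta')/\varepsilon^2\rceil$. Draw $s\sim\mathrm{Poi}(s_1)$ and abort if $s>2s_1$. Draw a multiset $\mathcal S$ of $s$ samples from $D_1$. For $i\in[k]$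 let $D_{i,\mathcal S}$ be the flattened distribution: each $x\in[n]$ is split into as many equally likely copies as one plus the multiplicity of $x$ in $\mathcal S$. For each of the other $m-1$ indices $i$ in turn, apply an equivalence test with parameters $\varepsilon,\delta',b$ to $s_2$ fresh samples from each of $D_{1,\mathcal S}$ and $D_{i,\mathcal S}$, and stop at the first $i=j$ that is declared different. *Stage 2 (MultiLFHT).* Draw $\lceil C_2T\rceil$ samples from each of $D_1$ and $D_j$, and $\lceil C_2T/k\rceil$ samples from each other $D_i$. Classify each such $D_i$ as $D_1$ or $D_j$ by a likelihood-free hypothesis test with parameters $\varepsilon$ and $\frac1{9k}$. Here $T$ is $\big(\frac{n^2k\log k}{\varepsilon^4}\big)^{1/3}$ if $n\ge\frac{k\log k}{\varepsilon^4}$, $\frac{\sqrt{nk\log k}}{\varepsilon^2}$ if $k\log k\le n<\frac{k\log k}{\varepsilon^4}$, and $\frac{k\log k}{\varepsilon^2}$ if $n<k\log k$. (If Stage 1 found no $j$, output a trivial partition.) **Theorem.** There are an equivalence-test decision rule, a likelihood-free hypothesis-test decision rule and universal constants $C_1,C_2>0$ for which the two-stage algorithm outputs the true partition $\{\mathcal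 I_1,\mathcal I_2\}$ with probability at least $2/3$. The total number of samples it draws is always at most $$O\left(\max\left(\left(\tfrac{nk}{r\varepsilon^2}\right)^{2/3},\tfrac{k\sqrt n}{r\varepsilon^2}\right)\log k+T_2\right),\qquad T_2=\begin{cases}\left(\frac{n^2k\log k}{\varepsilon^4}\right)^{1/3}& n\gtrsim\frac{k\log k}{\varepsilon^4},\\[1ex] \frac{\sqrt{nk\log k}}{\varepsilon^2}& k\log k\lesssim n\lesssim\frac{k\log k}{\varepsilon^4},\\[1ex] \frac{k\log k}{\varepsilon^2}& n\lesssim k\log k.\end{cases}$$ The constant in $O(\cdot)$ depends only on the constants in $\lesssim,\gtrsim$, which may be any positive numbers. Moreover, knowledge of $r$ is not needed: there is an algorithm that knows only $n,k,\varepsilon$ and that, with probability at least $2/3$, outputs the true partition and draws a number of samples obeying the same bound. -/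

import Mathlib

open scoped ENNReal NNReal

namespace TwoClustering

noncomputable section

/-! ### Distributions and the clustering promise -/

/-- Total variation distance of two distributions on `[n]`. -/
def tv {n : ℕ} (P Q : PMF (Fin n)) : ℝ :=
  (1 / 2) * ∑ x, |(P x).toReal - (Q x).toReal|

/-- `{I, Iᶜ}` is a hidden partition of the `k` distributions `D` into two non-empty clusters:
distributions in the same cluster are equal, and distributions in different clusters are at
total variation distance at least `ε`. -/
structure IsHiddenPartition {k n : ℕ} (ε : ℝ) (D : Fin k → PMF (Fin n))
    (I : Finset (Fin k)) : Prop where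
  nonempty : I.Nonempty
  nonempty_compl : Iᶜ.Nonempty
  eq_of_mem : ∀ a ∈ I, ∀ b ∈ I, D a = D b
  eq_of_mem_compl : ∀ a ∈ Iᶜ, ∀ b ∈ Iᶜ, D a = D b
  le_tv : ∀ a ∈ I, ∀ b ∈ Iᶜ, ε ≤ tv (D a) (D b)

/-- The size of the smaller of the two clusters `I` and `Iᶜ`. -/
def smallerSize {k : ℕ} (I : Finset (Fin k)) : ℕ := min I.card Iᶜ.card

/-! ### Adaptive randomized sampling algorithms -/

/-- An adaptive randomized algorithm with sample access to `k` distributions over `[n]` and output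
in `α`: it stops with an output, or draws a sample from the distribution of its choice, or uses
internal randomness; in the last two cases it continues according to the outcome. -/
inductive SampleAlg (k n : ℕ) (α : Type) : Type 1
  | ret (a : α) : SampleAlg k n α
  | query (i : Fin k) (next : Fin n → SampleAlg k n α) : SampleAlg k n α
  | random {β : Type} (μ : PMF β) (next : β → SampleAlg k n α) : SampleAlg k n α

namespace SampleAlg

variable {k n : ℕ} {α β : Type}

/-- Sequential composition. -/
def bind : SampleAlg k n α → (α → SampleAlg k n β) → SampleAlg k n β
  | ret a, f => f a
  | query i next, f => query i fun x => (next x).bind f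
  | random μ next, f => random μ fun x => (next x).bind f

instance : Monad (SampleAlg k n) where
  pure := ret
  bind := bind

/-- Draw one sample from the `i`-th distribution. -/
def draw (i : Fin k) : SampleAlg k n (Fin n) := query i ret

/-- Draw a value from a known distribution, at no cost in samples. -/
def rand (μ : PMF α) : SampleAlg k n α := random μ ret

/-- Run `A` independently `s` times and collect the results. -/
def iid (A : SampleAlg k n α) : (s : ℕ) → SampleAlg k n (Fin s → α)
  | 0 => pure Fin.elim0
  | s + 1 => do
    let x ← A
    let xs ← iid A s
    pure (Fin.cons x xs)

/-- The joint law of the output of the algorithm and of the number of samples that it draws,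
when the `k` distributions are `D`. -/
def run (D : Fin k → PMF (Fin n)) : SampleAlg k n α → PMF (α × ℕ)
  | ret a => PMF.pure (a, 0)
  | query i next => (D i).bind fun x => (run D (next x)).map fun p => (p.1, p.2 + 1)
  | random μ next => μ.bind fun x => run D (next x)

/-- The probability that the pair (output, number of samples drawn) satisfies `E`. -/
def prob (A : SampleAlg k n α) (D : Fin k → PMF (Fin n)) (E : α → ℕ → Prop) : ℝ≥0∞ :=
  (A.run D).toOuterMeasure {p | E p.1 p.2}

end SampleAlg

open SampleAlg

/-! ### The subroutines used as black boxes -/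

/-- A decision rule for equivalence testing of two distributions on a finite domain `α`. Its
arguments are the distance `ε`, the error probability `δ`, the bound `b` on an `ℓ²` norm, and `s`
samples from each of the two distributions. The answer `true` means "at distance at least `ε`",
`false` means "identical". -/
abbrev EquivalenceTest : Type 1 :=
  ∀ (α : Type) [Fintype α], (ε δ b : ℝ) → (s : ℕ) → (Fin s → α) → (Fin s → α) → PMF Bool

/-- A decision rule for likelihood-free hypothesis testing over `[n]`. Its arguments are the
distance `ε`, the error probability `δ`, `s₁` samples from each of `P` and `Q`, and `s₂` samples
from the distribution to be classified. The answer `true` means `P`, `false` means `Q`. -/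
abbrev LFHTest : Type :=
  ∀ n : ℕ, (ε δ : ℝ) → (s₁ s₂ : ℕ) →
    (Fin s₁ → Fin n) → (Fin s₁ → Fin n) → (Fin s₂ → Fin n) → PMF Bool

/-! ### Stage 1: Find-One-Unknown -/

/-- The expanded domain of the flattening by the multiset `S` of samples: the element `x` is split
into as many copies as one plus the multiplicity of `x` in `S`. -/
abbrev Flat {n s : ℕ} (S : Fin s → Fin n) : Type :=
  Σ x : Fin n, Fin ((Finset.univ.filter fun t => S t = x).card + 1)

/-- Draw one sample from the flattened distribution `D_{i,S}`: draw `x` from `D_i`, then one of the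
copies of `x` uniformly at random. -/
def drawFlat {k n s : ℕ} (S : Fin s → Fin n) (i : Fin k) : SampleAlg k n (Flat S) := do
  let x ← draw i
  let j ← rand (PMF.uniformOfFintype (Fin ((Finset.univ.filter fun t => S t = x).card + 1)))
  pure ⟨x, j⟩

/-- Apply `test` to the listed distributions in turn, and return the first one on which the answer
is `true`, if there is one. -/
def firstDifferent {k n : ℕ} (test : Fin k → SampleAlg k n Bool) :
    List (Fin k) → SampleAlg k n (Option (Fin k))
  | [] => pure none
  | i :: l => do
    let b ← test i
    if b then pure (some i) else firstDifferent test l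

/-- The mean number `s₁ = min (n, (n m / ε²)^{2/3})` of samples used for flattening. -/
def sketchSize (n m : ℕ) (ε : ℝ) : ℝ :=
  min (n : ℝ) ((n * m / ε ^ 2) ^ (2 / 3 : ℝ))

/-- Find-One-Unknown on the `m` distributions formed by the reference `a₁` and `arms`: looks for
an index whose distribution differs from that of `a₁`. The result `none` stands for the answer
"all identical", and for the abortion when the Poisson variable is too large. -/
def findOneUnknown (test : EquivalenceTest) (C : ℝ) {k n : ℕ} (ε : ℝ) (a₁ : Fin k)
    (arms : List (Fin k)) : SampleAlg k n (Option (Fin k)) := do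
  let m : ℕ := arms.length + 1
  let s₁ : ℝ := sketchSize n m ε
  let δ : ℝ := 1 / (30 * m)
  let b : ℝ := √(30 / s₁)
  let s₂ : ℕ := ⌈C * n * s₁ ^ (-(1 / 2) : ℝ) * Real.log (1 / δ) / ε ^ 2⌉₊
  let s ← rand (ProbabilityTheory.poissonMeasure s₁.toNNReal).toPMF
  if 2 * s₁ < s then
    pure none
  else do
    let S ← iid (draw a₁) s
    firstDifferent (fun i => do
      let X ← iid (drawFlat S a₁) s₂
      let Y ← iid (drawFlat S i) s₂
      rand (test (Flat S) ε δ b s₂ X Y)) arms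

/-! ### Stage 2: MultiLFHT -/

/-- Apply `test` to the listed distributions, and return the set of those with answer `true`. -/
def classify {k n : ℕ} (test : Fin k → SampleAlg k n Bool) :
    List (Fin k) → SampleAlg k n (Finset (Fin k))
  | [] => pure ∅
  | i :: l => do
    let b ← test i
    let χ ← classify test l
    pure (if b then insert i χ else χ)

/-- `(n² k log k / ε⁴)^{1/3}`. -/
def costLarge (n k : ℕ) (ε : ℝ) : ℝ :=
  ((n : ℝ) ^ 2 * k * Real.log k / ε ^ 4) ^ (1 / 3 : ℝ)

/-- `√(n k log k) / ε²`. -/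
def costMid (n k : ℕ) (ε : ℝ) : ℝ :=
  √(n * k * Real.log k) / ε ^ 2

/-- `k log k / ε²`. -/
def costSmall (k : ℕ) (ε : ℝ) : ℝ :=
  k * Real.log k / ε ^ 2

/-- The order of the number of samples that MultiLFHT takes from each of the two exemplars,
according to the regime of `n`; each distribution to be classified is sampled `1 / k` times as
often. -/
def lfhtSize (n k : ℕ) (ε : ℝ) : ℝ :=
  if k * Real.log k / ε ^ 4 ≤ n then costLarge n k ε
  else if k * Real.log k ≤ n then costMid n k ε
  else costSmall k ε

/-- MultiLFHT with the exemplars `a₁` and `a₂` of the two clusters: the other `k - 2` distributions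
are classified one by one by the rule `lfht`, with error probability `1 / (9 k)` each, where the
samples from the exemplars are shared. The output is the resulting partition. -/
def multiLFHT (lfht : LFHTest) (C : ℝ) {k n : ℕ} (ε : ℝ) (a₁ a₂ : Fin k) :
    SampleAlg k n (Finset (Finset (Fin k))) := do
  let s₁ : ℕ := ⌈C * lfhtSize n k ε⌉₊
  let s₂ : ℕ := ⌈C * lfhtSize n k ε / k⌉₊
  let X ← iid (draw a₁) s₁
  let Y ← iid (draw a₂) s₁
  let χ ← classify (fun i => do
    let Z ← iid (draw i) s₂
    rand (lfht n ε (1 / (9 * k)) s₁ s₂ X Y Z)) ((Finset.univ.erase a₁).erase a₂).toList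
  pure {insert a₁ χ, (insert a₁ χ)ᶜ}

/-! ### The two-stage algorithm -/

/-- The number of distributions subsampled in Stage 1: `⌈9 k / r⌉`, or all `k` if this is more. -/
def subsetSize (k r : ℕ) : ℕ := min ⌈(9 * k / r : ℝ)⌉₊ k

/-- The uniform law on the sets of `subsetSize k r` of the `k` indices. -/
def randomSubset (k r : ℕ) : PMF (Finset (Fin k)) :=
  PMF.uniformOfFinset (Finset.powersetCard (subsetSize k r) Finset.univ)
    (Finset.powersetCard_nonempty.2 (by simp [subsetSize]))

/-- The two-stage algorithm for smaller cluster size `r`: Find-One-Unknown on the reference `a₁`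
and a random subset of the distributions, followed by MultiLFHT with `a₁` and the index found.
If no index is found, the output is a trivial one. -/
def twoStage (test : EquivalenceTest) (lfht : LFHTest) (C₁ C₂ : ℝ) {k n : ℕ} (r : ℕ) (ε : ℝ)
    (a₁ : Fin k) : SampleAlg k n (Finset (Finset (Fin k))) := do
  let J ← rand (randomSubset k r)
  let found ← findOneUnknown test C₁ ε a₁ (J.erase a₁).toList
  match found with
  | none => pure {Finset.univ, ∅}
  | some a₂ => multiLFHT lfht C₂ ε a₁ a₂

/-! ### The sample complexity -/

/-- `max ((n k / (r ε²))^{2/3}, k √n / (r ε²)) · log k`. -/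
def costFind (n k r : ℕ) (ε : ℝ) : ℝ :=
  max ((n * k / (r * ε ^ 2) : ℝ) ^ (2 / 3 : ℝ)) (k * √n / (r * ε ^ 2)) * Real.log k

/-- The number `N` of samples obeys the bounds of the three regimes of `n`. Here `c` is the constant
hidden in the conditions `≳`, `≲` on `n`, and `C` the constant hidden in `O(·)`. -/
structure SampleBound (c C : ℝ) (n k r : ℕ) (ε : ℝ) (N : ℕ) : Prop where
  large : c * (k * Real.log k / ε ^ 4) ≤ n →
    N ≤ C * (costFind n k r ε + costLarge n k ε)
  mid : c * (k * Real.log k) ≤ n → c * n ≤ k * Real.log k / ε ^ 4 →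
    N ≤ C * (costFind n k r ε + costMid n k ε)
  small : c * n ≤ k * Real.log k →
    N ≤ C * (costFind n k r ε + costSmall k ε)

end

end TwoClustering

open TwoClustering

/-!
Both tests count independent votes, and a single vote needs only a constant advantage: on a
first part of the samples it computes histograms, whose weighted difference is a score, and on the
second part it compares the means of that score. The weights are roughly the inverse multiplicities,
and Chebyshev's inequality bounds the error of a vote; Chernoff's method amplifies the votes.

In the first stage the reference distribution is flattened by `s` of its own samples. Since the mean
of `1 / (count + 1)` is at most `1 / ((s + 1) p)`, its squared `ℓ²` norm then is of order `1 / s`.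
A random subset of `9 k / r` indices misses the other cluster with probability at most `e⁻⁹`, and a
union bound over the equivalence tests does the rest. In the second stage a union bound over the
`k - 2` likelihood-free tests is enough.

If `r` is not known, the first stage is run with the guesses `2 ^ L, …, 2, 1` until it finds an
index. The costs grow geometrically, so the last run dominates, while the total probability of an
index that is wrongly found stays of order `∑ 2 ^ i / k`, which the largest guess dominates.
-/

namespace TwoClustering

open SampleAlg

noncomputable section

/-! ### Probabilities of events -/

/-- The real-valued indicator of a proposition, which turns probabilities into expectations. -/
def ind (E : Prop) : ℝ := open Classical in if E then 1 else 0

lemma ind_of {E : Prop} (h : E) : ind E = 1 := by simp [ind, h]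

lemma ind_of_not {E : Prop} (h : ¬ E) : ind E = 0 := by simp [ind, h]

lemma ind_nonneg (E : Prop) : 0 ≤ ind E := by unfold ind; split_ifs <;> norm_num

lemma ind_le_one (E : Prop) : ind E ≤ 1 := by unfold ind; split_ifs <;> norm_num

lemma ind_le {E : Prop} {c : ℝ} (hc : 0 ≤ c) (h : E → 1 ≤ c) : ind E ≤ c := by
  by_cases hE : E
  · rw [ind_of hE]; exact h hE
  · rwa [ind_of_not hE]

lemma ind_mono {E F : Prop} (h : E → F) : ind E ≤ ind F :=
  ind_le (ind_nonneg F) fun hE => (ind_of (h hE)).ge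

/-- The probability of an event under a `PMF`, as a real number. -/
def pr {α : Type*} (μ : PMF α) (E : α → Prop) : ℝ := (μ.toOuterMeasure {a | E a}).toReal

section Probability

variable {α β : Type*}

lemma toOuterMeasure_ne_top (μ : PMF α) (s : Set α) : μ.toOuterMeasure s ≠ ∞ := by
  rw [PMF.toOuterMeasure_apply]
  exact μ.tsum_coe_indicator_ne_top s

lemma pr_nonneg (μ : PMF α) (E : α → Prop) : 0 ≤ pr μ E := ENNReal.toReal_nonneg

lemma pr_mono {μ : PMF α} {E F : α → Prop} (h : ∀ a ∈ μ.support, E a → F a) : pr μ E ≤ pr μ F :=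
  ENNReal.toReal_mono (toOuterMeasure_ne_top _ _)
    (PMF.toOuterMeasure_mono _ fun a ha => h a ha.2 ha.1)

lemma hasSum_toReal_of_tsum_ne_top {f : α → ℝ≥0∞} (h : ∑' a, f a ≠ ∞) :
    HasSum (fun a => (f a).toReal) (∑' a, f a).toReal := by
  rw [ENNReal.tsum_toReal_eq (ENNReal.ne_top_of_tsum_ne_top h)]
  exact ENNReal.hasSum_toReal h

lemma hasSum_toReal (μ : PMF α) : HasSum (fun a => (μ a).toReal) 1 := by
  simpa only [μ.tsum_coe, ENNReal.toReal_one] using hasSum_toReal_of_tsum_ne_top μ.tsum_coe_ne_top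

lemma hasSum_pr (μ : PMF α) (E : α → Prop) :
    HasSum (fun a => (μ a).toReal * ind (E a)) (pr μ E) := by
  rw [pr, PMF.toOuterMeasure_apply]
  convert! hasSum_toReal_of_tsum_ne_top (μ.tsum_coe_indicator_ne_top {a | E a}) using 2 with a
  by_cases h : E a <;> simp [ind, Set.indicator, h]

lemma pr_not (μ : PMF α) (E : α → Prop) : pr μ (fun a => ¬ E a) = 1 - pr μ E := by
  refine (hasSum_pr μ _).unique
    (((hasSum_toReal μ).sub (hasSum_pr μ E)).congr_fun fun a => ?_)
  by_cases h : E a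
  · simp [ind_of h, ind_of_not (not_not_intro h)]
  · simp [ind_of h, ind_of_not h]

lemma pr_le_one (μ : PMF α) (E : α → Prop) : pr μ E ≤ 1 := by
  have := pr_nonneg μ fun a => ¬ E a
  rw [pr_not] at this
  linarith

lemma pr_map (μ : PMF α) (f : α → β) (E : β → Prop) :
    pr (μ.map f) E = pr μ (fun a => E (f a)) := by
  simp [pr, PMF.toOuterMeasure_map_apply]

lemma pr_pure (a : α) (E : α → Prop) : pr (PMF.pure a) E = ind (E a) := by
  by_cases h : E a <;> simp [pr, ind, PMF.toOuterMeasure_pure_apply, h]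

lemma pr_pure_of_not {a : α} {E : α → Prop} (h : ¬ E a) : pr (PMF.pure a) E = 0 := by
  rw [pr_pure, ind_of_not h]

lemma hasSum_pr_bind (μ : PMF α) (f : α → PMF β) (E : β → Prop) :
    HasSum (fun a => (μ a).toReal * pr (f a) E) (pr (μ.bind f) E) := by
  have h := toOuterMeasure_ne_top (μ.bind f) {b | E b}
  rw [PMF.toOuterMeasure_bind_apply] at h
  simpa only [pr, PMF.toOuterMeasure_bind_apply, ENNReal.toReal_mul] using
    hasSum_toReal_of_tsum_ne_top h

lemma pr_bind_eq_sum [Fintype α] (μ : PMF α) (f : α → PMF β) (E : β → Prop) :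
    pr (μ.bind f) E = ∑ a, (μ a).toReal * pr (f a) E :=
  (hasSum_pr_bind μ f E).unique (hasSum_fintype _)

lemma pr_bind_le_of_hasSum {μ : PMF α} {f : α → PMF β} {E : β → Prop} {g : α → ℝ} {c : ℝ}
    (hg : ∀ a ∈ μ.support, pr (f a) E ≤ g a) (hs : HasSum (fun a => (μ a).toReal * g a) c) :
    pr (μ.bind f) E ≤ c := by
  refine hasSum_le (fun a => ?_) (hasSum_pr_bind μ f E) hs
  by_cases ha : a ∈ μ.support
  · exact mul_le_mul_of_nonneg_left (hg a ha) ENNReal.toReal_nonneg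
  · simp [(μ.apply_eq_zero_iff a).2 ha]

lemma pr_bind_le_add {μ : PMF α} {f : α → PMF β} {E : β → Prop} (G : α → Prop) {c : ℝ}
    (hc : 0 ≤ c) (h : ∀ a ∈ μ.support, ¬ G a → pr (f a) E ≤ c) :
    pr (μ.bind f) E ≤ pr μ G + c := by
  refine pr_bind_le_of_hasSum (g := fun a => ind (G a) + c) (fun a ha => ?_) ?_
  · by_cases hG : G a
    · linarith [pr_le_one (f a) E, ind_of hG]
    · linarith [h a ha hG, ind_of_not hG]
  · simpa only [mul_add, one_mul] using (hasSum_pr μ G).add ((hasSum_toReal μ).mul_right c)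

lemma pr_bind_le {μ : PMF α} {f : α → PMF β} {E : β → Prop} {c : ℝ}
    (h : ∀ a ∈ μ.support, pr (f a) E ≤ c) : pr (μ.bind f) E ≤ c :=
  pr_bind_le_of_hasSum h (by simpa using (hasSum_toReal μ).mul_right c)

lemma ofReal_le_toOuterMeasure {μ : PMF α} {E : α → Prop} {c : ℝ}
    (h : pr μ (fun a => ¬ E a) ≤ 1 - c) : ENNReal.ofReal c ≤ μ.toOuterMeasure {a | E a} := by
  rw [pr_not, sub_le_sub_iff_left] at h
  exact ENNReal.ofReal_le_of_le_toReal h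

end Probability

/-! ### Laws and costs of sampling algorithms -/

/-- The law of the output of an algorithm, regardless of the number of samples drawn. -/
def law {k n : ℕ} {α : Type} (D : Fin k → PMF (Fin n)) (A : SampleAlg k n α) : PMF α :=
  (A.run D).map Prod.fst

/-- The law of `s` independent samples from `μ`. -/
def iidPMF {α : Type} (μ : PMF α) : (s : ℕ) → PMF (Fin s → α)
  | 0 => PMF.pure Fin.elim0
  | s + 1 => μ.bind fun x => (iidPMF μ s).bind fun xs => PMF.pure (Fin.cons x xs)

/-- The algorithm never draws more than `N` samples. -/
def CostLE {k n : ℕ} {α : Type} (D : Fin k → PMF (Fin n)) (A : SampleAlg k n α) (N : ℕ) : Prop :=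
  ∀ p ∈ (A.run D).support, p.2 ≤ N

section Law

variable {k n : ℕ} {α β : Type} {D : Fin k → PMF (Fin n)}

lemma monad_bind_eq (A : SampleAlg k n α) (f : α → SampleAlg k n β) : (A >>= f) = A.bind f := rfl

lemma monad_pure_eq (a : α) : (pure a : SampleAlg k n α) = .ret a := rfl

lemma run_bind (A : SampleAlg k n α) (f : α → SampleAlg k n β) :
    (A.bind f).run D =
      (A.run D).bind fun p => ((f p.1).run D).map fun q => (q.1, p.2 + q.2) := by
  induction A with
  | ret a =>
    simp only [SampleAlg.bind, SampleAlg.run, PMF.pure_bind, zero_add, Prod.mk.eta]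
    exact (PMF.map_id _).symm
  | query i next ih =>
    simp only [SampleAlg.bind, SampleAlg.run, ih, PMF.map_bind, PMF.bind_bind, PMF.bind_map,
      PMF.map_comp]
    congr 1; funext x; congr 1; funext p
    simp only [Function.comp_def]
    congr 1; funext q; simp [add_right_comm]
  | random μ next ih => simp only [SampleAlg.bind, SampleAlg.run, ih, PMF.bind_bind]

lemma law_bind (A : SampleAlg k n α) (f : α → SampleAlg k n β) :
    law D (A.bind f) = (law D A).bind fun a => law D (f a) := by
  simp only [law, run_bind, PMF.map_bind, PMF.map_comp, PMF.bind_map, Function.comp_def]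

lemma law_ret (a : α) : law D (.ret a) = PMF.pure a := by simp [law, SampleAlg.run, PMF.pure_map]

lemma law_rand (μ : PMF α) : law D (rand μ) = μ := by
  simp [law, rand, SampleAlg.run, PMF.map_bind, PMF.pure_map]

lemma law_draw (i : Fin k) : law D (draw i) = D i := by
  simp [law, draw, SampleAlg.run, PMF.map_bind, PMF.pure_map]

lemma law_iid (A : SampleAlg k n α) (s : ℕ) : law D (iid A s) = iidPMF (law D A) s := by
  induction s with
  | zero => simp [iid, iidPMF, monad_pure_eq, law_ret]
  | succ s ih => simp [iid, iidPMF, monad_pure_eq, monad_bind_eq, law_bind, law_ret, ih]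

lemma pr_law (A : SampleAlg k n α) (E : α → Prop) :
    pr (law D A) E = pr (A.run D) fun p => E p.1 := by rw [law, pr_map]

lemma mem_support_law {A : SampleAlg k n α} {a : α} :
    a ∈ (law D A).support ↔ ∃ N, (a, N) ∈ (A.run D).support := by
  simp [law]

lemma costLE_ret (a : α) (N : ℕ) : CostLE D (.ret a) N := by
  intro p hp
  simp only [SampleAlg.run, PMF.mem_support_pure_iff] at hp
  simp [hp]

lemma CostLE.mono {A : SampleAlg k n α} {M N : ℕ} (h : CostLE D A M) (hMN : M ≤ N) :
    CostLE D A N := fun p hp => (h p hp).trans hMN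

lemma CostLE.cast_le {A : SampleAlg k n α} {x : ℝ} (h : CostLE D A ⌊x⌋₊) (hx : 0 ≤ x)
    {p : α × ℕ} (hp : p ∈ (A.run D).support) : (p.2 : ℝ) ≤ x :=
  (Nat.le_floor_iff hx).1 (h p hp)

lemma CostLE.bind {A : SampleAlg k n α} {f : α → SampleAlg k n β} {M N : ℕ} (hA : CostLE D A M)
    (hf : ∀ a ∈ (law D A).support, CostLE D (f a) N) : CostLE D (A.bind f) (M + N) := by
  intro p hp
  rw [run_bind, PMF.mem_support_bind_iff] at hp
  obtain ⟨q, hq, hp⟩ := hp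
  rw [PMF.mem_support_map_iff] at hp
  obtain ⟨r, hr, rfl⟩ := hp
  exact add_le_add (hA q hq) (hf q.1 (mem_support_law.2 ⟨q.2, hq⟩) r hr)

lemma costLE_rand (μ : PMF α) : CostLE D (rand μ) 0 := by
  intro p hp
  simp only [rand, SampleAlg.run, PMF.mem_support_bind_iff, PMF.mem_support_pure_iff] at hp
  obtain ⟨x, -, rfl⟩ := hp
  simp

lemma costLE_rand_bind {μ : PMF α} {f : α → SampleAlg k n β} {N : ℕ}
    (hf : ∀ a ∈ μ.support, CostLE D (f a) N) : CostLE D ((rand μ).bind f) N := by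
  have := (costLE_rand (D := D) μ).bind (f := f) (N := N) (by rwa [law_rand])
  rwa [zero_add] at this

lemma costLE_draw (i : Fin k) : CostLE D (draw i) 1 := by
  intro p hp
  simp only [draw, SampleAlg.run, PMF.mem_support_bind_iff, PMF.mem_support_map_iff,
    PMF.mem_support_pure_iff] at hp
  obtain ⟨x, -, q, rfl, rfl⟩ := hp
  simp

lemma costLE_iid {A : SampleAlg k n α} {N : ℕ} (hA : CostLE D A N) (s : ℕ) :
    CostLE D (iid A s) (s * N) := by
  induction s with
  | zero => exact costLE_ret _ _
  | succ s ih =>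
    rw [add_mul, one_mul, add_comm (s * N)]
    exact hA.bind fun x _ => ih.bind (N := 0) fun xs _ => costLE_ret _ _

end Law

/-! ### Expectations over lists of independent samples -/

/-- The expectation of `F` over lists of `s` independent samples with probabilities `p`. Lists make
it easy to spend consecutive parts of a sample on different purposes. -/
def avg {α : Type*} [Fintype α] (p : α → ℝ) : ℕ → (List α → ℝ) → ℝ
  | 0, F => F []
  | s + 1, F => ∑ x, p x * avg p s fun l => F (x :: l)

/-- The probabilities of a `PMF` on a finite type, as real numbers. -/
def wt {α : Type*} (μ : PMF α) (x : α) : ℝ := (μ x).toReal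

section Average

variable {α β : Type*} [Fintype α] [Fintype β] {p : α → ℝ} {q : β → ℝ}

lemma wt_mem_stdSimplex (μ : PMF α) : wt μ ∈ stdSimplex ℝ α :=
  ⟨fun _ => ENNReal.toReal_nonneg, (hasSum_fintype _).unique (hasSum_toReal μ)⟩

/-- The joint probabilities of independent samples with probabilities `p` and `q`. -/
def prodWt (p : α → ℝ) (q : β → ℝ) (z : α × β) : ℝ := p z.1 * q z.2

lemma sum_prodWt_mul (p : α → ℝ) (q : β → ℝ) (F : α × β → ℝ) :
    ∑ z, prodWt p q z * F z = ∑ x, p x * ∑ y, q y * F (x, y) := by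
  simp only [prodWt, Fintype.sum_prod_type, Finset.mul_sum, mul_assoc]

lemma prodWt_mem_stdSimplex (hp : p ∈ stdSimplex ℝ α) (hq : q ∈ stdSimplex ℝ β) :
    prodWt p q ∈ stdSimplex ℝ (α × β) :=
  ⟨fun _ => mul_nonneg (hp.1 _) (hq.1 _), by
    simpa [hq.2, hp.2] using sum_prodWt_mul p q fun _ => 1⟩

lemma avg_zero (F : List α → ℝ) : avg p 0 F = F [] := rfl

lemma avg_succ (s : ℕ) (F : List α → ℝ) :
    avg p (s + 1) F = ∑ x, p x * avg p s fun l => F (x :: l) := rfl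

lemma avg_congr {s : ℕ} {F G : List α → ℝ} (h : ∀ l, l.length = s → F l = G l) :
    avg p s F = avg p s G := by
  induction s generalizing F G with
  | zero => exact h [] rfl
  | succ s ih =>
    simp only [avg_succ]
    exact Finset.sum_congr rfl fun x _ => by
      rw [ih fun l hl => h (x :: l) (by simp [hl])]

lemma avg_mono (hp : ∀ x, 0 ≤ p x) {s : ℕ} {F G : List α → ℝ} (h : ∀ l, F l ≤ G l) :
    avg p s F ≤ avg p s G := by
  induction s generalizing F G with
  | zero => exact h []
  | succ s ih =>
    exact Finset.sum_le_sum fun x _ =>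
      mul_le_mul_of_nonneg_left (ih fun l => h (x :: l)) (hp x)

lemma avg_add (s : ℕ) (F G : List α → ℝ) :
    avg p s (fun l => F l + G l) = avg p s F + avg p s G := by
  induction s generalizing F G with
  | zero => rfl
  | succ s ih => simp only [avg_succ, ih, mul_add, Finset.sum_add_distrib]

lemma avg_mul_left (s : ℕ) (c : ℝ) (F : List α → ℝ) :
    avg p s (fun l => c * F l) = c * avg p s F := by
  induction s generalizing F with
  | zero => rfl
  | succ s ih => simp only [avg_succ, ih, Finset.mul_sum, mul_left_comm]

lemma avg_mul_right (s : ℕ) (c : ℝ) (F : List α → ℝ) :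
    avg p s (fun l => F l * c) = avg p s F * c := by
  simp only [mul_comm _ c, avg_mul_left]

lemma avg_sub (s : ℕ) (F G : List α → ℝ) :
    avg p s (fun l => F l - G l) = avg p s F - avg p s G := by
  have := avg_add (p := p) s F fun l => (-1) * G l
  rw [avg_mul_left] at this
  simpa [sub_eq_add_neg] using this

lemma avg_const (hp : p ∈ stdSimplex ℝ α) (s : ℕ) (c : ℝ) : avg p s (fun _ => c) = c := by
  induction s with
  | zero => rfl
  | succ s ih => simp only [avg_succ, ih, ← Finset.sum_mul, hp.2, one_mul]

lemma avg_sum {ι : Type*} (s : ℕ) (t : Finset ι) (F : ι → List α → ℝ) :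
    avg p s (fun l => ∑ i ∈ t, F i l) = ∑ i ∈ t, avg p s (F i) := by
  induction s generalizing F with
  | zero => rfl
  | succ s ih =>
    simp only [avg_succ, ih, Finset.mul_sum]
    rw [Finset.sum_comm]

lemma avg_nonneg (hp : ∀ x, 0 ≤ p x) {s : ℕ} {F : List α → ℝ} (h : ∀ l, 0 ≤ F l) :
    0 ≤ avg p s F := by
  have := avg_mono hp (s := s) h
  have h0 : avg p s (fun _ => (0 : ℝ)) = 0 := by simpa using avg_mul_left (p := p) s 0 fun _ => 0
  rwa [h0] at this

lemma avg_append (a b : ℕ) (F : List α → ℝ) :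
    avg p (a + b) F = avg p a fun l => avg p b fun l' => F (l ++ l') := by
  induction a generalizing F with
  | zero => simp only [Nat.zero_add, avg_zero, List.nil_append]
  | succ a ih =>
    rw [Nat.add_right_comm]
    simp only [avg_succ, ih, List.cons_append]

lemma avg_split {a s : ℕ} (h : a ≤ s) (F : List α → List α → ℝ) :
    avg p s (fun l => F (l.take a) (l.drop a)) =
      avg p a fun l => avg p (s - a) fun l' => F l l' := by
  obtain ⟨b, rfl⟩ := Nat.exists_eq_add_of_le h
  rw [avg_append, Nat.add_sub_cancel_left]
  exact avg_congr fun l hl => avg_congr fun l' _ => by simp [← hl]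

lemma avg_take (hp : p ∈ stdSimplex ℝ α) {a s : ℕ} (h : a ≤ s) (F : List α → ℝ) :
    avg p s (fun l => F (l.take a)) = avg p a F := by
  rw [avg_split h fun l _ => F l]
  simp only [avg_const hp]

lemma avg_comm (s t : ℕ) (F : List α → List β → ℝ) :
    (avg p s fun l => avg q t fun l' => F l l') = avg q t fun l' => avg p s fun l => F l l' := by
  induction s generalizing F with
  | zero => rfl
  | succ s ih =>
    simp only [avg_succ, ih]
    rw [avg_sum]
    simp only [avg_mul_left]

lemma avg_zip (s : ℕ) (F : List (α × β) → ℝ) :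
    (avg p s fun l => avg q s fun l' => F (l.zip l')) = avg (prodWt p q) s F := by
  induction s generalizing F with
  | zero => rfl
  | succ s ih =>
    simp only [avg_succ, List.zip_cons_cons]
    rw [sum_prodWt_mul]
    refine Finset.sum_congr rfl fun x _ => ?_
    rw [avg_sum]
    simp only [avg_mul_left]
    exact congrArg _ (Finset.sum_congr rfl fun y _ => by rw [← ih])

lemma avg_map_fst (hq : q ∈ stdSimplex ℝ β) (s : ℕ) (F : List α → ℝ) :
    avg (prodWt p q) s (fun l => F (l.map Prod.fst)) = avg p s F := by
  rw [← avg_zip]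
  refine avg_congr fun l hl => ?_
  rw [← avg_const hq s (F l)]
  exact avg_congr fun l' hl' => by rw [List.map_fst_zip (by omega)]

lemma avg_map_snd (hp : p ∈ stdSimplex ℝ α) (s : ℕ) (F : List β → ℝ) :
    avg (prodWt p q) s (fun l => F (l.map Prod.snd)) = avg q s F := by
  rw [← avg_zip, avg_comm]
  refine avg_congr fun l hl => ?_
  rw [← avg_const hp s (F l)]
  exact avg_congr fun l' hl' => by rw [List.map_snd_zip (by omega)]

lemma avg_map_equiv (e : α ≃ α) (he : ∀ x, p (e x) = p x) (s : ℕ) (F : List α → ℝ) :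
    avg p s (fun l => F (l.map e)) = avg p s F := by
  induction s generalizing F with
  | zero => rfl
  | succ s ih =>
    simp only [avg_succ, List.map_cons]
    rw [← Equiv.sum_comp e fun x => p x * avg p s fun l => F (x :: l)]
    exact Finset.sum_congr rfl fun x _ => by rw [he, ih fun l => F (e x :: l)]

/-! ### First and second moments of sums -/

lemma avg_sum_map (hp : p ∈ stdSimplex ℝ α) (s : ℕ) (g : α → ℝ) :
    avg p s (fun l => (l.map g).sum) = s * ∑ x, p x * g x := by
  induction s with
  | zero => simp [avg_zero]
  | succ s ih =>
    simp only [avg_succ, List.map_cons, List.sum_cons, avg_add, avg_const hp, ih, mul_add,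
      Finset.sum_add_distrib, ← Finset.sum_mul, hp.2]
    push_cast; ring

lemma avg_sum_map_sq (hp : p ∈ stdSimplex ℝ α) (s : ℕ) (g : α → ℝ) :
    avg p s (fun l => (l.map g).sum ^ 2) =
      s * (∑ x, p x * g x ^ 2 - (∑ x, p x * g x) ^ 2) + (s * ∑ x, p x * g x) ^ 2 := by
  induction s with
  | zero => simp [avg_zero]
  | succ s ih =>
    have h : ∀ (x : α) (l : List α), (((x :: l).map g).sum) ^ 2 =
        g x ^ 2 + (2 * g x * (l.map g).sum + (l.map g).sum ^ 2) := by
      intro x l; simp only [List.map_cons, List.sum_cons]; ring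
    simp only [avg_succ, h, avg_add, avg_const hp, avg_mul_left, ih, avg_sum_map hp]
    set m := ∑ x, p x * g x
    have hsum : ∑ x, p x * (g x ^ 2 + (2 * g x * (s * m) +
        (s * (∑ x, p x * g x ^ 2 - m ^ 2) + (s * m) ^ 2))) =
        ∑ x, p x * g x ^ 2 + 2 * (s * m) * (∑ x, p x * g x) +
        (∑ x, p x) * (s * (∑ x, p x * g x ^ 2 - m ^ 2) + (s * m) ^ 2) := by
      simp only [Finset.mul_sum, Finset.sum_mul, ← Finset.sum_add_distrib]
      exact Finset.sum_congr rfl fun x _ => by ring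
    rw [hsum, hp.2]
    push_cast; ring

lemma avg_sum_map_sub_sq (hp : p ∈ stdSimplex ℝ α) (s : ℕ) (g : α → ℝ) :
    avg p s (fun l => ((l.map g).sum - s * ∑ x, p x * g x) ^ 2) =
      s * (∑ x, p x * g x ^ 2 - (∑ x, p x * g x) ^ 2) := by
  set m := ∑ x, p x * g x with hm
  have h : ∀ l : List α, ((l.map g).sum - s * m) ^ 2 =
      (l.map g).sum ^ 2 - (2 * (s * m)) * (l.map g).sum + (s * m) ^ 2 := by intro l; ring
  simp only [h, avg_add, avg_sub, avg_mul_left, avg_const hp, avg_sum_map_sq hp, avg_sum_map hp,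
    ← hm]
  ring

end Average

/-! ### Votes of consecutive blocks -/

/-- The number of blocks with property `φ` among the first `R` blocks of length `B`. -/
def blockCount {α : Type*} (φ : List α → Prop) (B : ℕ) : ℕ → List α → ℕ
  | 0, _ => 0
  | R + 1, l => (open Classical in if φ (l.take B) then 1 else 0) + blockCount φ B R (l.drop B)

lemma blockCount_add_not {α : Type*} (φ : List α → Prop) (B R : ℕ) (l : List α) :
    blockCount φ B R l + blockCount (fun l => ¬ φ l) B R l = R := by
  induction R generalizing l with
  | zero => rfl
  | succ R ih =>
    have := ih (l.drop B)
    by_cases h : φ (l.take B) <;> simp only [blockCount, h, not_true, not_false_iff, if_true,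
      if_false] <;> omega

section BlockCount

variable {α : Type*} [Fintype α] {p : α → ℝ}

lemma avg_pow_blockCount (hp : p ∈ stdSimplex ℝ α) (φ : List α → Prop) (B R : ℕ) {s : ℕ}
    (hs : B * R ≤ s) (x : ℝ) :
    avg p s (fun l => x ^ blockCount φ B R l) =
      (1 + (x - 1) * avg p B fun l => ind (φ l)) ^ R := by
  induction R generalizing s with
  | zero => simp [blockCount, avg_const hp]
  | succ R ih =>
    rw [mul_add, mul_one] at hs
    simp only [blockCount, pow_add]
    rw [avg_split (by omega) fun l l' => x ^ (open Classical in if φ l then 1 else 0) *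
      x ^ blockCount φ B R l']
    simp only [avg_mul_left, avg_mul_right, ih (show B * R ≤ s - B by omega)]
    rw [pow_one, mul_comm]
    congr 1
    have hpow : ∀ l : List α, x ^ (open Classical in if φ l then 1 else 0) =
        1 + (x - 1) * ind (φ l) := by
      intro l; by_cases h : φ l <;> simp [ind, h]
    simp only [hpow, avg_add, avg_const hp, avg_mul_left]

/-- Chernoff's method: Markov's inequality for `x ^ (a * blockCount φ B R l)`. -/
lemma avg_ind_le_mul_blockCount_le (hp : p ∈ stdSimplex ℝ α) (φ : List α → Prop) (B R : ℕ) {s : ℕ}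
    (hs : B * R ≤ s) (a b : ℕ) {x : ℝ} (hx : 1 ≤ x) :
    avg p s (fun l => ind (b * R ≤ a * blockCount φ B R l)) ≤
      ((1 + (x ^ a - 1) * avg p B fun l => ind (φ l)) / x ^ b) ^ R := by
  rw [div_pow, ← avg_pow_blockCount hp φ B R hs, le_div_iff₀ (by positivity), ← avg_mul_right]
  refine avg_mono hp.1 fun l => ?_
  by_cases h : b * R ≤ a * blockCount φ B R l
  · rw [ind_of h, one_mul, ← pow_mul, ← pow_mul]
    exact pow_le_pow_right₀ hx h
  · rw [ind_of_not h, zero_mul]; positivity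

end BlockCount

/-! ### Laws of independent samples as expectations -/

section Iid

variable {α β : Type} [Fintype α]

lemma pr_iid_bind_le (μ : PMF α) {γ : Type} {s : ℕ} {f : (Fin s → α) → PMF γ} {E : γ → Prop}
    {g : List α → ℝ} (h : ∀ X, pr (f X) E ≤ g (List.ofFn X)) :
    pr ((iidPMF μ s).bind f) E ≤ avg (wt μ) s g := by
  induction s generalizing g with
  | zero =>
    rw [iidPMF, PMF.pure_bind]
    simpa [avg_zero] using h Fin.elim0
  | succ s ih =>
    rw [iidPMF, PMF.bind_bind, pr_bind_eq_sum]
    refine Finset.sum_le_sum fun x _ => mul_le_mul_of_nonneg_left ?_ ENNReal.toReal_nonneg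
    rw [PMF.bind_bind]
    refine ih fun X => ?_
    rw [PMF.pure_bind]
    simpa [List.ofFn_succ] using h (Fin.cons x X)

lemma pr_iid_iid_bind_le (μ ν : PMF α) {γ : Type} {s : ℕ}
    {f : (Fin s → α) → (Fin s → α) → PMF γ} {E : γ → Prop} {g : List (α × α) → ℝ}
    (h : ∀ X Y, pr (f X Y) E ≤ g ((List.ofFn X).zip (List.ofFn Y))) :
    pr ((iidPMF μ s).bind fun X => (iidPMF ν s).bind fun Y => f X Y) E ≤
      avg (prodWt (wt μ) (wt ν)) s g := by
  rw [← avg_zip]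
  exact pr_iid_bind_le μ fun X => pr_iid_bind_le ν fun Y => h X Y

end Iid

/-! ### Linear statistics of two samples -/

section LinearStatistic

variable {α : Type*}

/-- The difference of the sums of the statistic `f` over the two samples paired in `l`. -/
def diffSum (f : α → ℝ) (l : List (α × α)) : ℝ := (l.map fun a => f a.1 - f a.2).sum

/-- The weighted difference of the histograms of the two samples paired in `l`. Trained on a part of
the samples, it serves as the statistic that separates the two distributions. -/
def score (ω : α → ℝ) (l : List (α × α)) (z : α) : ℝ := ω z * diffSum (fun y => ind (y = z)) l

lemma diffSum_nil (f : α → ℝ) : diffSum f [] = 0 := rfl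

lemma diffSum_cons (f : α → ℝ) (a : α × α) (l : List (α × α)) :
    diffSum f (a :: l) = f a.1 - f a.2 + diffSum f l := rfl

lemma diffSum_map_swap (f : α → ℝ) (l : List (α × α)) :
    diffSum f (l.map (Equiv.prodComm α α)) = -diffSum f l := by
  induction l with
  | nil => simp [diffSum_nil]
  | cons a l ih =>
    rw [List.map_cons, diffSum_cons, diffSum_cons, ih]
    simp only [Equiv.prodComm_apply, Prod.fst_swap, Prod.snd_swap]
    ring

variable [Fintype α]

lemma sum_mul_ind (f : α → ℝ) (y : α) : ∑ z, f z * ind (y = z) = f y := by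
  rw [Finset.sum_eq_single y] <;> simp +contextual [ind, eq_comm]

lemma sum_score_mul (ω d : α → ℝ) (l : List (α × α)) :
    ∑ z, score ω l z * d z = diffSum (fun z => ω z * d z) l := by
  induction l with
  | nil => simp [score, diffSum_nil]
  | cons a l ih =>
    rw [diffSum_cons, ← ih, ← sum_mul_ind (fun z => ω z * d z) a.1,
      ← sum_mul_ind (fun z => ω z * d z) a.2, ← Finset.sum_sub_distrib, ← Finset.sum_add_distrib]
    refine Finset.sum_congr rfl fun z _ => ?_
    simp only [score, diffSum_cons]
    ring

/-- The difference of the means of the statistic `f` under `p` and under `q`. -/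
def gap (p q f : α → ℝ) : ℝ := ∑ z, f z * (p z - q z)

/-- The sum of the second moments of the statistic `f` under `p` and under `q`. -/
def energy (p q f : α → ℝ) : ℝ := ∑ z, (p z + q z) * f z ^ 2

lemma gap_eq_sub (p q f : α → ℝ) : gap p q f = ∑ x, p x * f x - ∑ x, q x * f x := by
  simp only [gap, mul_sub, Finset.sum_sub_distrib, mul_comm]

lemma energy_eq_add (p q f : α → ℝ) :
    energy p q f = ∑ x, p x * f x ^ 2 + ∑ x, q x * f x ^ 2 := by
  simp only [energy, add_mul, Finset.sum_add_distrib]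

variable {p q : α → ℝ}

lemma energy_nonneg (hp : ∀ x, 0 ≤ p x) (hq : ∀ x, 0 ≤ q x) (f : α → ℝ) : 0 ≤ energy p q f :=
  Finset.sum_nonneg fun z _ => mul_nonneg (add_nonneg (hp z) (hq z)) (sq_nonneg _)

lemma sum_prodWt_mul_add (hp : p ∈ stdSimplex ℝ α) (hq : q ∈ stdSimplex ℝ α) (f g : α → ℝ) :
    ∑ z, prodWt p q z * (f z.1 + g z.2) = ∑ x, p x * f x + ∑ x, q x * g x := by
  rw [sum_prodWt_mul p q fun z => f z.1 + g z.2]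
  simp only [mul_add, Finset.sum_add_distrib, ← Finset.sum_mul, hq.2, hp.2, one_mul]

lemma sum_prodWt_mul_add_sq (hp : p ∈ stdSimplex ℝ α) (hq : q ∈ stdSimplex ℝ α) (f g : α → ℝ) :
    ∑ z, prodWt p q z * (f z.1 + g z.2) ^ 2 =
      ∑ x, p x * f x ^ 2 + ∑ x, q x * g x ^ 2 + 2 * (∑ x, p x * f x) * ∑ x, q x * g x := by
  have hexpand : ∀ z : α × α, prodWt p q z * (f z.1 + g z.2) ^ 2 =
      prodWt p q z * (f z.1 ^ 2 + g z.2 ^ 2) + 2 * (prodWt p q z * (f z.1 * g z.2)) := by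
    intro z; ring
  have hmixed : ∑ z, prodWt p q z * (f z.1 * g z.2) = (∑ x, p x * f x) * ∑ x, q x * g x := by
    rw [sum_prodWt_mul p q fun z => f z.1 * g z.2, Finset.sum_mul]
    refine Finset.sum_congr rfl fun x _ => ?_
    rw [mul_assoc, Finset.mul_sum (a := f x)]
    simp only [mul_left_comm]
  simp only [hexpand, Finset.sum_add_distrib, ← Finset.mul_sum, hmixed,
    sum_prodWt_mul_add hp hq (fun x => f x ^ 2) fun x => g x ^ 2, mul_assoc]

lemma avg_sum_map_add_sub_sq_le (hp : p ∈ stdSimplex ℝ α) (hq : q ∈ stdSimplex ℝ α) (s : ℕ)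
    (f g : α → ℝ) :
    avg (prodWt p q) s (fun l => ((l.map fun a => f a.1 + g a.2).sum -
      s * (∑ x, p x * f x + ∑ x, q x * g x)) ^ 2) ≤
      s * (∑ x, p x * f x ^ 2 + ∑ x, q x * g x ^ 2) := by
  have hvar := avg_sum_map_sub_sq (prodWt_mem_stdSimplex hp hq) s fun z : α × α => f z.1 + g z.2
  rw [sum_prodWt_mul_add hp hq, sum_prodWt_mul_add_sq hp hq] at hvar
  rw [hvar]
  refine mul_le_mul_of_nonneg_left ?_ s.cast_nonneg
  nlinarith only [sq_nonneg (∑ x, p x * f x), sq_nonneg (∑ x, q x * g x)]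

lemma avg_diffSum (hp : p ∈ stdSimplex ℝ α) (hq : q ∈ stdSimplex ℝ α) (s : ℕ) (f : α → ℝ) :
    avg (prodWt p q) s (fun l => diffSum f l) = s * gap p q f := by
  have h := avg_sum_map (prodWt_mem_stdSimplex hp hq) s fun z : α × α => f z.1 + -f z.2
  rw [sum_prodWt_mul_add hp hq f fun x => -f x] at h
  simpa only [diffSum, mul_neg, Finset.sum_neg_distrib, ← sub_eq_add_neg, ← gap_eq_sub] using h

lemma avg_diffSum_sub_sq_le (hp : p ∈ stdSimplex ℝ α) (hq : q ∈ stdSimplex ℝ α) (s : ℕ)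
    (f : α → ℝ) :
    avg (prodWt p q) s (fun l => (diffSum f l - s * gap p q f) ^ 2) ≤ s * energy p q f := by
  have h := avg_sum_map_add_sub_sq_le hp hq s f fun x => -f x
  simpa only [diffSum, neg_sq, mul_neg, Finset.sum_neg_distrib, ← sub_eq_add_neg, ← gap_eq_sub,
    ← energy_eq_add] using h

lemma avg_diffSum_sq_le (hp : p ∈ stdSimplex ℝ α) (hq : q ∈ stdSimplex ℝ α) (s : ℕ) (f : α → ℝ) :
    avg (prodWt p q) s (fun l => diffSum f l ^ 2) ≤
      s * energy p q f + (s * gap p q f) ^ 2 := by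
  have hvar := avg_diffSum_sub_sq_le hp hq s f
  set m := s * gap p q f with hm
  have hexpand : ∀ l : List (α × α), diffSum f l ^ 2 =
      (diffSum f l - m) ^ 2 + ((2 * m) * diffSum f l + -m ^ 2) := by intro l; ring
  simp only [hexpand]
  rw [avg_add, avg_add, avg_mul_left, avg_diffSum hp hq, ← hm,
    avg_const (prodWt_mem_stdSimplex hp hq)]
  linarith

/-! ### Trained scores -/

/-- The weighted squared distance of `p` and `q`: the gap expected of a score trained on one pair of
samples. -/
def sqDist (ω p q : α → ℝ) : ℝ := ∑ z, ω z * (p z - q z) ^ 2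

/-- The energy of the statistic `ω * (p - q)`, the expectation of a score trained on one pair of
samples. -/
def varDir (ω p q : α → ℝ) : ℝ := ∑ z, ω z ^ 2 * (p z + q z) * (p z - q z) ^ 2

/-- The weighted squared norm of `p + q`: the contribution of the noise of the histograms to the
energy of a score trained on one pair of samples. -/
def sqNorm (ω p q : α → ℝ) : ℝ := ∑ z, ω z ^ 2 * (p z + q z) ^ 2

lemma gap_mul_sub (ω p q : α → ℝ) : gap p q (fun z => ω z * (p z - q z)) = sqDist ω p q :=
  Finset.sum_congr rfl fun z _ => by ring

lemma energy_mul_sub (ω p q : α → ℝ) : energy p q (fun z => ω z * (p z - q z)) = varDir ω p q :=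
  Finset.sum_congr rfl fun z _ => by ring

lemma varDir_nonneg (hp : ∀ x, 0 ≤ p x) (hq : ∀ x, 0 ≤ q x) (ω : α → ℝ) : 0 ≤ varDir ω p q :=
  energy_mul_sub ω p q ▸ energy_nonneg hp hq _

lemma sqNorm_nonneg (ω : α → ℝ) : 0 ≤ sqNorm ω p q :=
  Finset.sum_nonneg fun _ _ => mul_nonneg (sq_nonneg _) (sq_nonneg _)

lemma avg_gap_score_sub_sq_le (hp : p ∈ stdSimplex ℝ α) (hq : q ∈ stdSimplex ℝ α) (ω : α → ℝ)
    (h : ℕ) :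
    avg (prodWt p q) h (fun l => (gap p q (score ω l) - h * sqDist ω p q) ^ 2) ≤
      h * varDir ω p q := by
  have hdev := avg_diffSum_sub_sq_le hp hq h fun z => ω z * (p z - q z)
  rw [gap_mul_sub, energy_mul_sub] at hdev
  simpa only [gap, sum_score_mul] using hdev

lemma avg_energy_score_le (hp : p ∈ stdSimplex ℝ α) (hq : q ∈ stdSimplex ℝ α) (ω : α → ℝ) (h : ℕ) :
    avg (prodWt p q) h (fun l => energy p q (score ω l)) ≤
      h * sqNorm ω p q + h ^ 2 * varDir ω p q := by
  simp only [energy, avg_sum, avg_mul_left, score, mul_pow, sqNorm, varDir, Finset.mul_sum,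
    ← Finset.sum_add_distrib]
  refine Finset.sum_le_sum fun z _ => ?_
  have hcount := avg_diffSum_sq_le hp hq h fun y => ind (y = z)
  have henergy : energy p q (fun y => ind (y = z)) = p z + q z := by
    rw [energy, Finset.sum_eq_single z] <;> simp +contextual [ind]
  have hgap : gap p q (fun y => ind (y = z)) = p z - q z := by
    rw [gap, Finset.sum_eq_single z] <;> simp +contextual [ind]
  rw [henergy, hgap] at hcount
  have hweight : 0 ≤ (p z + q z) * ω z ^ 2 :=
    mul_nonneg (add_nonneg (hp.1 z) (hq.1 z)) (sq_nonneg _)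
  linarith [mul_le_mul_of_nonneg_left hcount hweight]

lemma one_le_inv_sq_mul_sq {t a : ℝ} (ht : 0 < t) (h : t ≤ |a|) : 1 ≤ 1 / t ^ 2 * a ^ 2 := by
  rw [one_div_mul_eq_div, one_le_div (by positivity), ← sq_abs a]
  exact pow_le_pow_left₀ ht.le h 2

lemma le_sub_sq_add_energy {G K M g e : ℝ} (hM : 0 < M) (hK : 0 ≤ K) (he : 0 ≤ e) (hG : G ≤ 1)
    (hG' : 0 < g → G ≤ K * e / g ^ 2) :
    G ≤ 4 / M ^ 2 * (g - M) ^ 2 + 4 * K / M ^ 2 * e := by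
  rcases le_or_gt g (M / 2) with hg | hg
  · have hdev : 1 ≤ 4 / M ^ 2 * (g - M) ^ 2 := by
      rw [div_mul_eq_mul_div, le_div_iff₀ (by positivity)]
      nlinarith only [hM, hg]
    have : 0 ≤ 4 * K / M ^ 2 * e := by positivity
    linarith
  · have hM2 : 0 < M / 2 := half_pos hM
    calc G ≤ K * e / g ^ 2 := hG' (hM2.trans hg)
      _ ≤ K * e / (M / 2) ^ 2 := by gcongr
      _ = 4 * K / M ^ 2 * e := by field_simp; ring
      _ ≤ 4 / M ^ 2 * (g - M) ^ 2 + 4 * K / M ^ 2 * e := le_add_of_nonneg_left (by positivity)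

/-- By Chebyshev's inequality the gap of the trained score is at least half of its mean, except on
an event that the first summand accounts for. -/
lemma avg_score_le (hp : p ∈ stdSimplex ℝ α) (hq : q ∈ stdSimplex ℝ α) {ω : α → ℝ}
    {h : ℕ} (hh : 0 < h) (hN : 0 < sqDist ω p q) {G : (α → ℝ) → ℝ} {K : ℝ} (hK : 0 ≤ K)
    (hG : ∀ f, G f ≤ 1) (hG' : ∀ f, 0 < gap p q f → G f ≤ K * energy p q f / gap p q f ^ 2) :
    avg (prodWt p q) h (fun l => G (score ω l)) ≤
      4 * varDir ω p q / (h * sqDist ω p q ^ 2) +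
        4 * K * (sqNorm ω p q / h + varDir ω p q) / sqDist ω p q ^ 2 := by
  set N := sqDist ω p q
  calc avg (prodWt p q) h (fun l => G (score ω l))
      ≤ avg (prodWt p q) h fun l => 4 / (h * N) ^ 2 * (gap p q (score ω l) - h * N) ^ 2 +
          4 * K / (h * N) ^ 2 * energy p q (score ω l) :=
        avg_mono (prodWt_mem_stdSimplex hp hq).1 fun l => le_sub_sq_add_energy (by positivity) hK
          (energy_nonneg hp.1 hq.1 _) (hG _) (hG' _)
    _ ≤ 4 / (h * N) ^ 2 * (h * varDir ω p q) +
          4 * K / (h * N) ^ 2 * (h * sqNorm ω p q + h ^ 2 * varDir ω p q) := by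
        rw [avg_add, avg_mul_left, avg_mul_left]
        gcongr
        exacts [avg_gap_score_sub_sq_le hp hq ω h, avg_energy_score_le hp hq ω h]
    _ = _ := by field_simp

/-! ### One block of the equivalence test -/

/-- The score trained on the first `h` pairs is larger on the first sample than on the second, when
both are evaluated on the remaining pairs. -/
def blockPositive (h : ℕ) (l : List (α × α)) : Prop :=
  0 < diffSum (score (fun _ => 1) (l.take h)) (l.drop h)

/-- Swapping the two samples exchanges positive and negative values. -/
lemma avg_diffSum_pos_le_half (hp : p ∈ stdSimplex ℝ α) (f : α → ℝ) (s : ℕ) :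
    avg (prodWt p p) s (fun l => ind (0 < diffSum f l)) ≤ 1 / 2 := by
  have hpp := prodWt_mem_stdSimplex hp hp
  have hswap := avg_map_equiv (p := prodWt p p) (Equiv.prodComm α α)
    (fun x => by simp [prodWt, mul_comm]) s fun l => ind (0 < diffSum f l)
  simp only [diffSum_map_swap] at hswap
  have hdisjoint : avg (prodWt p p) s (fun l => ind (0 < -diffSum f l) +
      ind (0 < diffSum f l)) ≤ 1 := by
    rw [← avg_const hpp s 1]
    refine avg_mono hpp.1 fun l => ?_
    by_cases hl : 0 < diffSum f l
    · rw [ind_of hl, ind_of_not (by linarith)]; simp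
    · rw [ind_of_not hl]; simpa using ind_le_one _
  rw [avg_add, hswap] at hdisjoint
  linarith

lemma avg_blockPositive_le_half (hp : p ∈ stdSimplex ℝ α) (h : ℕ) :
    avg (prodWt p p) (2 * h) (fun l => ind (blockPositive h l)) ≤ 1 / 2 := by
  have hpp := prodWt_mem_stdSimplex hp hp
  unfold blockPositive
  rw [avg_split (by omega) fun l l' => ind (0 < diffSum (score (fun _ => 1) l) l'),
    ← avg_const hpp h (1 / 2)]
  exact avg_mono hpp.1 fun l => avg_diffSum_pos_le_half hp _ _

lemma avg_not_diffSum_pos_le (hp : p ∈ stdSimplex ℝ α) (hq : q ∈ stdSimplex ℝ α) {h : ℕ}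
    (hh : 0 < h) {f : α → ℝ} (hf : 0 < gap p q f) :
    avg (prodWt p q) h (fun l => ind (¬ 0 < diffSum f l)) ≤
      1 / h * energy p q f / gap p q f ^ 2 := by
  have hh' : (0 : ℝ) < h := by exact_mod_cast hh
  have hmean : 0 < h * gap p q f := mul_pos hh' hf
  calc avg (prodWt p q) h (fun l => ind (¬ 0 < diffSum f l))
      ≤ avg (prodWt p q) h fun l =>
          1 / (h * gap p q f) ^ 2 * (diffSum f l - h * gap p q f) ^ 2 :=
        avg_mono (prodWt_mem_stdSimplex hp hq).1 fun l => ind_le (by positivity) fun hl =>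
          one_le_inv_sq_mul_sq hmean <| by
            rw [abs_sub_comm]; exact le_trans (by linarith) (le_abs_self _)
    _ ≤ 1 / (h * gap p q f) ^ 2 * (h * energy p q f) := by
        rw [avg_mul_left]
        exact mul_le_mul_of_nonneg_left (avg_diffSum_sub_sq_le hp hq h f) (by positivity)
    _ = _ := by field_simp

lemma avg_not_blockPositive_le (hp : p ∈ stdSimplex ℝ α) (hq : q ∈ stdSimplex ℝ α) {h : ℕ}
    (hh : 0 < h) (hN : 0 < sqDist (fun _ => 1) p q) :
    avg (prodWt p q) (2 * h) (fun l => ind (¬ blockPositive h l)) ≤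
      8 * varDir (fun _ => 1) p q / (h * sqDist (fun _ => 1) p q ^ 2) +
        4 * sqNorm (fun _ => 1) p q / (h ^ 2 * sqDist (fun _ => 1) p q ^ 2) := by
  have hpq := prodWt_mem_stdSimplex hp hq
  unfold blockPositive
  rw [avg_split (by omega) fun l l' => ind (¬ 0 < diffSum (score (fun _ => 1) l) l'),
    show 2 * h - h = h by omega]
  refine (avg_score_le hp hq hh hN (K := 1 / h)
    (G := fun f => avg (prodWt p q) h fun l => ind (¬ 0 < diffSum f l)) (by positivity)
    (fun f => ?_) fun f hf => avg_not_diffSum_pos_le hp hq hh hf).trans_eq ?_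
  · rw [← avg_const hpq h 1]
    exact avg_mono hpq.1 fun l => ind_le_one _
  · field_simp; ring

/-! ### One block of the likelihood-free test -/

/-- The mean of `f` over the `h` elements of `Z` is at least the average of its means over the two
samples of size `s` paired in `l`, with the denominators cleared. -/
def vote (f : α → ℝ) (s h : ℕ) (l : List (α × α)) (Z : List α) : Prop :=
  h * (l.map fun a => f a.1 + f a.2).sum ≤ 2 * s * (Z.map f).sum

lemma avg_sum_map_sub_sq_le_energy {u : α → ℝ} (hu : u ∈ stdSimplex ℝ α)
    (hupq : ∀ x, u x ≤ p x + q x) (h : ℕ) (f : α → ℝ) :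
    avg u h (fun Z => ((Z.map f).sum - h * ∑ x, u x * f x) ^ 2) ≤ h * energy p q f := by
  have hmoment : ∑ x, u x * f x ^ 2 ≤ energy p q f :=
    Finset.sum_le_sum fun x _ => mul_le_mul_of_nonneg_right (hupq x) (sq_nonneg _)
  rw [avg_sum_map_sub_sq hu h f]
  exact mul_le_mul_of_nonneg_left (by linarith [sq_nonneg (∑ x, u x * f x)]) h.cast_nonneg

/-- A wrong vote, `W`, requires one of the two sums to deviate from its mean. -/
lemma avg_vote_error_le (hp : p ∈ stdSimplex ℝ α) (hq : q ∈ stdSimplex ℝ α) {u : α → ℝ}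
    (hu : u ∈ stdSimplex ℝ α) (hupq : ∀ x, u x ≤ p x + q x) {f : α → ℝ} (hg : 0 < gap p q f)
    {s h : ℕ} (hs : 0 < s) (hh : 0 < h) {W : List (α × α) → List α → Prop}
    (hW : ∀ l Z, W l Z →
      s * gap p q f / 2 ≤
          |(l.map fun a => f a.1 + f a.2).sum - s * (∑ x, p x * f x + ∑ x, q x * f x)| ∨
        h * gap p q f / 4 ≤ |(Z.map f).sum - h * ∑ x, u x * f x|) :
    (avg (prodWt p q) s fun l => avg u h fun Z => ind (W l Z)) ≤
      (16 / h + 4 / s) * energy p q f / gap p q f ^ 2 := by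
  have hpq := prodWt_mem_stdSimplex hp hq
  set g := gap p q f
  set A : List (α × α) → ℝ := fun l =>
    (l.map fun a => f a.1 + f a.2).sum - s * (∑ x, p x * f x + ∑ x, q x * f x)
  set B : List α → ℝ := fun Z => (Z.map f).sum - h * ∑ x, u x * f x
  have hunion : ∀ l Z, ind (W l Z) ≤
      1 / (s * g / 2) ^ 2 * A l ^ 2 + 1 / (h * g / 4) ^ 2 * B Z ^ 2 := by
    intro l Z
    refine ind_le (by positivity) fun hWl => ?_
    rcases hW l Z hWl with hA | hB
    · exact (one_le_inv_sq_mul_sq (by positivity) hA).trans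
        (le_add_of_nonneg_right (by positivity))
    · exact (one_le_inv_sq_mul_sq (by positivity) hB).trans
        (le_add_of_nonneg_left (by positivity))
  refine (avg_mono hpq.1 fun l => avg_mono hu.1 (hunion l)).trans ?_
  simp only [avg_add, avg_const hu, avg_mul_left, avg_const hpq]
  have hA := avg_sum_map_add_sub_sq_le hp hq s f f
  rw [← energy_eq_add] at hA
  have hB := avg_sum_map_sub_sq_le_energy hu hupq h f
  refine (add_le_add (mul_le_mul_of_nonneg_left hA (by positivity))
    (mul_le_mul_of_nonneg_left hB (by positivity))).trans_eq ?_
  field_simp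
  ring

lemma avg_not_vote_le (hp : p ∈ stdSimplex ℝ α) (hq : q ∈ stdSimplex ℝ α) {f : α → ℝ}
    (hg : 0 < gap p q f) {s h : ℕ} (hs : 0 < s) (hh : 0 < h) :
    (avg (prodWt p q) s fun l => avg p h fun Z => ind (¬ vote f s h l Z)) ≤
      (16 / h + 4 / s) * energy p q f / gap p q f ^ 2 := by
  refine avg_vote_error_le hp hq hp (fun x => by linarith [hq.1 x]) hg hs hh fun l Z hv => ?_
  have hh' : (0 : ℝ) < h := by exact_mod_cast hh
  have hs' : (0 : ℝ) < s := by exact_mod_cast hs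
  unfold vote at hv
  by_contra! hAB
  simp only [abs_lt, gap_eq_sub] at hAB
  nlinarith [mul_lt_mul_of_pos_left hAB.1.2 hh', mul_lt_mul_of_pos_left hAB.2.1 hs']

lemma avg_vote_le (hp : p ∈ stdSimplex ℝ α) (hq : q ∈ stdSimplex ℝ α) {f : α → ℝ}
    (hg : 0 < gap p q f) {s h : ℕ} (hs : 0 < s) (hh : 0 < h) :
    (avg (prodWt p q) s fun l => avg q h fun Z => ind (vote f s h l Z)) ≤
      (16 / h + 4 / s) * energy p q f / gap p q f ^ 2 := by
  refine avg_vote_error_le hp hq hq (fun x => by linarith [hp.1 x]) hg hs hh fun l Z hv => ?_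
  have hh' : (0 : ℝ) < h := by exact_mod_cast hh
  have hs' : (0 : ℝ) < s := by exact_mod_cast hs
  unfold vote at hv
  by_contra! hAB
  simp only [abs_lt, gap_eq_sub] at hAB
  nlinarith [mul_lt_mul_of_pos_left hAB.1.1 hh', mul_lt_mul_of_pos_left hAB.2.2 hs']

end LinearStatistic

/-! ### Weights from the histogram of two samples -/

section HistWeight

variable {α : Type*} [DecidableEq α]

/-- The multiplicity of `z` in the two samples paired in `l`, taken together. -/
def pairCount (l : List (α × α)) (z : α) : ℕ := (l.map Prod.fst).count z + (l.map Prod.snd).count z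

/-- The weight given to `z` by the two samples paired in `l`. The summand `1` keeps it finite, and
makes it a proxy for `1 / (s * (p z + q z) + 1)`. -/
def histWeight (l : List (α × α)) (z : α) : ℝ := 1 / ((pairCount l z : ℝ) + 1)

lemma histWeight_pos (l : List (α × α)) (z : α) : 0 < histWeight l z := by
  unfold histWeight; positivity

lemma histWeight_le_fst (l : List (α × α)) (z : α) :
    histWeight l z ≤ 1 / (((l.map Prod.fst).count z : ℝ) + 1) := by
  unfold histWeight pairCount; gcongr; simp

lemma histWeight_le_snd (l : List (α × α)) (z : α) :
    histWeight l z ≤ 1 / (((l.map Prod.snd).count z : ℝ) + 1) := by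
  unfold histWeight pairCount; gcongr; simp

/-! ### Negative moments of multiplicities -/

variable [Fintype α] {p q : α → ℝ}

lemma avg_count_succ (hp : p ∈ stdSimplex ℝ α) (z : α) (s : ℕ) (g : ℕ → ℝ) :
    avg p (s + 1) (fun l => g (l.count z)) =
      p z * avg p s (fun l => g (l.count z + 1)) + (1 - p z) * avg p s fun l => g (l.count z) := by
  have hsummand : ∀ x, p x * avg p s (fun l => g ((x :: l).count z)) =
      p x * avg p s (fun l => g (l.count z)) + (if x = z then p z *
        (avg p s (fun l => g (l.count z + 1)) - avg p s fun l => g (l.count z)) else 0) := by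
    intro x
    by_cases hx : x = z
    · subst hx
      simp only [List.count_cons_self, if_true]
      ring
    · simp [hx]
  rw [avg_succ, Finset.sum_congr rfl fun x _ => hsummand x, Finset.sum_add_distrib,
    ← Finset.sum_mul, hp.2, Finset.sum_ite_eq' Finset.univ z, if_pos (Finset.mem_univ z)]
  ring

lemma avg_count_mul (hp : p ∈ stdSimplex ℝ α) (z : α) (s : ℕ) (g : ℕ → ℝ) :
    avg p (s + 1) (fun l => l.count z * g (l.count z)) =
      (s + 1) * p z * avg p s fun l => g (l.count z + 1) := by
  induction s generalizing g with
  | zero =>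
    rw [avg_count_succ hp z 0 fun c => (c : ℝ) * g c]
    simp [avg_zero]
  | succ s ih =>
    have hadd : avg p (s + 1) (fun l => ((l.count z + 1 : ℕ) : ℝ) * g (l.count z + 1)) =
        avg p (s + 1) (fun l => l.count z * g (l.count z + 1)) +
          avg p (s + 1) fun l => g (l.count z + 1) := by
      rw [← avg_add]
      exact avg_congr fun l _ => by push_cast; ring
    rw [avg_count_succ hp z (s + 1) fun c => (c : ℝ) * g c, hadd, ih g, ih fun c => g (c + 1),
      avg_count_succ hp z s fun c => g (c + 1)]
    push_cast
    ring

lemma avg_count (hp : p ∈ stdSimplex ℝ α) (s : ℕ) (z : α) :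
    avg p s (fun l => (l.count z : ℝ)) = s * p z := by
  cases s with
  | zero => simp [avg_zero]
  | succ s => simpa [avg_const hp] using avg_count_mul hp z s fun _ => 1

lemma avg_pairCount (hp : p ∈ stdSimplex ℝ α) (hq : q ∈ stdSimplex ℝ α) (s : ℕ) (z : α) :
    avg (prodWt p q) s (fun l => (pairCount l z : ℝ)) = s * (p z + q z) := by
  simp only [pairCount, Nat.cast_add, avg_add]
  rw [avg_map_fst hq s fun l => (l.count z : ℝ), avg_map_snd hp s fun l => (l.count z : ℝ),
    avg_count hp, avg_count hq]
  ring

lemma mul_avg_inv_count_le (hp : p ∈ stdSimplex ℝ α) (z : α) (s : ℕ) :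
    (s + 1) * p z * avg p s (fun l => 1 / ((l.count z : ℝ) + 1)) ≤ 1 := by
  have h := avg_count_mul hp z s fun c => 1 / (c : ℝ)
  push_cast at h
  refine h ▸ (avg_mono hp.1 fun l => ?_).trans_eq (avg_const hp (s + 1) 1)
  rw [mul_one_div]
  exact div_self_le_one _

lemma mul_avg_inv_count_mul_le (hp : p ∈ stdSimplex ℝ α) (z : α) (s : ℕ) :
    (s + 1) * (s + 2) * p z ^ 2 *
      avg p s (fun l => 1 / (((l.count z : ℝ) + 1) * ((l.count z : ℝ) + 2))) ≤ 1 := by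
  have hshift := avg_count_mul hp z s fun c => 1 / ((c : ℝ) * (c + 1))
  have hcast : ∀ c : ℝ, c + 1 + 1 = c + 2 := fun c => by ring
  push_cast at hshift
  simp only [hcast] at hshift
  have hcancel : avg p (s + 1) (fun l => (l.count z : ℝ) * (1 / (l.count z * (l.count z + 1)))) ≤
      avg p (s + 1) fun l => 1 / ((l.count z : ℝ) + 1) := by
    refine avg_mono hp.1 fun l => ?_
    rcases (l.count z).eq_zero_or_pos with hc | hc
    · simp [hc]
    · have : (0 : ℝ) < l.count z := by exact_mod_cast hc
      exact le_of_eq (by field_simp)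
  rw [hshift] at hcancel
  have hfirst := mul_avg_inv_count_le hp z (s + 1)
  push_cast at hfirst
  have hnonneg : 0 ≤ ((s : ℝ) + 2) * p z := mul_nonneg (by positivity) (hp.1 z)
  linarith [mul_le_mul_of_nonneg_left hcancel hnonneg]

lemma avg_inv_count_sq_le (hp : p ∈ stdSimplex ℝ α) (z : α) (s : ℕ) :
    avg p s (fun l => (1 / ((l.count z : ℝ) + 1)) ^ 2) ≤ 8 / (s * p z + 1) ^ 2 := by
  have hz := hp.1 z
  have hsz : 0 ≤ s * p z := by positivity
  rcases le_or_gt (s * p z) 1 with h | h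
  · calc avg p s (fun l => (1 / ((l.count z : ℝ) + 1)) ^ 2) ≤ avg p s fun _ => 1 :=
          avg_mono hp.1 fun l => pow_le_one₀ (by positivity) (by
            rw [div_le_one (by positivity)]; linarith [(l.count z).cast_nonneg (α := ℝ)])
      _ = 1 := avg_const hp s 1
      _ ≤ 8 / (s * p z + 1) ^ 2 := by
          rw [one_le_div (by positivity)]; nlinarith
  · have hmul := mul_avg_inv_count_mul_le hp z s
    set A := avg p s fun l => 1 / (((l.count z : ℝ) + 1) * ((l.count z : ℝ) + 2))
    have hle : avg p s (fun l => (1 / ((l.count z : ℝ) + 1)) ^ 2) ≤ 2 * A := by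
      rw [← avg_mul_left]
      refine avg_mono hp.1 fun l => ?_
      rw [one_div_pow, mul_one_div, div_le_div_iff₀ (by positivity) (by positivity)]
      nlinarith [(l.count z).cast_nonneg (α := ℝ)]
    have hA : 0 ≤ A := avg_nonneg hp.1 fun l => by positivity
    have hsA : (s * p z) ^ 2 * A ≤ 1 := by
      refine le_trans (mul_le_mul_of_nonneg_right ?_ hA) hmul
      nlinarith [sq_nonneg (p z), (s.cast_nonneg : (0 : ℝ) ≤ s)]
    rw [le_div_iff₀ (by positivity)]
    calc _ ≤ 2 * A * (2 * (s * p z)) ^ 2 := by gcongr; linarith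
      _ ≤ 8 := by linarith

lemma div_sq_le_of_le_of_le {x y c t : ℝ} (hx : 0 ≤ x) (hy : 0 ≤ y) (hc : 0 ≤ c)
    (htx : t ≤ c / (x + 1) ^ 2) (hty : t ≤ c / (y + 1) ^ 2) : t ≤ 4 * c / (x + y + 1) ^ 2 := by
  wlog hxy : x ≤ y generalizing x y
  · simpa [add_comm x y] using this hy hx hty htx (le_of_not_ge hxy)
  calc t ≤ c / (y + 1) ^ 2 := hty
    _ = 4 * c / (2 * (y + 1)) ^ 2 := by field_simp; ring
    _ ≤ 4 * c / (x + y + 1) ^ 2 := by gcongr; linarith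

lemma avg_histWeight_sq_le (hp : p ∈ stdSimplex ℝ α) (hq : q ∈ stdSimplex ℝ α) (s : ℕ) (z : α) :
    avg (prodWt p q) s (fun l => histWeight l z ^ 2) ≤ 32 / (s * (p z + q z) + 1) ^ 2 := by
  have hpq := prodWt_mem_stdSimplex hp hq
  have hfst : avg (prodWt p q) s (fun l => histWeight l z ^ 2) ≤ 8 / (s * p z + 1) ^ 2 :=
    (avg_mono hpq.1 fun l =>
      pow_le_pow_left₀ (histWeight_pos l z).le (histWeight_le_fst l z) 2).trans
      ((avg_map_fst hq s fun l => (1 / ((l.count z : ℝ) + 1)) ^ 2).trans_le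
        (avg_inv_count_sq_le hp z s))
  have hsnd : avg (prodWt p q) s (fun l => histWeight l z ^ 2) ≤ 8 / (s * q z + 1) ^ 2 :=
    (avg_mono hpq.1 fun l =>
      pow_le_pow_left₀ (histWeight_pos l z).le (histWeight_le_snd l z) 2).trans
      ((avg_map_snd hp s fun l => (1 / ((l.count z : ℝ) + 1)) ^ 2).trans_le
        (avg_inv_count_sq_le hq z s))
  have h := div_sq_le_of_le_of_le (mul_nonneg s.cast_nonneg (hp.1 z))
    (mul_nonneg s.cast_nonneg (hq.1 z)) (by norm_num) hfst hsnd
  rwa [← mul_add, show (4 * 8 : ℝ) = 32 by norm_num] at h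

end HistWeight

/-! ### Histogram weights are close to the ideal ones -/

section GoodWeight

variable {α : Type*} [Fintype α] {p q : α → ℝ}

/-- The squared distance of `p` and `q` for the ideal weights `1 / (s * (p z + q z) + 1)`, which
balance the variance of the histograms and their expected size. -/
def idealDist (s : ℕ) (p q : α → ℝ) : ℝ := ∑ z, (p z - q z) ^ 2 / (s * (p z + q z) + 1)

/-- The weights `ω` are as good, up to the factor `K`, as the ideal ones for samples of size `s`. -/
structure GoodWeight (K : ℝ) (s : ℕ) (p q ω : α → ℝ) : Prop where
  sqDist_ge : idealDist s p q ≤ K * sqDist ω p q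
  varDir_le : s * varDir ω p q ≤ K * idealDist s p q
  sqNorm_le : s * (Fintype.card α + s) * sqNorm ω p q ≤ K * Fintype.card α

lemma mul_add_add_one_pos {ι : Type*} {p q : ι → ℝ} (hp : ∀ z, 0 ≤ p z) (hq : ∀ z, 0 ≤ q z)
    (s : ℕ) (z : ι) : 0 < s * (p z + q z) + 1 := by
  have := hp z; have := hq z; positivity

lemma le_mul_idealDist (hp : p ∈ stdSimplex ℝ α) (hq : q ∈ stdSimplex ℝ α) (s : ℕ) {ε : ℝ}
    (hε : 0 ≤ ε) (h : 2 * ε ≤ ∑ z, |p z - q z|) :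
    2 * ε ^ 2 ≤ (Fintype.card α + s) * idealDist s p q := by
  have hden := mul_add_add_one_pos hp.1 hq.1 s
  have hcs : (∑ z, |p z - q z|) ^ 2 ≤ (∑ z, (s * (p z + q z) + 1)) * idealDist s p q :=
    Finset.sum_sq_le_sum_mul_sum_of_sq_le_mul _ (fun z _ => (hden z).le)
      (fun z _ => div_nonneg (sq_nonneg _) (hden z).le)
      fun z _ => by rw [sq_abs, mul_div_cancel₀ _ (hden z).ne']
  have hmass : ∑ z, (s * (p z + q z) + 1) = 2 * s + (Fintype.card α : ℝ) := by
    rw [Finset.sum_add_distrib, ← Finset.mul_sum, Finset.sum_add_distrib, hp.2, hq.2]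
    simp only [Finset.sum_const, Finset.card_univ, nsmul_eq_mul, mul_one]
    ring
  have hsq : (2 * ε) ^ 2 ≤ (∑ z, |p z - q z|) ^ 2 := pow_le_pow_left₀ (by positivity) h 2
  have hL : 0 ≤ idealDist s p q := Finset.sum_nonneg fun z _ =>
    div_nonneg (sq_nonneg _) (hden z).le
  rw [hmass] at hcs
  linarith [mul_nonneg (Nat.cast_nonneg (α := ℝ) (Fintype.card α)) hL]

lemma div_mul_add_one_le_inv {s x : ℝ} (hs : 0 < s) (hx : 0 ≤ x) : x / (s * x + 1) ≤ 1 / s := by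
  rw [div_le_div_iff₀ (by positivity) hs]
  linarith

lemma sum_div_sq_le (hp : p ∈ stdSimplex ℝ α) (hq : q ∈ stdSimplex ℝ α) {s : ℕ} (hs : 0 < s) :
    ∑ z, ((p z + q z) / (s * (p z + q z) + 1)) ^ 2 ≤
      3 * (Fintype.card α : ℝ) / (s * (Fintype.card α + s)) := by
  have hs' : (0 : ℝ) < s := by exact_mod_cast hs
  have hmass : ∀ z, 0 ≤ p z + q z := fun z => add_nonneg (hp.1 z) (hq.1 z)
  have hden := mul_add_add_one_pos hp.1 hq.1 s
  have hratio : ∀ z, 0 ≤ (p z + q z) / (s * (p z + q z) + 1) := fun z =>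
    div_nonneg (hmass z) (hden z).le
  set n : ℝ := (Fintype.card α : ℝ)
  have hn0 : 0 ≤ n := Nat.cast_nonneg _
  rcases le_total n (2 * s) with h | h
  · calc ∑ z, ((p z + q z) / (s * (p z + q z) + 1)) ^ 2 ≤ ∑ _z : α, (1 / s : ℝ) ^ 2 :=
          Finset.sum_le_sum fun z _ =>
            pow_le_pow_left₀ (hratio z) (div_mul_add_one_le_inv hs' (hmass z)) 2
      _ = n / s ^ 2 := by
          rw [Finset.sum_const, Finset.card_univ, nsmul_eq_mul, one_div_pow, mul_one_div]
      _ ≤ 3 * n / (s * (n + s)) := by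
          rw [div_le_div_iff₀ (by positivity) (by positivity)]
          nlinarith [mul_nonneg (mul_nonneg hs'.le hn0) (sub_nonneg.2 h)]
  · calc ∑ z, ((p z + q z) / (s * (p z + q z) + 1)) ^ 2 ≤ ∑ z, (p z + q z) * (1 / s) :=
          Finset.sum_le_sum fun z _ => by
            rw [sq]
            exact mul_le_mul (div_le_self (hmass z) (by linarith [mul_nonneg hs'.le (hmass z)]))
              (div_mul_add_one_le_inv hs' (hmass z)) (hratio z) (hmass z)
      _ = 2 / s := by rw [← Finset.sum_mul, Finset.sum_add_distrib, hp.2, hq.2]; ring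
      _ ≤ 3 * n / (s * (n + s)) := by
          rw [div_le_div_iff₀ (by positivity) (by positivity)]
          nlinarith [mul_nonneg hs'.le (sub_nonneg.2 h)]

section DecidableEq

variable [DecidableEq α]

/-- The dual quantity in the Cauchy–Schwarz inequality that bounds `sqDist` for the histogram
weights from below; it is linear in the multiplicities. -/
def dualDist (s : ℕ) (p q : α → ℝ) (l : List (α × α)) : ℝ :=
  ∑ z, (p z - q z) ^ 2 / (s * (p z + q z) + 1) ^ 2 * ((pairCount l z : ℝ) + 1)

lemma idealDist_sq_le (hp : ∀ z, 0 ≤ p z) (hq : ∀ z, 0 ≤ q z) (s : ℕ) (l : List (α × α)) :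
    idealDist s p q ^ 2 ≤ sqDist (histWeight l) p q * dualDist s p q l := by
  refine Finset.sum_sq_le_sum_mul_sum_of_sq_le_mul _
    (fun z _ => mul_nonneg (histWeight_pos l z).le (sq_nonneg _)) (fun z _ => by positivity)
    fun z _ => ?_
  have hden := mul_add_add_one_pos hp hq s z
  unfold histWeight
  exact le_of_eq (by field_simp)

lemma avg_dualDist (hp : p ∈ stdSimplex ℝ α) (hq : q ∈ stdSimplex ℝ α) (s : ℕ) :
    avg (prodWt p q) s (dualDist s p q) = idealDist s p q := by
  unfold dualDist
  simp only [avg_sum, avg_mul_left, avg_add, avg_const (prodWt_mem_stdSimplex hp hq),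
    avg_pairCount hp hq]
  refine Finset.sum_congr rfl fun z _ => ?_
  have hden := mul_add_add_one_pos hp.1 hq.1 s z
  field_simp

lemma avg_varDir_histWeight_le (hp : p ∈ stdSimplex ℝ α) (hq : q ∈ stdSimplex ℝ α) {s : ℕ}
    (hs : 0 < s) :
    avg (prodWt p q) s (fun l => varDir (histWeight l) p q) ≤ 32 * idealDist s p q / s := by
  simp only [varDir, avg_sum, avg_mul_right]
  rw [idealDist, Finset.mul_sum, Finset.sum_div]
  refine Finset.sum_le_sum fun z _ => ?_
  have hs' : (0 : ℝ) < s := by exact_mod_cast hs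
  have hmass : 0 ≤ p z + q z := add_nonneg (hp.1 z) (hq.1 z)
  have := mul_add_add_one_pos hp.1 hq.1 s z
  calc _ ≤ 32 / (s * (p z + q z) + 1) ^ 2 * (p z + q z) * (p z - q z) ^ 2 := by
        gcongr; exact avg_histWeight_sq_le hp hq s z
    _ = 32 * (p z - q z) ^ 2 / (s * (p z + q z) + 1) *
          ((p z + q z) / (s * (p z + q z) + 1)) := by field_simp
    _ ≤ 32 * (p z - q z) ^ 2 / (s * (p z + q z) + 1) * (1 / s) := by
        exact mul_le_mul_of_nonneg_left (div_mul_add_one_le_inv hs' hmass) (by positivity)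
    _ = _ := by field_simp

lemma avg_sqNorm_histWeight_le (hp : p ∈ stdSimplex ℝ α) (hq : q ∈ stdSimplex ℝ α) {s : ℕ}
    (hs : 0 < s) :
    avg (prodWt p q) s (fun l => sqNorm (histWeight l) p q) ≤
      96 * Fintype.card α / (s * (Fintype.card α + s)) := by
  simp only [sqNorm, avg_sum, avg_mul_right]
  calc ∑ z, avg (prodWt p q) s (fun l => histWeight l z ^ 2) * (p z + q z) ^ 2 ≤
        ∑ z, 32 * ((p z + q z) / (s * (p z + q z) + 1)) ^ 2 :=
        Finset.sum_le_sum fun z _ => by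
          refine (mul_le_mul_of_nonneg_right (avg_histWeight_sq_le hp hq s z)
            (sq_nonneg (p z + q z))).trans_eq ?_
          rw [div_pow]; ring
    _ ≤ 32 * (3 * (Fintype.card α : ℝ) / (s * (Fintype.card α + s))) := by
        rw [← Finset.mul_sum]; gcongr; exact sum_div_sq_le hp hq hs
    _ = _ := by ring

lemma goodWeight_histWeight (hp : ∀ z, 0 ≤ p z) (hq : ∀ z, 0 ≤ q z) {s : ℕ} {K : ℝ}
    (hL : 0 < idealDist s p q) {l : List (α × α)}
    (hdual : dualDist s p q l ≤ K * idealDist s p q)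
    (hvar : s * varDir (histWeight l) p q ≤ K * idealDist s p q)
    (hnorm : s * (Fintype.card α + s) * sqNorm (histWeight l) p q ≤ K * Fintype.card α) :
    GoodWeight K s p q (histWeight l) := by
  refine ⟨?_, hvar, hnorm⟩
  have hN : 0 ≤ sqDist (histWeight l) p q := Finset.sum_nonneg fun z _ =>
    mul_nonneg (histWeight_pos l z).le (sq_nonneg _)
  have hcs := (idealDist_sq_le hp hq s l).trans (mul_le_mul_of_nonneg_left hdual hN)
  exact le_of_mul_le_mul_left (by linarith) hL

/-- A union bound over the three conditions, with Markov's inequality for each of them. -/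
lemma avg_not_goodWeight_le (hp : p ∈ stdSimplex ℝ α) (hq : q ∈ stdSimplex ℝ α) {s : ℕ}
    (hs : 0 < s) (hL : 0 < idealDist s p q) {K : ℝ} (hK : 0 < K) :
    avg (prodWt p q) s (fun l => ind (¬ GoodWeight K s p q (histWeight l))) ≤ 129 / K := by
  have hcard : (0 : ℝ) < Fintype.card α := by
    exact_mod_cast Finset.card_pos.2 (Finset.nonempty_of_sum_ne_zero hL.ne')
  set L := idealDist s p q
  set n : ℝ := (Fintype.card α : ℝ)
  have hunion : ∀ l, ind (¬ GoodWeight K s p q (histWeight l)) ≤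
      1 / (K * L) * dualDist s p q l + (s / (K * L) * varDir (histWeight l) p q +
        s * (n + s) / (K * n) * sqNorm (histWeight l) p q) := by
    intro l
    have hdual : 0 ≤ 1 / (K * L) * dualDist s p q l :=
      mul_nonneg (by positivity) (Finset.sum_nonneg fun z _ => by positivity)
    have hvar : 0 ≤ s / (K * L) * varDir (histWeight l) p q :=
      mul_nonneg (by positivity) (varDir_nonneg hp.1 hq.1 _)
    have hnorm : 0 ≤ s * (n + s) / (K * n) * sqNorm (histWeight l) p q :=
      mul_nonneg (by positivity) (sqNorm_nonneg _)
    refine ind_le (by positivity) fun hl => ?_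
    by_contra! hlt
    refine hl (goodWeight_histWeight hp.1 hq.1 hL ?_ ?_ ?_)
    · have h1 : 1 / (K * L) * dualDist s p q l ≤ 1 := by linarith
      rwa [one_div_mul_eq_div, div_le_one (by positivity)] at h1
    · have h1 : s / (K * L) * varDir (histWeight l) p q ≤ 1 := by linarith
      rwa [div_mul_eq_mul_div, div_le_one (by positivity)] at h1
    · have h1 : s * (n + s) / (K * n) * sqNorm (histWeight l) p q ≤ 1 := by linarith
      rwa [div_mul_eq_mul_div, div_le_one (by positivity)] at h1
  calc _ ≤ 1 / (K * L) * L + (s / (K * L) * (32 * L / s) +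
        s * (n + s) / (K * n) * (96 * n / (s * (n + s)))) := by
        refine (avg_mono (prodWt_mem_stdSimplex hp hq).1 hunion).trans ?_
        rw [avg_add, avg_add, avg_mul_left, avg_mul_left, avg_mul_left, avg_dualDist hp hq]
        gcongr
        exacts [avg_varDir_histWeight_le hp hq hs, avg_sqNorm_histWeight_le hp hq hs]
    _ = 129 / K := by field_simp; norm_num

end DecidableEq

/-! ### Scores trained with histogram weights -/

lemma div_le_of_varDir_le {s h m M N K L V ε : ℝ} (hs : 0 < s) (hh : 0 < h) (hm : 0 < m)
    (hM : 0 < M) (hN : 0 < N) (hK : 0 < K) (hL : 0 < L) (hLN : L ≤ K * N)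
    (hVL : s * V ≤ K * L) (hsh : M * m ≤ s * h * ε ^ 2) (hεL : 2 * ε ^ 2 ≤ m * L) :
    84 * V / (h * N ^ 2) ≤ 42 * K ^ 3 / M := by
  have hLN2 : L ^ 2 ≤ K ^ 2 * N ^ 2 := by
    rw [← mul_pow]; exact pow_le_pow_left₀ hL.le hLN 2
  rw [div_le_div_iff₀ (by positivity) hM]
  refine le_of_mul_le_mul_left (a := s * m) ?_ (by positivity)
  calc s * m * (84 * V * M) = 84 * ((s * V) * (M * m)) := by ring
    _ ≤ 84 * ((K * L) * (s * h * ε ^ 2)) := by gcongr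
    _ = 42 * (K * L * (s * h)) * (2 * ε ^ 2) := by ring
    _ ≤ 42 * (K * L * (s * h)) * (m * L) := by gcongr
    _ = 42 * (K * (s * h) * m) * L ^ 2 := by ring
    _ ≤ 42 * (K * (s * h) * m) * (K ^ 2 * N ^ 2) := by gcongr
    _ = s * m * (42 * K ^ 3 * (h * N ^ 2)) := by ring

lemma div_le_of_sqNorm_le {s h n m M N K L V ε : ℝ} (hs : 0 < s) (hh : 0 < h) (hm : 0 < m)
    (hM : 0 < M) (hN : 0 < N) (hK : 0 < K) (hL : 0 < L)
    (hLN : L ≤ K * N) (hVn : s * m * V ≤ K * n) (hsh : M * (n * m) ≤ s ^ 2 * h * ε ^ 4)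
    (hεL : 2 * ε ^ 2 ≤ m * L) :
    80 * V / (s * h * N ^ 2) ≤ 20 * K ^ 3 / M := by
  rw [div_le_div_iff₀ (by positivity) hM]
  refine le_of_mul_le_mul_left (a := s * m ^ 2) ?_ (by positivity)
  calc s * m ^ 2 * (80 * V * M) = 80 * (s * m * V) * (M * m) := by ring
    _ ≤ 80 * (K * n) * (M * m) := by gcongr
    _ = 80 * K * (M * (n * m)) := by ring
    _ ≤ 80 * K * (s ^ 2 * h * ε ^ 4) := by gcongr
    _ = 20 * K * (s ^ 2 * h) * (2 * ε ^ 2) ^ 2 := by ring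
    _ ≤ 20 * K * (s ^ 2 * h) * (m * L) ^ 2 := by gcongr
    _ ≤ 20 * K * (s ^ 2 * h) * (m * (K * N)) ^ 2 := by gcongr
    _ = s * m ^ 2 * (20 * K ^ 3 * (s * h * N ^ 2)) := by ring

variable {s h : ℕ} {ε K M : ℝ} {G : (α → ℝ) → ℝ}

lemma idealDist_pos (hp : p ∈ stdSimplex ℝ α) (hq : q ∈ stdSimplex ℝ α) (hε : 0 < ε)
    (hd : 2 * ε ≤ ∑ z, |p z - q z|) : 0 < idealDist s p q := by
  have := le_mul_idealDist hp hq s hε.le hd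
  exact pos_of_mul_pos_right (lt_of_lt_of_le (by positivity) this) (by positivity)

lemma avg_score_le_of_goodWeight (hp : p ∈ stdSimplex ℝ α) (hq : q ∈ stdSimplex ℝ α) (hh : 0 < h)
    (hhs : h ≤ s) (hε : 0 < ε) (hd : 2 * ε ≤ ∑ z, |p z - q z|) (hK : 0 < K) (hM : 0 < M)
    (hvar : M * (Fintype.card α + s) ≤ s * h * ε ^ 2)
    (hnorm : M * (Fintype.card α * (Fintype.card α + s)) ≤ s ^ 2 * h * ε ^ 4)
    (hG : ∀ f, G f ≤ 1)
    (hG' : ∀ f, 0 < gap p q f → G f ≤ (16 / h + 4 / s) * energy p q f / gap p q f ^ 2)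
    {ω : α → ℝ} (hω : GoodWeight K s p q ω) :
    avg (prodWt p q) s (fun l => G (score ω l)) ≤ 62 * K ^ 3 / M := by
  have hs : 0 < s := hh.trans_le hhs
  have hs' : (0 : ℝ) < s := by exact_mod_cast hs
  have hh' : (0 : ℝ) < h := by exact_mod_cast hh
  have hL := idealDist_pos (s := s) hp hq hε hd
  have hV1 := varDir_nonneg hp.1 hq.1 ω
  have hV2 := sqNorm_nonneg (p := p) (q := q) ω
  have hN : 0 < sqDist ω p q := pos_of_mul_pos_right (hL.trans_le hω.sqDist_ge) hK.le
  have hcoeff : 16 / (h : ℝ) + 4 / s ≤ 20 / h := by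
    have : 4 / (s : ℝ) ≤ 4 / h := by gcongr
    linarith [show 16 / (h : ℝ) + 4 / h = 20 / h by ring]
  have hεL := le_mul_idealDist hp hq s hε.le hd
  have hns : (0 : ℝ) < Fintype.card α + s := by positivity
  set N := sqDist ω p q
  set V1 := varDir ω p q
  set V2 := sqNorm ω p q
  calc _ ≤ 4 * V1 / (s * N ^ 2) + 4 * (16 / h + 4 / s) * (V2 / s + V1) / N ^ 2 :=
        avg_score_le hp hq hs hN (by positivity) hG hG'
    _ ≤ 4 * V1 / (h * N ^ 2) + 4 * (20 / h) * (V2 / s + V1) / N ^ 2 := by gcongr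
    _ = 84 * V1 / (h * N ^ 2) + 80 * V2 / (s * h * N ^ 2) := by field_simp; ring
    _ ≤ 42 * K ^ 3 / M + 20 * K ^ 3 / M := by
        gcongr ?_ + ?_
        · exact div_le_of_varDir_le hs' hh' hns hM hN hK hL hω.sqDist_ge hω.varDir_le hvar hεL
        · exact div_le_of_sqNorm_le hs' hh' hns hM hN hK hL hω.sqDist_ge hω.sqNorm_le hnorm hεL
    _ = 62 * K ^ 3 / M := by ring

lemma avg_score_histWeight_le [DecidableEq α] (hp : p ∈ stdSimplex ℝ α) (hq : q ∈ stdSimplex ℝ α)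
    (hh : 0 < h) (hhs : h ≤ s) (hε : 0 < ε) (hd : 2 * ε ≤ ∑ z, |p z - q z|) (hK : 0 < K)
    (hM : 0 < M) (hvar : M * (Fintype.card α + s) ≤ s * h * ε ^ 2)
    (hnorm : M * (Fintype.card α * (Fintype.card α + s)) ≤ s ^ 2 * h * ε ^ 4)
    (hG : ∀ f, G f ≤ 1)
    (hG' : ∀ f, 0 < gap p q f → G f ≤ (16 / h + 4 / s) * energy p q f / gap p q f ^ 2) :
    (avg (prodWt p q) s fun l => avg (prodWt p q) s fun l' => G (score (histWeight l) l')) ≤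
      129 / K + 62 * K ^ 3 / M := by
  have hpq := prodWt_mem_stdSimplex hp hq
  have htrained : ∀ l, avg (prodWt p q) s (fun l' => G (score (histWeight l) l')) ≤
      ind (¬ GoodWeight K s p q (histWeight l)) + 62 * K ^ 3 / M := by
    intro l
    by_cases hl : GoodWeight K s p q (histWeight l)
    · rw [ind_of_not (not_not.2 hl), zero_add]
      exact avg_score_le_of_goodWeight hp hq hh hhs hε hd hK hM hvar hnorm hG hG' hl
    · rw [ind_of hl]
      refine ((avg_mono hpq.1 fun l' => hG _).trans_eq (avg_const hpq s 1)).trans ?_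
      exact le_add_of_nonneg_right (by positivity)
  refine (avg_mono hpq.1 htrained).trans ?_
  rw [avg_add, avg_const hpq]
  gcongr
  exact avg_not_goodWeight_le hp hq (hh.trans_le hhs) (idealDist_pos hp hq hε hd) hK

end GoodWeight

/-! ### The two tests -/

/-- The number of votes taken to reach error probability `δ`. -/
def votes (δ : ℝ) : ℕ := ⌈30 * Real.log (1 / δ)⌉₊

lemma pow_votes_le {δ : ℝ} (hδ : 0 < δ) : (9 / 10 : ℝ) ^ votes δ ≤ δ ^ 3 := by
  have hvotes : 30 * Real.log (1 / δ) ≤ votes δ := Nat.le_ceil _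
  rw [one_div, Real.log_inv] at hvotes
  calc (9 / 10 : ℝ) ^ votes δ ≤ Real.exp (-(1 / 10)) ^ votes δ := by
        gcongr; linarith [Real.add_one_le_exp (-(1 / 10) : ℝ)]
    _ = Real.exp (votes δ * -(1 / 10)) := (Real.exp_nat_mul _ _).symm
    _ ≤ Real.exp ((3 : ℕ) * Real.log δ) := Real.exp_le_exp.2 (by push_cast; linarith)
    _ = δ ^ 3 := by rw [Real.exp_nat_mul, Real.exp_log hδ]

lemma avg_ind_mul_votes_le {α : Type*} [Fintype α] {p : α → ℝ} (hp : p ∈ stdSimplex ℝ α)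
    (φ : List α → Prop) {δ : ℝ} (hδ : 0 < δ) {B s : ℕ} (hs : B * votes δ ≤ s) (a b : ℕ)
    {x c : ℝ} (hx : 1 ≤ x) (hφ : avg p B (fun l => ind (φ l)) ≤ c)
    (hc : 1 + (x ^ a - 1) * c ≤ 9 / 10 * x ^ b) :
    avg p s (fun l => ind (b * votes δ ≤ a * blockCount φ B (votes δ) l)) ≤ δ ^ 3 := by
  have hx' : 0 ≤ x ^ a - 1 := sub_nonneg.2 (one_le_pow₀ hx)
  have hmean : 0 ≤ avg p B fun l => ind (φ l) := avg_nonneg hp.1 fun l => ind_nonneg _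
  refine (avg_ind_le_mul_blockCount_le hp φ B (votes δ) hs a b hx).trans
    ((pow_le_pow_left₀ (by positivity) ?_ _).trans (pow_votes_le hδ))
  rw [div_le_iff₀ (by positivity)]
  linarith [mul_le_mul_of_nonneg_left hφ hx']

/-- The equivalence test: at least three quarters of the blocks are positive. -/
def equivTest : EquivalenceTest := fun _ _ _ δ _ s X Y =>
  PMF.pure (open Classical in decide (3 * votes δ ≤
    4 * blockCount (blockPositive (s / (2 * votes δ))) (2 * (s / (2 * votes δ))) (votes δ)
      ((List.ofFn X).zip (List.ofFn Y))))

section EquivalenceTest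

variable {α : Type} [Fintype α] {δ : ℝ}

lemma two_mul_div_mul_le (s R : ℕ) : 2 * (s / (2 * R)) * R ≤ s :=
  calc 2 * (s / (2 * R)) * R = s / (2 * R) * (2 * R) := by ring
    _ ≤ s := Nat.div_mul_le_self _ _

lemma pr_equivTest_null_le (μ : PMF α) (ε b : ℝ) (hδ : 0 < δ) (s : ℕ) :
    pr ((iidPMF μ s).bind fun X => (iidPMF μ s).bind fun Y => equivTest α ε δ b s X Y)
      (fun o => o = true) ≤ δ ^ 3 := by
  have hp := wt_mem_stdSimplex μ
  set h := s / (2 * votes δ)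
  refine (pr_iid_iid_bind_le μ μ (g := fun l => ind (3 * votes δ ≤
    4 * blockCount (blockPositive h) (2 * h) (votes δ) l)) fun X Y => ?_).trans
    (avg_ind_mul_votes_le (prodWt_mem_stdSimplex hp hp) (blockPositive h) hδ
      (two_mul_div_mul_le s _) 4 3 (x := 3 / 2) (by norm_num) (avg_blockPositive_le_half hp h)
      (by norm_num))
  rw [equivTest, pr_pure]
  exact ind_mono of_decide_eq_true

lemma pr_equivTest_alt_le (μ ν : PMF α) (ε b : ℝ) (hδ : 0 < δ) (s : ℕ)
    (hs : avg (prodWt (wt μ) (wt ν)) (2 * (s / (2 * votes δ)))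
      (fun l => ind (¬ blockPositive (s / (2 * votes δ)) l)) ≤ 1 / 30) :
    pr ((iidPMF μ s).bind fun X => (iidPMF ν s).bind fun Y => equivTest α ε δ b s X Y)
      (fun o => o ≠ true) ≤ δ ^ 3 := by
  have hpq := prodWt_mem_stdSimplex (wt_mem_stdSimplex μ) (wt_mem_stdSimplex ν)
  set h := s / (2 * votes δ) with hh
  refine (pr_iid_iid_bind_le μ ν (g := fun l => ind (1 * votes δ ≤
    4 * blockCount (fun l => ¬ blockPositive h l) (2 * h) (votes δ) l)) fun X Y => ?_).trans
    (avg_ind_mul_votes_le hpq (fun l => ¬ blockPositive h l) hδ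
      (two_mul_div_mul_le s _) 4 1 (x := 2) (by norm_num) hs (by norm_num))
  rw [equivTest, pr_pure]
  refine ind_mono fun hfail => ?_
  rw [ne_eq, decide_eq_true_eq, ← hh] at hfail
  have := blockCount_add_not (blockPositive h) (2 * h) (votes δ) ((List.ofFn X).zip (List.ofFn Y))
  omega

end EquivalenceTest

/-- One vote of the likelihood-free test: weights, score and threshold are found from the first,
second and third `s` pairs in the list `l`. -/
def lfhtVote {α : Type*} [DecidableEq α] (s h : ℕ) (l : List (α × α)) (Z : List α) : Prop :=
  vote (score (histWeight (l.take s)) ((l.drop s).take s)) s h (((l.drop s).drop s).take s) Z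

/-- The likelihood-free hypothesis test: a majority of votes. -/
def lfhtTest : LFHTest := fun _ _ δ s₁ s₂ X Y Z =>
  PMF.pure (open Classical in decide (votes δ < 2 * blockCount
    (lfhtVote (s₁ / 3) (s₂ / votes δ) ((List.ofFn X).zip (List.ofFn Y))) (s₂ / votes δ) (votes δ)
    (List.ofFn Z)))

section LfhtTest

variable {n : ℕ} {δ : ℝ} {s₁ s₂ : ℕ}

lemma pr_lfhtTest_true_le (μ : PMF (Fin n)) (ε : ℝ) (hδ : 0 < δ) (X Y : Fin s₁ → Fin n)
    (h : avg (wt μ) (s₂ / votes δ) (fun Z => ind (lfhtVote (s₁ / 3) (s₂ / votes δ)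
      ((List.ofFn X).zip (List.ofFn Y)) Z)) ≤ 1 / 30) :
    pr ((iidPMF μ s₂).bind fun Z => lfhtTest n ε δ s₁ s₂ X Y Z) (fun o => o ≠ false) ≤ δ ^ 3 := by
  refine (pr_iid_bind_le μ fun Z => ?_).trans (avg_ind_mul_votes_le (wt_mem_stdSimplex μ) _ hδ
    (Nat.div_mul_le_self s₂ _) 2 1 (x := 2) (by norm_num) h (by norm_num))
  rw [lfhtTest, pr_pure]
  refine ind_mono fun hfail => ?_
  rw [ne_eq, decide_eq_false_iff_not, not_not] at hfail
  omega

lemma pr_lfhtTest_false_le (μ : PMF (Fin n)) (ε : ℝ) (hδ : 0 < δ) (X Y : Fin s₁ → Fin n)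
    (h : avg (wt μ) (s₂ / votes δ) (fun Z => ind (¬ lfhtVote (s₁ / 3) (s₂ / votes δ)
      ((List.ofFn X).zip (List.ofFn Y)) Z)) ≤ 1 / 30) :
    pr ((iidPMF μ s₂).bind fun Z => lfhtTest n ε δ s₁ s₂ X Y Z) (fun o => o ≠ true) ≤ δ ^ 3 := by
  refine (pr_iid_bind_le μ fun Z => ?_).trans (avg_ind_mul_votes_le (wt_mem_stdSimplex μ) _ hδ
    (Nat.div_mul_le_self s₂ _) 2 1 (x := 2) (by norm_num) h (by norm_num))
  rw [lfhtTest, pr_pure]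
  refine ind_mono fun hfail => ?_
  rw [ne_eq, decide_eq_true_eq] at hfail
  have := blockCount_add_not (lfhtVote (s₁ / 3) (s₂ / votes δ)
    ((List.ofFn X).zip (List.ofFn Y))) (s₂ / votes δ) (votes δ) (List.ofFn Z)
  omega

end LfhtTest

section LfhtVote

variable {α : Type*} [Fintype α] {p q : α → ℝ} {s h S : ℕ} {ε : ℝ}

lemma avg_take_drop_take_drop (hp : p ∈ stdSimplex ℝ α) (hq : q ∈ stdSimplex ℝ α)
    (hS : 3 * s ≤ S) (F : List (α × α) → List (α × α) → List (α × α) → ℝ) :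
    avg (prodWt p q) S (fun l => F (l.take s) ((l.drop s).take s) (((l.drop s).drop s).take s)) =
    avg (prodWt p q) s fun l => avg (prodWt p q) s fun l' => avg (prodWt p q) s (F l l') := by
  rw [avg_split (a := s) (by omega) fun l l' => F l (l'.take s) ((l'.drop s).take s)]
  refine avg_congr fun l _ => ?_
  rw [avg_split (a := s) (by omega) fun l' l'' => F l l' (l''.take s)]
  exact avg_congr fun l' _ => avg_take (prodWt_mem_stdSimplex hp hq) (by omega) _

variable [DecidableEq α]

lemma avg_lfhtScore_le (hp : p ∈ stdSimplex ℝ α) (hq : q ∈ stdSimplex ℝ α) (hS : 3 * s ≤ S)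
    (hh : 0 < h) (hhs : h ≤ s) (hε : 0 < ε) (hd : 2 * ε ≤ ∑ z, |p z - q z|)
    (hvar : 10 ^ 28 * ((Fintype.card α : ℝ) + s) ≤ s * h * ε ^ 2)
    (hnorm : 10 ^ 28 * ((Fintype.card α : ℝ) * (Fintype.card α + s)) ≤ s ^ 2 * h * ε ^ 4)
    {H : (α → ℝ) → List (α × α) → ℝ} (hH : ∀ f l, H f l ≤ 1)
    (hH' : ∀ f, 0 < gap p q f →
      avg (prodWt p q) s (H f) ≤ (16 / h + 4 / s) * energy p q f / gap p q f ^ 2) :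
    avg (prodWt p q) S (fun l => H (score (histWeight (l.take s)) ((l.drop s).take s))
      (((l.drop s).drop s).take s)) ≤ 1 / 50000 := by
  have hpq := prodWt_mem_stdSimplex hp hq
  rw [avg_take_drop_take_drop hp hq hS fun l l' => H (score (histWeight l) l')]
  refine (avg_score_histWeight_le hp hq hh hhs hε hd (K := 10 ^ 7) (by norm_num) (by norm_num)
    hvar hnorm (G := fun f => avg (prodWt p q) s (H f)) (fun f => ?_) hH').trans (by norm_num)
  exact (avg_mono hpq.1 (hH f)).trans_eq (avg_const hpq s 1)

lemma avg_not_lfhtVote_le (hp : p ∈ stdSimplex ℝ α) (hq : q ∈ stdSimplex ℝ α) (hS : 3 * s ≤ S)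
    (hh : 0 < h) (hhs : h ≤ s) (hε : 0 < ε) (hd : 2 * ε ≤ ∑ z, |p z - q z|)
    (hvar : 10 ^ 28 * ((Fintype.card α : ℝ) + s) ≤ s * h * ε ^ 2)
    (hnorm : 10 ^ 28 * ((Fintype.card α : ℝ) * (Fintype.card α + s)) ≤ s ^ 2 * h * ε ^ 4) :
    avg (prodWt p q) S (fun l => avg p h fun Z => ind (¬ lfhtVote s h l Z)) ≤ 1 / 50000 :=
  avg_lfhtScore_le hp hq hS hh hhs hε hd hvar hnorm
    (H := fun f l => avg p h fun Z => ind (¬ vote f s h l Z))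
    (fun _ _ => (avg_mono hp.1 fun _ => ind_le_one _).trans_eq (avg_const hp h 1))
    fun _ hf => avg_not_vote_le hp hq hf (hh.trans_le hhs) hh

lemma avg_lfhtVote_le (hp : p ∈ stdSimplex ℝ α) (hq : q ∈ stdSimplex ℝ α) (hS : 3 * s ≤ S)
    (hh : 0 < h) (hhs : h ≤ s) (hε : 0 < ε) (hd : 2 * ε ≤ ∑ z, |p z - q z|)
    (hvar : 10 ^ 28 * ((Fintype.card α : ℝ) + s) ≤ s * h * ε ^ 2)
    (hnorm : 10 ^ 28 * ((Fintype.card α : ℝ) * (Fintype.card α + s)) ≤ s ^ 2 * h * ε ^ 4) :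
    avg (prodWt p q) S (fun l => avg q h fun Z => ind (lfhtVote s h l Z)) ≤ 1 / 50000 :=
  avg_lfhtScore_le hp hq hS hh hhs hε hd hvar hnorm
    (H := fun f l => avg q h fun Z => ind (vote f s h l Z))
    (fun _ _ => (avg_mono hq.1 fun _ => ind_le_one _).trans_eq (avg_const hq h 1))
    fun _ hf => avg_vote_le hp hq hf (hh.trans_le hhs) hh

end LfhtVote

/-! ### MultiLFHT -/

section MultiLFHT

variable {k n : ℕ} {D : Fin k → PMF (Fin n)} {ε δ : ℝ} {I : Finset (Fin k)} {a₁ a₂ : Fin k}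

lemma IsHiddenPartition.two_mul_le_sum_abs_sub (hI : IsHiddenPartition ε D I) (h₁ : a₁ ∈ I)
    (h₂ : a₂ ∈ Iᶜ) : 2 * ε ≤ ∑ z, |wt (D a₁) z - wt (D a₂) z| := by
  have := hI.le_tv a₁ h₁ a₂ h₂
  unfold tv at this
  unfold wt
  linarith

lemma pr_classify_le {test : Fin k → SampleAlg k n Bool} (P : Fin k → Prop) [DecidablePred P]
    {η : ℝ} (l : List (Fin k))
    (h : ∀ i ∈ l, pr (law D (test i)) (fun o => o ≠ decide (P i)) ≤ η) :
    pr (law D (classify test l)) (fun χ => χ ≠ (l.filter (fun i => decide (P i))).toFinset) ≤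
      l.length * η := by
  induction l with
  | nil =>
    rw [classify, monad_pure_eq, law_ret, pr_pure_of_not (by simp)]
    simp
  | cons i l ih =>
    have htail := ih fun j hj => h j (List.mem_cons_of_mem _ hj)
    have hhead := h i List.mem_cons_self
    rw [classify, monad_bind_eq, law_bind, List.length_cons]
    refine (pr_bind_le_add (fun o => o ≠ decide (P i)) ((pr_nonneg _ _).trans htail)
      fun o _ ho => ?_).trans (by push_cast; linarith)
    rw [monad_bind_eq, law_bind]
    refine (pr_bind_le_add (fun χ => χ ≠ (l.filter (fun i => decide (P i))).toFinset) le_rfl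
      fun χ _ hχ => ?_).trans (by linarith)
    rw [monad_pure_eq, law_ret, pr_pure_of_not]
    simp only [ne_eq, not_not] at ho hχ ⊢
    subst ho hχ
    by_cases hP : P i <;> simp [hP]

lemma pr_classify_lfhtTest_le (hI : IsHiddenPartition ε D I) (h₁ : a₁ ∈ I) (h₂ : a₂ ∈ Iᶜ)
    (hδ : 0 < δ) {s₁ s₂ : ℕ} (X Y : Fin s₁ → Fin n)
    (hfst : avg (wt (D a₁)) (s₂ / votes δ) (fun Z => ind (¬ lfhtVote (s₁ / 3) (s₂ / votes δ)
      ((List.ofFn X).zip (List.ofFn Y)) Z)) ≤ 1 / 30)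
    (hsnd : avg (wt (D a₂)) (s₂ / votes δ) (fun Z => ind (lfhtVote (s₁ / 3) (s₂ / votes δ)
      ((List.ofFn X).zip (List.ofFn Y)) Z)) ≤ 1 / 30) (l : List (Fin k)) :
    pr (law D (classify (fun i => (iid (draw i) s₂).bind fun Z =>
      rand (lfhtTest n ε δ s₁ s₂ X Y Z)) l))
      (fun χ => χ ≠ (l.filter (fun i => decide (i ∈ I))).toFinset) ≤ l.length * δ ^ 3 := by
  refine pr_classify_le (fun i => i ∈ I) l fun i _ => ?_
  simp only [law_bind, law_iid, law_draw, law_rand]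
  by_cases hi : i ∈ I
  · rw [hI.eq_of_mem i hi a₁ h₁, decide_eq_true hi]
    exact pr_lfhtTest_false_le (D a₁) ε hδ X Y hfst
  · rw [hI.eq_of_mem_compl i (Finset.mem_compl.2 hi) a₂ h₂, decide_eq_false hi]
    exact pr_lfhtTest_true_le (D a₂) ε hδ X Y hsnd

lemma insert_filter_erase_erase (h₁ : a₁ ∈ I) (h₂ : a₂ ∈ Iᶜ) :
    insert a₁ (((Finset.univ.erase a₁).erase a₂).toList.filter
      (fun i => decide (i ∈ I))).toFinset = I := by
  ext i
  rcases eq_or_ne i a₁ with rfl | hi₁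
  · simp [h₁]
  · rcases eq_or_ne i a₂ with rfl | hi₂
    · simpa [hi₁] using h₂
    · simp [hi₁, hi₂]

lemma pr_classify_lfhtTest_bind_le (hI : IsHiddenPartition ε D I) (h₁ : a₁ ∈ I) (h₂ : a₂ ∈ Iᶜ)
    (hδ : 0 < δ) {s₁ s₂ : ℕ} (X Y : Fin s₁ → Fin n)
    (hfst : avg (wt (D a₁)) (s₂ / votes δ) (fun Z => ind (¬ lfhtVote (s₁ / 3) (s₂ / votes δ)
      ((List.ofFn X).zip (List.ofFn Y)) Z)) ≤ 1 / 30)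
    (hsnd : avg (wt (D a₂)) (s₂ / votes δ) (fun Z => ind (lfhtVote (s₁ / 3) (s₂ / votes δ)
      ((List.ofFn X).zip (List.ofFn Y)) Z)) ≤ 1 / 30) :
    pr ((law D (classify (fun i => (iid (draw i) s₂).bind fun Z =>
        rand (lfhtTest n ε δ s₁ s₂ X Y Z)) ((Finset.univ.erase a₁).erase a₂).toList)).bind
      fun χ => law D (pure {insert a₁ χ, (insert a₁ χ)ᶜ}))
      (fun o : Finset (Finset (Fin k)) => o ≠ {I, Iᶜ}) ≤
      k * δ ^ 3 := by
  set l := ((Finset.univ.erase a₁).erase a₂).toList with hl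
  have hlen : (l.length : ℝ) ≤ k := by
    rw [hl, Finset.length_toList]
    exact_mod_cast (Finset.card_le_univ _).trans_eq (Fintype.card_fin k)
  calc _ ≤ _ + 0 :=
        pr_bind_le_add (fun χ => χ ≠ (l.filter (fun i => decide (i ∈ I))).toFinset) le_rfl
          fun χ _ hχ => by
            rw [not_not.1 hχ, insert_filter_erase_erase h₁ h₂, monad_pure_eq, law_ret,
              pr_pure_of_not (by simp)]
    _ ≤ l.length * δ ^ 3 := by
        rw [add_zero]
        exact pr_classify_lfhtTest_le hI h₁ h₂ hδ X Y hfst hsnd l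
    _ ≤ k * δ ^ 3 := by gcongr

lemma mul_one_div_nine_mul_cube_le (hk : 0 < k) : k * (1 / (9 * k) : ℝ) ^ 3 ≤ 1 / 200 := by
  have hk' : (1 : ℝ) ≤ k := by exact_mod_cast hk
  calc k * (1 / (9 * k) : ℝ) ^ 3 = 1 / (729 * (k : ℝ) ^ 2) := by field_simp; norm_num
    _ ≤ 1 / 200 := one_div_le_one_div_of_le (by norm_num) (by nlinarith)

lemma pr_multiLFHT_le {C : ℝ} (hε : 0 < ε) (hI : IsHiddenPartition ε D I) (h₁ : a₁ ∈ I)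
    (h₂ : a₂ ∈ Iᶜ) {s h : ℕ} (hs : s = ⌈C * lfhtSize n k ε⌉₊ / 3)
    (hh : h = ⌈C * lfhtSize n k ε / k⌉₊ / votes (1 / (9 * k))) (hh0 : 0 < h) (hhs : h ≤ s)
    (hvar : 10 ^ 28 * ((n : ℝ) + s) ≤ s * h * ε ^ 2)
    (hnorm : 10 ^ 28 * ((n : ℝ) * (n + s)) ≤ s ^ 2 * h * ε ^ 4) :
    pr (law D (multiLFHT lfhtTest C ε a₁ a₂)) (fun o => o ≠ {I, Iᶜ}) ≤ 1 / 100 := by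
  have hk : 0 < k := Fin.pos a₁
  have hp := wt_mem_stdSimplex (D a₁)
  have hq := wt_mem_stdSimplex (D a₂)
  have hd := hI.two_mul_le_sum_abs_sub h₁ h₂
  simp only [multiLFHT, monad_bind_eq, law_bind, law_iid, law_draw]
  set s₁ := ⌈C * lfhtSize n k ε⌉₊
  set s₂ := ⌈C * lfhtSize n k ε / k⌉₊
  have hfst := avg_not_lfhtVote_le hp hq (S := s₁) (by omega) hh0 hhs hε hd (by simpa using hvar)
    (by simpa using hnorm)
  have hsnd := avg_lfhtVote_le hp hq (S := s₁) (by omega) hh0 hhs hε hd (by simpa using hvar)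
    (by simpa using hnorm)
  set β₁ := fun l => avg (wt (D a₁)) h fun Z => ind (¬ lfhtVote s h l Z)
  set β₂ := fun l => avg (wt (D a₂)) h fun Z => ind (lfhtVote s h l Z)
  have hβ₁ : ∀ l, 0 ≤ β₁ l := fun l => avg_nonneg hp.1 fun _ => ind_nonneg _
  have hβ₂ : ∀ l, 0 ≤ β₂ l := fun l => avg_nonneg hq.1 fun _ => ind_nonneg _
  -- Markov: a vote trained on the exemplars errs with probability above `1 / 30` only rarely.
  refine (pr_iid_iid_bind_le (D a₁) (D a₂)
    (g := fun l => 30 * β₁ l + (30 * β₂ l + 1 / 200)) fun X Y => ?_).trans ?_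
  · set l := (List.ofFn X).zip (List.ofFn Y)
    by_cases hgood : β₁ l ≤ 1 / 30 ∧ β₂ l ≤ 1 / 30
    · have hcond := (pr_classify_lfhtTest_bind_le hI h₁ h₂ (by positivity) X Y
        (by rw [← hs, ← hh]; exact hgood.1) (by rw [← hs, ← hh]; exact hgood.2)).trans
        (mul_one_div_nine_mul_cube_le hk)
      exact hcond.trans (by linarith [hβ₁ l, hβ₂ l])
    · refine (pr_le_one _ _).trans ?_
      rcases not_and_or.1 hgood with hbad | hbad <;> linarith [hβ₁ l, hβ₂ l, not_le.1 hbad]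
  · rw [avg_add, avg_add, avg_mul_left, avg_mul_left, avg_const (prodWt_mem_stdSimplex hp hq)]
    linarith

end MultiLFHT

/-! ### The three regimes of MultiLFHT -/

section Regimes

variable {n k : ℕ} {ε c M : ℝ}

lemma costLarge_nonneg (n k : ℕ) (ε : ℝ) : 0 ≤ costLarge n k ε := by
  have := Real.log_natCast_nonneg k
  unfold costLarge; positivity

lemma costMid_nonneg (n k : ℕ) (ε : ℝ) : 0 ≤ costMid n k ε := by
  unfold costMid; positivity

lemma costSmall_nonneg (k : ℕ) (ε : ℝ) : 0 ≤ costSmall k ε := by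
  have := Real.log_natCast_nonneg k
  unfold costSmall; positivity

lemma costLarge_cube (n k : ℕ) (ε : ℝ) :
    costLarge n k ε ^ 3 = n ^ 2 * (k * Real.log k) / ε ^ 4 := by
  have := Real.log_natCast_nonneg k
  rw [costLarge, ← Real.rpow_natCast, ← Real.rpow_mul (by positivity)]
  norm_num
  ring

lemma costMid_sq (n k : ℕ) (ε : ℝ) : costMid n k ε ^ 2 = n * (k * Real.log k) / ε ^ 4 := by
  have := Real.log_natCast_nonneg k
  rw [costMid, div_pow, Real.sq_sqrt (by positivity), ← pow_mul, mul_assoc]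

lemma costLarge_pow_six (n k : ℕ) (ε : ℝ) :
    costLarge n k ε ^ 6 = n ^ 4 * (k * Real.log k) ^ 2 / ε ^ 8 := by
  rw [show 6 = 3 * 2 by norm_num, pow_mul, costLarge_cube]
  ring

lemma costMid_pow_six (n k : ℕ) (ε : ℝ) :
    costMid n k ε ^ 6 = n ^ 3 * (k * Real.log k) ^ 3 / ε ^ 12 := by
  rw [show 6 = 2 * 3 by norm_num, pow_mul, costMid_sq]
  ring

lemma le_mul_of_mul_pow_le {x y : ℝ} {j : ℕ} (hj : j ≠ 0) (hx : 0 ≤ x) (hy : 0 ≤ y)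
    (hM : 1 ≤ M) (hMc : 1 ≤ M * c) (h : c * x ^ j ≤ y ^ j) : x ≤ M * y := by
  refine le_of_pow_le_pow_left₀ hj (by positivity) ?_
  calc x ^ j ≤ M * c * x ^ j := le_mul_of_one_le_left (by positivity) hMc
    _ = M * (c * x ^ j) := mul_assoc _ _ _
    _ ≤ M * y ^ j := by gcongr
    _ ≤ M ^ j * y ^ j := by gcongr; exact le_self_pow₀ hM hj
    _ = (M * y) ^ j := (mul_pow _ _ _).symm

lemma costMid_le_costLarge (hM : 1 ≤ M) (hMc : 1 ≤ M * c)
    (h : c * (k * Real.log k / ε ^ 4) ≤ n) : costMid n k ε ≤ M * costLarge n k ε := by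
  have := Real.log_natCast_nonneg k
  refine le_mul_of_mul_pow_le (j := 6) (by norm_num) (costMid_nonneg _ _ _)
    (costLarge_nonneg _ _ _) hM hMc ?_
  rw [costMid_pow_six, costLarge_pow_six]
  calc c * (n ^ 3 * (k * Real.log k) ^ 3 / ε ^ 12)
      = n ^ 3 * (k * Real.log k) ^ 2 / ε ^ 8 * (c * (k * Real.log k / ε ^ 4)) := by ring
    _ ≤ n ^ 3 * (k * Real.log k) ^ 2 / ε ^ 8 * n := by gcongr
    _ = n ^ 4 * (k * Real.log k) ^ 2 / ε ^ 8 := by ring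

lemma costLarge_le_costMid (hM : 1 ≤ M) (hMc : 1 ≤ M * c)
    (h : c * n ≤ k * Real.log k / ε ^ 4) : costLarge n k ε ≤ M * costMid n k ε := by
  have := Real.log_natCast_nonneg k
  refine le_mul_of_mul_pow_le (j := 6) (by norm_num) (costLarge_nonneg _ _ _)
    (costMid_nonneg _ _ _) hM hMc ?_
  rw [costMid_pow_six, costLarge_pow_six]
  calc c * (n ^ 4 * (k * Real.log k) ^ 2 / ε ^ 8)
      = n ^ 3 * (k * Real.log k) ^ 2 / ε ^ 8 * (c * n) := by ring
    _ ≤ n ^ 3 * (k * Real.log k) ^ 2 / ε ^ 8 * (k * Real.log k / ε ^ 4) := by gcongr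
    _ = n ^ 3 * (k * Real.log k) ^ 3 / ε ^ 12 := by ring

lemma costSmall_le_costMid (hM : 1 ≤ M) (hMc : 1 ≤ M * c) (h : c * (k * Real.log k) ≤ n) :
    costSmall k ε ≤ M * costMid n k ε := by
  have := Real.log_natCast_nonneg k
  refine le_mul_of_mul_pow_le (j := 2) (by norm_num) (costSmall_nonneg _ _)
    (costMid_nonneg _ _ _) hM hMc ?_
  rw [costMid_sq, costSmall]
  calc c * (k * Real.log k / ε ^ 2) ^ 2
      = c * (k * Real.log k) * (k * Real.log k) / ε ^ 4 := by ring
    _ ≤ n * (k * Real.log k) / ε ^ 4 := by gcongr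

lemma costMid_le_costSmall (hM : 1 ≤ M) (hMc : 1 ≤ M * c) (h : c * n ≤ k * Real.log k) :
    costMid n k ε ≤ M * costSmall k ε := by
  have := Real.log_natCast_nonneg k
  refine le_mul_of_mul_pow_le (j := 2) (by norm_num) (costMid_nonneg _ _ _)
    (costSmall_nonneg _ _) hM hMc ?_
  rw [costMid_sq, costSmall]
  calc c * (n * (k * Real.log k) / ε ^ 4) = c * n * (k * Real.log k) / ε ^ 4 := by ring
    _ ≤ k * Real.log k * (k * Real.log k) / ε ^ 4 := by gcongr
    _ = (k * Real.log k / ε ^ 2) ^ 2 := by ring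

lemma mul_log_le_div_pow (hε : 0 < ε) (hε1 : ε ≤ 1) (j : ℕ) :
    k * Real.log k ≤ k * Real.log k / ε ^ j := by
  have := Real.log_natCast_nonneg k
  rw [le_div_iff₀ (by positivity)]
  exact mul_le_of_le_one_right (by positivity) (pow_le_one₀ hε.le hε1)

lemma le_lfhtSize (hε : 0 < ε) (hε1 : ε ≤ 1) : costLarge n k ε ≤ lfhtSize n k ε ∧
    costMid n k ε ≤ lfhtSize n k ε ∧ costSmall k ε ≤ lfhtSize n k ε := by
  have hdiv := mul_log_le_div_pow (k := k) hε hε1 4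
  have hone : (1 : ℝ) ≤ 1 * 1 := by norm_num
  unfold lfhtSize
  split_ifs with hlarge hmid
  · have hML := costMid_le_costLarge le_rfl hone (by rwa [one_mul])
    have hSM := costSmall_le_costMid (ε := ε) le_rfl hone (by rw [one_mul]; exact hdiv.trans hlarge)
    exact ⟨le_rfl, by linarith, by linarith⟩
  · have hLM := costLarge_le_costMid le_rfl hone (by rw [one_mul]; exact (not_le.1 hlarge).le)
    have hSM := costSmall_le_costMid (ε := ε) le_rfl hone (by rwa [one_mul])
    exact ⟨by linarith, le_rfl, by linarith⟩
  · have hn : 1 * n ≤ k * Real.log k := by rw [one_mul]; exact (not_le.1 hmid).le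
    have hLM := costLarge_le_costMid le_rfl hone (hn.trans hdiv)
    have hMS := costMid_le_costSmall (ε := ε) le_rfl hone hn
    exact ⟨by linarith, by linarith, le_rfl⟩

lemma lfhtSize_le {x : ℝ} (hl : costLarge n k ε ≤ x) (hm : costMid n k ε ≤ x)
    (hs : costSmall k ε ≤ x) : lfhtSize n k ε ≤ x := by
  unfold lfhtSize; split_ifs <;> assumption

lemma costFind_nonneg (n k r : ℕ) (ε : ℝ) : 0 ≤ costFind n k r ε := by
  have := Real.log_natCast_nonneg k
  unfold costFind
  positivity

lemma lfhtSize_nonneg (n k : ℕ) (ε : ℝ) : 0 ≤ lfhtSize n k ε := by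
  unfold lfhtSize
  split_ifs
  exacts [costLarge_nonneg n k ε, costMid_nonneg n k ε, costSmall_nonneg k ε]

lemma sampleBound_of_le (hε : 0 < ε) (hε1 : ε ≤ 1) (hc : 0 < c) {A : ℝ} (hA : 0 ≤ A) {r N : ℕ}
    (hN : (N : ℝ) ≤ A * (costFind n k r ε + lfhtSize n k ε)) :
    SampleBound c (A * max 1 (1 / c) ^ 2) n k r ε N := by
  set M := max 1 (1 / c)
  have hM : 1 ≤ M := le_max_left _ _
  have hMc : 1 ≤ M * c := (div_le_iff₀ hc).1 (le_max_right _ _)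
  have hdiv := mul_log_le_div_pow (k := k) hε hε1 4
  have hF := costFind_nonneg n k r ε
  have hL := costLarge_nonneg n k ε
  have hMid := costMid_nonneg n k ε
  have hS := costSmall_nonneg k ε
  have hbound : ∀ x, lfhtSize n k ε ≤ M ^ 2 * x →
      (N : ℝ) ≤ A * M ^ 2 * (costFind n k r ε + x) := by
    intro x hx
    calc (N : ℝ) ≤ A * (1 * costFind n k r ε + lfhtSize n k ε) := by rwa [one_mul]
      _ ≤ A * (M ^ 2 * costFind n k r ε + M ^ 2 * x) := by gcongr; exact one_le_pow₀ hM
      _ = A * M ^ 2 * (costFind n k r ε + x) := by ring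
  refine ⟨fun h => hbound _ ?_, fun h h' => hbound _ ?_, fun h => hbound _ ?_⟩
  · have hML := costMid_le_costLarge hM hMc h
    have hSM := costSmall_le_costMid (ε := ε) hM hMc
      ((mul_le_mul_of_nonneg_left hdiv hc.le).trans h)
    refine lfhtSize_le ?_ ?_ ?_ <;> nlinarith
  · have hLM := costLarge_le_costMid hM hMc h'
    have hSM := costSmall_le_costMid (ε := ε) hM hMc h
    refine lfhtSize_le ?_ ?_ ?_ <;> nlinarith
  · have hLM := costLarge_le_costMid hM hMc (h.trans hdiv)
    have hMS := costMid_le_costSmall (ε := ε) hM hMc h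
    refine lfhtSize_le ?_ ?_ ?_ <;> nlinarith

lemma mul_log_le_lfhtSize_mul_sq (hε : 0 < ε) (hε1 : ε ≤ 1) :
    k * Real.log k ≤ lfhtSize n k ε * ε ^ 2 := by
  rw [← div_le_iff₀ (by positivity)]
  exact (le_lfhtSize hε hε1).2.2

lemma mul_log_le_lfhtSize (hε : 0 < ε) (hε1 : ε ≤ 1) : k * Real.log k ≤ lfhtSize n k ε :=
  (mul_log_le_div_pow hε hε1 2).trans (le_lfhtSize hε hε1).2.2

lemma mul_mul_log_le_lfhtSize_sq_mul (hε : 0 < ε) (hε1 : ε ≤ 1) :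
    n * (k * Real.log k) ≤ lfhtSize n k ε ^ 2 * ε ^ 4 := by
  rw [← div_le_iff₀ (by positivity), ← costMid_sq]
  exact pow_le_pow_left₀ (costMid_nonneg n k ε) (le_lfhtSize hε hε1).2.1 2

lemma sq_mul_mul_log_le_lfhtSize_cube_mul (hε : 0 < ε) (hε1 : ε ≤ 1) :
    n ^ 2 * (k * Real.log k) ≤ lfhtSize n k ε ^ 3 * ε ^ 4 := by
  rw [← div_le_iff₀ (by positivity), ← costLarge_cube]
  exact pow_le_pow_left₀ (costLarge_nonneg n k ε) (le_lfhtSize hε hε1).1 3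

end Regimes

/-! ### The constant of MultiLFHT -/

section LfhtConstant

variable {n k : ℕ} {ε : ℝ}

lemma one_half_le_log (hk : 2 ≤ k) : 1 / 2 ≤ Real.log k := by
  have hlog : Real.log 2 ≤ Real.log k := Real.log_le_log (by norm_num) (by exact_mod_cast hk)
  linarith [Real.log_two_gt_d9]

lemma votes_ninth_le (hk : 2 ≤ k) : (votes (1 / (9 * k)) : ℝ) ≤ 200 * Real.log k := by
  have hhalf := one_half_le_log hk
  have hk' : (2 : ℝ) ≤ k := by exact_mod_cast hk
  have hlog : Real.log (9 * k) ≤ 5 * Real.log k := by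
    calc Real.log (9 * k) ≤ Real.log ((k : ℝ) ^ 4 * k) := by
          gcongr
          linarith [pow_le_pow_left₀ zero_le_two hk' 4]
      _ = 5 * Real.log k := by
          rw [← pow_succ, Real.log_pow]
          norm_num
  have hlog0 : 0 ≤ Real.log (9 * k) := Real.log_nonneg (by linarith)
  rw [votes, one_div_one_div]
  linarith [Nat.ceil_lt_add_one (a := 30 * Real.log (9 * k)) (by positivity)]

lemma three_le_votes_ninth (hk : 2 ≤ k) : 3 ≤ votes (1 / (9 * k)) := by
  have hlog : Real.log k ≤ Real.log (9 * k) := by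
    gcongr
    linarith [(k.cast_nonneg : (0 : ℝ) ≤ k)]
  rw [votes, one_div_one_div]
  refine Nat.lt_ceil.2 ?_
  push_cast
  linarith [one_half_le_log hk]

lemma sub_one_lt_natDiv (a b : ℕ) : (a : ℝ) / b - 1 < (a / b : ℕ) := by
  rw [← Nat.floor_div_eq_div (K := ℝ)]
  exact Nat.sub_one_lt_floor _

/-- The constant `C₂` of the theorem. -/
def lfhtConst : ℝ := 10 ^ 31

lemma le_ceil_lfhtConst_mul_div_three {T : ℝ} (hT : 1 ≤ T) :
    T ≤ (⌈lfhtConst * T⌉₊ / 3 : ℕ) := by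
  have hdiv := sub_one_lt_natDiv ⌈lfhtConst * T⌉₊ 3
  have hceil := Nat.le_ceil (lfhtConst * T)
  have hC : 6 * T ≤ lfhtConst * T := by unfold lfhtConst; linarith
  rw [Nat.cast_ofNat, sub_lt_iff_lt_add, div_lt_iff₀ three_pos] at hdiv
  linarith

lemma le_ceil_lfhtConst_mul_div_votes {T : ℝ} (hk : 2 ≤ k) (hT : k * Real.log k ≤ T) :
    2 * 10 ^ 28 * T ≤ (⌈lfhtConst * T / k⌉₊ / votes (1 / (9 * k)) : ℕ) * (k * Real.log k) := by
  have hlog : 0 < Real.log k := by linarith [one_half_le_log hk]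
  have : (0 : ℝ) < k := by positivity
  have hT0 : 0 ≤ T := le_trans (by positivity) hT
  set s₂ := ⌈lfhtConst * T / k⌉₊
  set R := votes (1 / (9 * k))
  have hR : (0 : ℝ) < R := by exact Nat.cast_pos.2 (three_pos.trans_le (three_le_votes_ninth hk))
  have hdiv : 5 * 10 ^ 28 * T / (k * Real.log k) ≤ s₂ / R := by
    calc 5 * 10 ^ 28 * T / (k * Real.log k) = lfhtConst * T / k / (200 * Real.log k) := by
          rw [lfhtConst]; field_simp; ring
      _ ≤ s₂ / R := by
          gcongr
          exacts [Nat.le_ceil _, votes_ninth_le hk]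
  calc 2 * 10 ^ 28 * T ≤ (5 * 10 ^ 28 * T / (k * Real.log k) - 1) * (k * Real.log k) := by
        rw [sub_mul, div_mul_cancel₀ _ (by positivity)]
        linarith
    _ ≤ (s₂ / R : ℕ) * (k * Real.log k) := by
        gcongr
        linarith [sub_one_lt_natDiv s₂ R]

section Domination

variable {N T ℓ s h A : ℝ}

lemma mul_add_le_of_le_sq_mul (hA : 0 ≤ A) (hℓ : 0 < ℓ) (hT : 0 ≤ T) (hε : 0 ≤ ε) (hε1 : ε ≤ 1)
    (h₁ : ℓ ≤ T * ε ^ 2) (h₂ : N * ℓ ≤ T ^ 2 * ε ^ 4) (hs : T ≤ s) (hh : 2 * A * T ≤ h * ℓ) :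
    A * (N + s) ≤ s * h * ε ^ 2 := by
  have hs0 : 0 ≤ s := hT.trans hs
  have hε24 : ε ^ 4 ≤ ε ^ 2 := pow_le_pow_of_le_one hε hε1 (by norm_num)
  refine le_of_mul_le_mul_right ?_ hℓ
  calc A * (N + s) * ℓ = A * (N * ℓ + s * ℓ) := by ring
    _ ≤ A * (T ^ 2 * ε ^ 4 + s * (T * ε ^ 2)) := by gcongr
    _ ≤ A * (s * T * ε ^ 2 + s * (T * ε ^ 2)) := by rw [sq T]; gcongr
    _ = s * ε ^ 2 * (2 * A * T) := by ring
    _ ≤ s * ε ^ 2 * (h * ℓ) := by gcongr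
    _ = s * h * ε ^ 2 * ℓ := by ring

lemma mul_mul_add_le_of_le_cube_mul (hA : 0 ≤ A) (hℓ : 0 < ℓ) (hT : 0 ≤ T)
    (h₂ : N * ℓ ≤ T ^ 2 * ε ^ 4) (h₃ : N ^ 2 * ℓ ≤ T ^ 3 * ε ^ 4) (hs : T ≤ s)
    (hh : 2 * A * T ≤ h * ℓ) : A * (N * (N + s)) ≤ s ^ 2 * h * ε ^ 4 := by
  have hs0 : 0 ≤ s := hT.trans hs
  refine le_of_mul_le_mul_right ?_ hℓ
  calc A * (N * (N + s)) * ℓ = A * (N ^ 2 * ℓ + s * (N * ℓ)) := by ring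
    _ ≤ A * (T ^ 3 * ε ^ 4 + s * (T ^ 2 * ε ^ 4)) := by gcongr
    _ = A * T * (T * T + s * T) * ε ^ 4 := by ring
    _ ≤ A * T * (s * s + s * s) * ε ^ 4 := by gcongr
    _ = s ^ 2 * ε ^ 4 * (2 * A * T) := by ring
    _ ≤ s ^ 2 * ε ^ 4 * (h * ℓ) := by gcongr
    _ = s ^ 2 * h * ε ^ 4 * ℓ := by ring

end Domination

variable {D : Fin k → PMF (Fin n)}

lemma two_le_of_mem_of_mem_compl {I : Finset (Fin k)} {a₁ a₂ : Fin k} (h₁ : a₁ ∈ I)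
    (h₂ : a₂ ∈ Iᶜ) : 2 ≤ k := by
  have hne : a₁ ≠ a₂ := fun h => Finset.mem_compl.1 h₂ (h ▸ h₁)
  simpa [Nat.succ_le_iff] using Fintype.one_lt_card_iff.2 ⟨a₁, a₂, hne⟩

lemma one_le_mul_log (hk : 2 ≤ k) : 1 ≤ k * Real.log k := by
  have hk' : (2 : ℝ) ≤ k := by exact_mod_cast hk
  nlinarith [one_half_le_log hk]

lemma pr_multiLFHT_lfhtConst_le {I : Finset (Fin k)} (hε : 0 < ε) (hε1 : ε ≤ 1)
    (hI : IsHiddenPartition ε D I) {a₁ a₂ : Fin k} (h₁ : a₁ ∈ I) (h₂ : a₂ ∈ Iᶜ) :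
    pr (law D (multiLFHT lfhtTest lfhtConst ε a₁ a₂)) (fun o => o ≠ {I, Iᶜ}) ≤ 1 / 100 := by
  have hk := two_le_of_mem_of_mem_compl h₁ h₂
  have hℓ := one_le_mul_log hk
  have hTℓ := mul_log_le_lfhtSize (n := n) (k := k) hε hε1
  have hbound₂ := mul_mul_log_le_lfhtSize_sq_mul (n := n) (k := k) hε hε1
  have hs := le_ceil_lfhtConst_mul_div_three (hℓ.trans hTℓ)
  have hh := le_ceil_lfhtConst_mul_div_votes hk hTℓ
  have hT : 0 < lfhtSize n k ε := by linarith
  have hpos : 0 < ⌈lfhtConst * lfhtSize n k ε / k⌉₊ / votes (1 / (9 * k)) := by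
    by_contra! hzero
    rw [Nat.le_zero.1 hzero, Nat.cast_zero, zero_mul] at hh
    linarith
  have hle : ⌈lfhtConst * lfhtSize n k ε / k⌉₊ / votes (1 / (9 * k)) ≤
      ⌈lfhtConst * lfhtSize n k ε⌉₊ / 3 := by
    refine Nat.div_le_div (Nat.ceil_mono (div_le_self ?_ ?_)) (three_le_votes_ninth hk)
      (by norm_num)
    · unfold lfhtConst; positivity
    · exact_mod_cast one_le_two.trans hk
  exact pr_multiLFHT_le hε hI h₁ h₂ rfl rfl hpos hle
    (mul_add_le_of_le_sq_mul (by norm_num) (by linarith) hT.le hε.le hε1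
      (mul_log_le_lfhtSize_mul_sq hε hε1) hbound₂ hs (by exact_mod_cast hh))
    (mul_mul_add_le_of_le_cube_mul (by norm_num) (by linarith) hT.le hbound₂
      (sq_mul_mul_log_le_lfhtSize_cube_mul hε hε1) hs hh)

lemma costLE_classify {test : Fin k → SampleAlg k n Bool} {N : ℕ}
    (h : ∀ i, CostLE D (test i) N) (l : List (Fin k)) :
    CostLE D (classify test l) (l.length * N) := by
  induction l with
  | nil => exact costLE_ret _ _
  | cons i l ih =>
    rw [List.length_cons, add_mul, one_mul, add_comm (_ * _)]
    exact (h i).bind fun b _ => ih.bind (N := 0) fun χ _ => costLE_ret _ _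

lemma costLE_multiLFHT (test : LFHTest) (C : ℝ) (a₁ a₂ : Fin k) :
    CostLE D (multiLFHT test C ε a₁ a₂)
      (2 * ⌈C * lfhtSize n k ε⌉₊ + k * ⌈C * lfhtSize n k ε / k⌉₊) := by
  set s₁ := ⌈C * lfhtSize n k ε⌉₊
  set s₂ := ⌈C * lfhtSize n k ε / k⌉₊
  have hclassify (X Y : Fin s₁ → Fin n) : CostLE D (classify (fun i =>
      (iid (draw i) s₂).bind fun Z => rand (test n ε (1 / (9 * k)) s₁ s₂ X Y Z))
      ((Finset.univ.erase a₁).erase a₂).toList) (k * s₂) := by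
    refine (costLE_classify (N := s₂) (fun i => ?_) _).mono (Nat.mul_le_mul_right _ ?_)
    · simpa using (costLE_iid (costLE_draw (D := D) i) s₂).bind (N := 0) fun Z _ => costLE_rand _
    · rw [Finset.length_toList]
      exact (Finset.card_le_univ _).trans_eq (Fintype.card_fin k)
  refine ((costLE_iid (costLE_draw a₁) s₁).bind fun X _ => (costLE_iid (costLE_draw a₂) s₁).bind
    fun Y _ => (hclassify X Y).bind fun χ _ => costLE_ret _ 0).mono (by linarith)

lemma exists_costLE_multiLFHT (hε : 0 < ε) (hε1 : ε ≤ 1) (hk : 2 ≤ k) (a₁ a₂ : Fin k) :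
    ∃ N : ℕ, CostLE D (multiLFHT lfhtTest lfhtConst ε a₁ a₂) N ∧
      (N : ℝ) ≤ 10 ^ 32 * lfhtSize n k ε := by
  refine ⟨_, costLE_multiLFHT lfhtTest lfhtConst a₁ a₂, ?_⟩
  have hk' : (0 : ℝ) < k := by positivity
  have hlog := one_half_le_log hk
  have hℓ := one_le_mul_log hk
  have hTℓ := mul_log_le_lfhtSize (n := n) (k := k) hε hε1
  set T := lfhtSize n k ε
  have hC : (0 : ℝ) ≤ lfhtConst := by unfold lfhtConst; positivity
  have hs₁ := Nat.ceil_lt_add_one (show 0 ≤ lfhtConst * T by nlinarith)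
  have hs₂ : (k : ℝ) * ⌈lfhtConst * T / k⌉₊ ≤ lfhtConst * T + k := by
    calc (k : ℝ) * ⌈lfhtConst * T / k⌉₊ ≤ k * (lfhtConst * T / k + 1) := by
          gcongr
          exact (Nat.ceil_lt_add_one (div_nonneg (by nlinarith) hk'.le)).le
      _ = lfhtConst * T + k := by field_simp
  have hkT : (k : ℝ) ≤ 2 * T := by nlinarith
  have hCT : 3 * (lfhtConst * T) + 4 * T ≤ 10 ^ 32 * T := by unfold lfhtConst; linarith
  push_cast
  linarith

end LfhtConstant

/-! ### The equivalence test for a distribution of small norm -/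

section SmallNorm

variable {α : Type*} [Fintype α] {p q : α → ℝ}

lemma sqNorm_one_le (p q : α → ℝ) :
    sqNorm (fun _ => 1) p q ≤ 8 * ∑ z, p z ^ 2 + 2 * sqDist (fun _ => 1) p q := by
  simp only [sqNorm, sqDist, Finset.mul_sum, ← Finset.sum_add_distrib]
  exact Finset.sum_le_sum fun z _ => by nlinarith [sq_nonneg (3 * p z - q z)]

lemma varDir_one_sq_le (p q : α → ℝ) :
    varDir (fun _ => 1) p q ^ 2 ≤ sqNorm (fun _ => 1) p q * sqDist (fun _ => 1) p q ^ 2 := by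
  simp only [varDir, sqNorm, sqDist, one_pow, one_mul]
  calc (∑ z, (p z + q z) * (p z - q z) ^ 2) ^ 2
      ≤ (∑ z, (p z + q z) ^ 2) * ∑ z, ((p z - q z) ^ 2) ^ 2 :=
        Finset.sum_mul_sq_le_sq_mul_sq _ _ _
    _ ≤ (∑ z, (p z + q z) ^ 2) * (∑ z, (p z - q z) ^ 2) ^ 2 := by
        gcongr
        exact Finset.sum_sq_le_sq_sum_of_nonneg fun z _ => sq_nonneg _

lemma avg_not_blockPositive_le_of_norm (hp : p ∈ stdSimplex ℝ α) (hq : q ∈ stdSimplex ℝ α) {h : ℕ}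
    (hh : 0 < h) (hN : 0 < sqDist (fun _ => 1) p q)
    (hle : 10 ^ 6 * (8 * ∑ z, p z ^ 2 + 2 * sqDist (fun _ => 1) p q) ≤
      h ^ 2 * sqDist (fun _ => 1) p q ^ 2) :
    avg (prodWt p q) (2 * h) (fun l => ind (¬ blockPositive h l)) ≤ 1 / 30 := by
  refine (avg_not_blockPositive_le hp hq hh hN).trans ?_
  have : (0 : ℝ) < h := by exact_mod_cast hh
  have hnorm := (mul_le_mul_of_nonneg_left (sqNorm_one_le p q) (by norm_num)).trans hle
  have hdir := varDir_one_sq_le p q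
  set N := sqDist (fun _ => 1) p q
  set V := varDir (fun _ => 1) p q
  set W := sqNorm (fun _ => 1) p q
  have hV : 1000 * V ≤ h * N ^ 2 := by
    refine le_of_pow_le_pow_left₀ two_ne_zero (by positivity) ?_
    calc (1000 * V) ^ 2 = 10 ^ 6 * V ^ 2 := by ring
      _ ≤ 10 ^ 6 * (W * N ^ 2) := by gcongr
      _ = 10 ^ 6 * W * N ^ 2 := by ring
      _ ≤ h ^ 2 * N ^ 2 * N ^ 2 := by gcongr
      _ = (h * N ^ 2) ^ 2 := by ring
  have hVdiv : 8 * V / (h * N ^ 2) ≤ 8 / 1000 := by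
    rw [div_le_iff₀ (by positivity)]; linarith
  have hWdiv : 4 * W / (h ^ 2 * N ^ 2) ≤ 4 / 10 ^ 6 := by
    rw [div_le_iff₀ (by positivity)]; linarith
  linarith

end SmallNorm

/-! ### Flattening -/

section Flattening

variable {k n s : ℕ} {D : Fin k → PMF (Fin n)}

/-- The multiplicity of `x` among the samples `S`, in the form used by `Flat`. -/
abbrev mult (S : Fin s → Fin n) (x : Fin n) : ℕ := (Finset.univ.filter fun t => S t = x).card

lemma mult_eq_count (S : Fin s → Fin n) (x : Fin n) : mult S x = (List.ofFn S).count x := by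
  rw [List.ofFn_eq_map, List.count_eq_length_filter, List.filter_map, List.length_map, mult,
    ← List.toFinset_card_of_nodup ((List.nodup_finRange s).filter _)]
  congr 1
  ext t
  simp

lemma sum_mult (S : Fin s → Fin n) : ∑ x, mult S x = s := by
  simpa using (Finset.card_eq_sum_card_fiberwise (s := Finset.univ) (t := Finset.univ) (f := S)
    (by simp)).symm

lemma wt_drawFlat (S : Fin s → Fin n) (i : Fin k) (z : Flat S) :
    wt (law D (drawFlat S i)) z = wt (D i) z.1 / ((mult S z.1 : ℝ) + 1) := by
  simp only [drawFlat, monad_bind_eq, monad_pure_eq, law_bind, law_draw, law_rand, law_ret, wt,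
    PMF.bind_apply, tsum_fintype, Finset.mul_sum]
  rw [← Fintype.sum_sigma' (fun x j => D i x * (_ * PMF.pure (⟨x, j⟩ : Flat S) z)),
    Fintype.sum_eq_single z fun y hy => by simp [PMF.pure_apply_of_ne _ _ hy.symm]]
  simp [div_eq_mul_inv, ENNReal.toReal_add]

lemma sum_flat (S : Fin s → Fin n) (F : Fin n → ℝ) :
    ∑ z : Flat S, F z.1 = ∑ x, ((mult S x : ℝ) + 1) * F x := by
  simp [Fintype.sum_sigma]

lemma sum_drawFlat_sq (S : Fin s → Fin n) (i : Fin k) :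
    ∑ z, wt (law D (drawFlat S i)) z ^ 2 =
      ∑ x, wt (D i) x ^ 2 * (1 / (((List.ofFn S).count x : ℝ) + 1)) := by
  simp only [wt_drawFlat, ← mult_eq_count]
  rw [sum_flat S fun x => (wt (D i) x / ((mult S x : ℝ) + 1)) ^ 2]
  refine Finset.sum_congr rfl fun x _ => ?_
  field_simp

lemma sum_abs_sub_drawFlat (S : Fin s → Fin n) (i j : Fin k) :
    ∑ z, |wt (law D (drawFlat S i)) z - wt (law D (drawFlat S j)) z| = 2 * tv (D i) (D j) := by
  simp only [wt_drawFlat, ← sub_div]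
  rw [sum_flat S fun x => |(wt (D i) x - wt (D j) x) / ((mult S x : ℝ) + 1)|, tv,
    ← mul_assoc, mul_one_div_cancel two_ne_zero, one_mul]
  refine Finset.sum_congr rfl fun x _ => ?_
  rw [abs_div, abs_of_pos (by positivity : (0 : ℝ) < mult S x + 1)]
  field_simp
  rfl

lemma le_sqDist_drawFlat (S : Fin s → Fin n) {i j : Fin k} {ε : ℝ} (hε : 0 ≤ ε)
    (h : ε ≤ tv (D i) (D j)) :
    4 * ε ^ 2 ≤ (n + s) *
      sqDist (fun _ => 1) (wt (law D (drawFlat S i))) (wt (law D (drawFlat S j))) := by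
  calc 4 * ε ^ 2 = (2 * ε) ^ 2 := by ring
    _ ≤ (∑ z, |wt (law D (drawFlat S i)) z - wt (law D (drawFlat S j)) z|) ^ 2 := by
        rw [sum_abs_sub_drawFlat]
        gcongr
    _ ≤ _ := by
        simpa [sqDist, sq_abs, sum_mult, Finset.sum_add_distrib, add_comm] using
          sq_sum_le_card_mul_sum_sq (s := Finset.univ)
            (f := fun z => |wt (law D (drawFlat S i)) z - wt (law D (drawFlat S j)) z|)

end Flattening

/-! ### The Poisson variable -/

section Poisson

lemma toReal_toPMF_poissonMeasure {r : ℝ} (hr : 0 ≤ r) (s : ℕ) :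
    ((ProbabilityTheory.poissonMeasure r.toNNReal).toPMF s).toReal =
      Real.exp (-r) * r ^ s / s.factorial := by
  rw [MeasureTheory.Measure.toPMF_apply, ← MeasureTheory.measureReal_def,
    ProbabilityTheory.poissonMeasure_real_singleton, Real.coe_toNNReal _ hr]

lemma hasSum_pow_div_factorial (r : ℝ) : HasSum (fun s : ℕ => r ^ s / s.factorial) (Real.exp r) :=
  Real.exp_eq_exp_ℝ ▸ NormedSpace.expSeries_div_hasSum_exp r

lemma hasSum_poisson_descFactorial {r : ℝ} (hr : 0 ≤ r) (j : ℕ) :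
    HasSum (fun s => ((ProbabilityTheory.poissonMeasure r.toNNReal).toPMF s).toReal *
      (s.descFactorial j : ℝ)) (r ^ j) := by
  simp only [toReal_toPMF_poissonMeasure hr]
  rw [← hasSum_nat_add_iff' j, Finset.sum_eq_zero fun s hs => by
    rw [Nat.descFactorial_of_lt (Finset.mem_range.1 hs), Nat.cast_zero, mul_zero], sub_zero]
  convert! (hasSum_pow_div_factorial r).mul_left (r ^ j * Real.exp (-r)) using 1
  · funext s
    have hfac : ((s + j).factorial : ℝ) = s.factorial * (s + j).descFactorial j := by
      have := Nat.factorial_mul_descFactorial (Nat.le_add_left j s)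
      rw [Nat.add_sub_cancel] at this
      exact_mod_cast this.symm
    have hdesc : ((s + j).descFactorial j : ℝ) ≠ 0 :=
      Nat.cast_ne_zero.2 (Nat.descFactorial_pos.2 (Nat.le_add_left j s)).ne'
    rw [hfac]
    field_simp
    ring
  · rw [mul_assoc, ← Real.exp_add, neg_add_cancel, Real.exp_zero, mul_one]

lemma hasSum_poisson_inv {r : ℝ} (hr : 0 < r) :
    HasSum (fun s => ((ProbabilityTheory.poissonMeasure r.toNNReal).toPMF s).toReal *
      (1 / ((s : ℝ) + 1))) ((1 - Real.exp (-r)) / r) := by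
  simp only [toReal_toPMF_poissonMeasure hr.le]
  convert! ((hasSum_nat_add_iff' 1).2 (hasSum_pow_div_factorial r)).mul_left
    (Real.exp (-r) / r) using 1
  · funext s
    rw [Nat.factorial_succ]
    push_cast
    field_simp
    ring
  · rw [Real.exp_neg]
    simp
    field_simp

/-- Markov's inequality for the third factorial moment `r ^ 3` of the Poisson variable with mean
`r`, as a pointwise bound of the indicator of `2 * r < s`. -/
lemma exists_descFactorial_bound {r : ℝ} (hr : 2 ≤ r) :
    ∃ J : ℝ, 0 < J ∧ r ^ 3 / J ≤ 25 / 96 ∧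
      ∀ s : ℕ, 2 * r < s → 1 ≤ (s.descFactorial 3 : ℝ) / J := by
  set j := ⌊2 * r⌋₊ + 1
  have hj : 2 * r < j := by exact_mod_cast Nat.lt_floor_add_one (2 * r)
  have hj5 : 5 ≤ j := Nat.succ_le_succ (Nat.le_floor (by push_cast; linarith))
  have hj5' : (5 : ℝ) ≤ j := by exact_mod_cast hj5
  have hJ : (j.descFactorial 3 : ℝ) = j * ((j - 1) * (j - 2)) := by
    simp only [Nat.descFactorial_succ, Nat.descFactorial_zero, Nat.cast_mul, Nat.sub_zero]
    rw [Nat.cast_sub (by omega), Nat.cast_sub (by omega)]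
    push_cast
    ring
  have hJ0 : (0 : ℝ) < j.descFactorial 3 :=
    Nat.cast_pos.2 (Nat.descFactorial_pos.2 (by omega))
  refine ⟨j.descFactorial 3, hJ0, ?_, fun s hs => ?_⟩
  · rw [div_le_iff₀ hJ0, hJ]
    calc r ^ 3 = (2 * r) ^ 3 / 8 := by ring
      _ ≤ (j : ℝ) ^ 3 / 8 := by gcongr
      _ = j * (j ^ 2 / 8) := by ring
      _ ≤ j * (25 / 96 * ((j - 1) * (j - 2))) := by gcongr; nlinarith
      _ = 25 / 96 * (j * ((j - 1) * (j - 2))) := by ring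
  · rw [one_le_div hJ0]
    exact_mod_cast Nat.descFactorial_le 3 (Nat.succ_le_of_lt ((Nat.floor_lt (by linarith)).2 hs))

end Poisson

/-! ### Find-One-Unknown -/

section FirstDifferent

variable {k n : ℕ} {D : Fin k → PMF (Fin n)} {test : Fin k → SampleAlg k n Bool} {η : ℝ}

lemma pr_firstDifferent_ne_find_le (P : Fin k → Prop) [DecidablePred P] (l : List (Fin k))
    (h : ∀ i ∈ l, pr (law D (test i)) (fun o => o ≠ decide (P i)) ≤ η) :
    pr (law D (firstDifferent test l)) (fun o => o ≠ l.find? fun i => P i) ≤ l.length * η := by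
  induction l with
  | nil =>
    rw [firstDifferent, monad_pure_eq, law_ret, pr_pure_of_not (by simp)]
    simp
  | cons i l ih =>
    have hi := h i List.mem_cons_self
    have hη : 0 ≤ η := (pr_nonneg _ _).trans hi
    have htail := ih fun j hj => h j (List.mem_cons_of_mem _ hj)
    rw [firstDifferent, monad_bind_eq, law_bind, List.length_cons]
    refine (pr_bind_le_add (fun o => o ≠ decide (P i)) (c := l.length * η) (by positivity)
      fun o _ ho => ?_).trans (by push_cast; linarith)
    obtain rfl := not_not.1 ho
    by_cases hP : P i
    · simp only [hP, decide_true, if_true, monad_pure_eq, law_ret, List.find?_cons_of_pos]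
      rw [pr_pure_of_not (by simp)]
      positivity
    · simpa [hP, List.find?_cons_of_neg] using htail

lemma pr_firstDifferent_not_le (P : Fin k → Prop) (hη : 0 ≤ η) (l : List (Fin k))
    (h : ∀ i ∈ l, ¬ P i → pr (law D (test i)) (fun o => o = true) ≤ η) :
    pr (law D (firstDifferent test l)) (fun o => ∃ j, o = some j ∧ ¬ P j) ≤ l.length * η := by
  induction l with
  | nil =>
    rw [firstDifferent, monad_pure_eq, law_ret, pr_pure_of_not (by simp)]
    simp
  | cons i l ih =>
    have htail := ih fun j hj => h j (List.mem_cons_of_mem _ hj)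
    rw [firstDifferent, monad_bind_eq, law_bind, List.length_cons]
    have hl : 0 ≤ (l.length : ℝ) * η := by positivity
    by_cases hP : P i
    · refine (pr_bind_le fun o _ => ?_).trans (show (l.length : ℝ) * η ≤ _ by push_cast; linarith)
      cases o with
      | true =>
        simp only [if_true, monad_pure_eq, law_ret]
        rwa [pr_pure_of_not (by simpa using hP)]
      | false => simpa using htail
    · have hi := h i List.mem_cons_self hP
      refine (pr_bind_le_add (fun o => o = true) hl fun o _ ho => ?_).trans
        (by push_cast; linarith)
      simpa [ho] using htail

lemma costLE_firstDifferent {N : ℕ} (h : ∀ i, CostLE D (test i) N) (l : List (Fin k)) :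
    CostLE D (firstDifferent test l) (l.length * N) := by
  induction l with
  | nil => exact costLE_ret _ _
  | cons i l ih =>
    rw [List.length_cons, add_mul, one_mul, add_comm (_ * _)]
    refine (h i).bind fun b _ => ?_
    cases b with
    | true => exact costLE_ret _ _
    | false => simpa using ih

end FirstDifferent

section FindOneUnknown

variable {k n : ℕ} {D : Fin k → PMF (Fin n)}

/-- The equivalence test that Find-One-Unknown applies to the index `i` after flattening by `S`. -/
def armTest {s : ℕ} (S : Fin s → Fin n) (ε δ b : ℝ) (s₂ : ℕ) (a₁ i : Fin k) :
    SampleAlg k n Bool :=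
  (iid (drawFlat S a₁) s₂).bind fun X => (iid (drawFlat S i) s₂).bind fun Y =>
    rand (equivTest (Flat S) ε δ b s₂ X Y)

/-- The error probability `δ'` prescribed for each equivalence test on `m` indices. -/
def testError (m : ℕ) : ℝ := 1 / (30 * m)

/-- The number `s₂` of samples of each flattened distribution in an equivalence test. -/
def testSize (C : ℝ) (n m : ℕ) (ε : ℝ) : ℕ :=
  ⌈C * n * sketchSize n m ε ^ (-(1 / 2) : ℝ) * Real.log (1 / testError m) / ε ^ 2⌉₊

lemma findOneUnknown_eq (C ε : ℝ) (a₁ : Fin k) (arms : List (Fin k)) :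
    (findOneUnknown equivTest C ε a₁ arms : SampleAlg k n (Option (Fin k))) =
      (rand (ProbabilityTheory.poissonMeasure
        (sketchSize n (arms.length + 1) ε).toNNReal).toPMF).bind fun s =>
      if 2 * sketchSize n (arms.length + 1) ε < s then .ret none else
        (iid (draw a₁) s).bind fun S => firstDifferent (armTest S ε (testError (arms.length + 1))
          (√(30 / sketchSize n (arms.length + 1) ε)) (testSize C n (arms.length + 1) ε) a₁) arms :=
  rfl

lemma law_armTest {s : ℕ} (S : Fin s → Fin n) (ε δ b : ℝ) (s₂ : ℕ) (a₁ i : Fin k) :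
    law D (armTest S ε δ b s₂ a₁ i) =
      (iidPMF (law D (drawFlat S a₁)) s₂).bind fun X =>
        (iidPMF (law D (drawFlat S i)) s₂).bind fun Y => equivTest (Flat S) ε δ b s₂ X Y := by
  simp only [armTest, law_bind, law_iid, law_rand]

lemma pr_armTest_null_le {s : ℕ} (S : Fin s → Fin n) (ε b : ℝ) {δ : ℝ} (hδ : 0 < δ) (s₂ : ℕ)
    {a₁ i : Fin k} (h : D i = D a₁) :
    pr (law D (armTest S ε δ b s₂ a₁ i)) (fun o => o = true) ≤ δ ^ 3 := by
  have hflat : law D (drawFlat S i) = law D (drawFlat S a₁) := by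
    simp only [drawFlat, monad_bind_eq, law_bind, law_draw, h]
  rw [law_armTest, hflat]
  exact pr_equivTest_null_le _ _ _ hδ _

lemma testError_pos {m : ℕ} (hm : 0 < m) : 0 < testError m := by
  unfold testError; positivity

lemma mul_testError_cube_le (l : ℕ) : (l : ℝ) * testError (l + 1) ^ 3 ≤ 1 / (27000 * (l + 1)) := by
  unfold testError
  push_cast
  have hl : (0 : ℝ) ≤ l := l.cast_nonneg
  rw [div_pow, one_pow, mul_one_div, div_le_div_iff₀ (by positivity) (by positivity)]
  nlinarith [mul_nonneg hl hl, mul_nonneg (mul_nonneg hl hl) hl]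

lemma pr_findOneUnknown_eq_le (C ε : ℝ) (a₁ : Fin k) (arms : List (Fin k)) :
    pr (law D (findOneUnknown equivTest C ε a₁ arms)) (fun o => ∃ j, o = some j ∧ D j = D a₁) ≤
      1 / (27000 * (arms.length + 1)) := by
  have hδ := testError_pos arms.length.succ_pos
  rw [findOneUnknown_eq, law_bind]
  refine pr_bind_le fun s _ => ?_
  split_ifs with h
  · rw [law_ret, pr_pure_of_not (by simp)]; positivity
  · rw [law_bind]
    refine pr_bind_le fun S _ => le_trans ?_ (mul_testError_cube_le _)
    simpa only [ne_eq, not_not] using pr_firstDifferent_not_le (fun i => D i ≠ D a₁)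
      (pow_nonneg hδ.le 3) arms
      fun i _ hi => pr_armTest_null_le S ε _ hδ _ (not_not.1 hi)

end FindOneUnknown

section TestSize

variable {n m : ℕ} {ε : ℝ}

lemma sketchSize_le : sketchSize n m ε ≤ n := min_le_left _ _

lemma two_le_sketchSize (hε : 0 < ε) (hε1 : ε ≤ 1) (hn : 2 ≤ n) (hm : 2 ≤ m) :
    2 ≤ sketchSize n m ε := by
  have hn' : (2 : ℝ) ≤ n := by exact_mod_cast hn
  have hm' : (2 : ℝ) ≤ m := by exact_mod_cast hm
  refine le_min hn' ?_
  have hbase : (4 : ℝ) ≤ n * m / ε ^ 2 := by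
    rw [le_div_iff₀ (by positivity)]
    have : ε ^ 2 ≤ 1 := pow_le_one₀ hε.le hε1
    nlinarith
  calc (2 : ℝ) ≤ 4 ^ (2 / 3 : ℝ) := by
        refine le_of_pow_le_pow_left₀ (n := 3) (by norm_num) (by positivity) ?_
        rw [← Real.rpow_natCast (4 ^ (2 / 3 : ℝ)), ← Real.rpow_mul (by norm_num)]
        norm_num
    _ ≤ _ := Real.rpow_le_rpow (by norm_num) hbase (by norm_num)

lemma three_le_log_testError (hm : 2 ≤ m) : 3 ≤ Real.log (1 / testError m) := by
  have hm' : (2 : ℝ) ≤ m := by exact_mod_cast hm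
  rw [testError, one_div_one_div]
  calc (3 : ℝ) ≤ 5 * Real.log 2 := by linarith [Real.log_two_gt_d9]
    _ = Real.log (2 ^ 5) := by rw [Real.log_pow]; norm_num
    _ ≤ Real.log (30 * m) := Real.log_le_log (by norm_num) (by linarith)

/-- The constant `C₁` of Find-One-Unknown. -/
def findConst : ℝ := 10 ^ 9

lemma le_testSize_div_votes (hε : 0 < ε) (hε1 : ε ≤ 1) (hn : 2 ≤ n) (hm : 2 ≤ m) :
    10 ^ 7 * (n / (√(sketchSize n m ε) * ε ^ 2)) ≤
      (testSize findConst n m ε / (2 * votes (testError m)) : ℕ) := by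
  have hs := two_le_sketchSize hε hε1 hn hm
  have hsn : sketchSize n m ε ≤ n := sketchSize_le
  have hlog := three_le_log_testError hm
  have hsize : findConst * n * (1 / √(sketchSize n m ε)) * Real.log (1 / testError m) / ε ^ 2 ≤
      testSize findConst n m ε := by
    rw [Real.sqrt_eq_rpow, one_div (_ ^ _), ← Real.rpow_neg (by linarith)]
    exact Nat.le_ceil _
  have hfloor := sub_one_lt_natDiv (testSize findConst n m ε) (2 * votes (testError m))
  have hvotes : (votes (testError m) : ℝ) < 30 * Real.log (1 / testError m) + 1 :=
    Nat.ceil_lt_add_one (by positivity)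
  have hvotes0 : (0 : ℝ) < votes (testError m) :=
    lt_of_lt_of_le (by positivity) (Nat.le_ceil (30 * Real.log (1 / testError m)))
  push_cast at hfloor
  set s := sketchSize n m ε
  set Λ := Real.log (1 / testError m)
  have hone : 1 ≤ n / (√s * ε ^ 2) := by
    rw [one_le_div (by positivity)]
    have hsqrt : √s ≤ s := Real.sqrt_le_self_iff.2 (.inr (by linarith))
    exact (mul_le_of_le_one_right (Real.sqrt_nonneg s) (pow_le_one₀ hε.le hε1)).trans
      (hsqrt.trans hsn)
  have hquot : 10 ^ 9 / 62 * (n / (√s * ε ^ 2)) ≤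
      (testSize findConst n m ε : ℝ) / (2 * votes (testError m)) := by
    calc 10 ^ 9 / 62 * (n / (√s * ε ^ 2))
        = findConst * n * (1 / √s) * Λ / ε ^ 2 / (2 * (31 * Λ)) := by
          have hΛ : Λ ≠ 0 := by positivity
          unfold findConst; field_simp; norm_num
      _ ≤ (testSize findConst n m ε : ℝ) / (2 * votes (testError m)) := by
          gcongr; linarith
  linarith

lemma mul_add_le_of_le_testSize {n s h Q N : ℝ} (hε : 0 < ε) (hε1 : ε ≤ 1) (hs : 0 < s)
    (hsn : s ≤ n) (hh : 10 ^ 7 * (n / (√s * ε ^ 2)) ≤ h) (hN : ε ^ 2 / n ≤ N)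
    (hQ : Q ≤ 1000 / s) : 10 ^ 6 * (8 * Q + 2 * N) ≤ h ^ 2 * N ^ 2 := by
  have hn : 0 < n := hs.trans_le hsn
  have hN0 : 0 < N := lt_of_lt_of_le (by positivity) hN
  set A := n / (√s * ε ^ 2) with hA
  have hA2 : A ^ 2 = n ^ 2 / (s * ε ^ 4) := by
    rw [hA, div_pow, mul_pow, Real.sq_sqrt hs.le, ← pow_mul]
  have hinv : 1 / s ≤ A ^ 2 * N ^ 2 := by
    calc 1 / s = A ^ 2 * (ε ^ 2 / n) ^ 2 := by rw [hA2]; field_simp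
      _ ≤ A ^ 2 * N ^ 2 := by gcongr
  have hself : N ≤ A ^ 2 * N ^ 2 := by
    have hone : 1 ≤ n / (s * ε ^ 2) := by
      rw [one_le_div (by positivity)]
      exact (mul_le_of_le_one_right hs.le (pow_le_one₀ hε.le hε1)).trans hsn
    calc N ≤ n / (s * ε ^ 2) * N := le_mul_of_one_le_left hN0.le hone
      _ = A ^ 2 * (ε ^ 2 / n) * N := by rw [hA2]; field_simp
      _ ≤ A ^ 2 * N * N := by gcongr
      _ = A ^ 2 * N ^ 2 := by ring
  calc 10 ^ 6 * (8 * Q + 2 * N) ≤ 10 ^ 6 * (8 * (1000 * (1 / s)) + 2 * N) := by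
        gcongr; rwa [mul_one_div]
    _ ≤ (10 ^ 7 * A) ^ 2 * N ^ 2 := by linarith
    _ ≤ h ^ 2 * N ^ 2 := by gcongr

end TestSize

section FindOneUnknown

variable {k n m s : ℕ} {ε : ℝ} {D : Fin k → PMF (Fin n)} {a₁ : Fin k}

lemma pr_armTest_alt_le (S : Fin s → Fin n) {i : Fin k} (b : ℝ) (hε : 0 < ε)
    (hε1 : ε ≤ 1) (hn : 2 ≤ n) (hm : 2 ≤ m) (htv : ε ≤ tv (D a₁) (D i))
    (hs : s ≤ 2 * sketchSize n m ε)
    (hQ : ∑ z, wt (law D (drawFlat S a₁)) z ^ 2 ≤ 1000 / sketchSize n m ε) :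
    pr (law D (armTest S ε (testError m) b (testSize findConst n m ε) a₁ i))
      (fun o => o ≠ true) ≤ testError m ^ 3 := by
  rw [law_armTest]
  refine pr_equivTest_alt_le _ _ _ _ (testError_pos (by omega)) _ ?_
  have hn0 : (0 : ℝ) < n := by positivity
  have hs₁ := two_le_sketchSize hε hε1 hn hm
  have hs₁n : sketchSize n m ε ≤ n := sketchSize_le
  have hsize := le_testSize_div_votes hε hε1 hn hm
  have hdist := le_sqDist_drawFlat S hε.le htv
  set h := testSize findConst n m ε / (2 * votes (testError m))
  set N := sqDist (fun _ => 1) (wt (law D (drawFlat S a₁))) (wt (law D (drawFlat S i)))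
  have hN : ε ^ 2 / n ≤ N := by
    have hN0 : 0 ≤ N := nonneg_of_mul_nonneg_right
      ((by positivity : (0 : ℝ) ≤ 4 * ε ^ 2).trans hdist) (by positivity)
    rw [div_le_iff₀ hn0]
    have hsn : s ≤ 2 * (n : ℝ) := hs.trans (mul_le_mul_of_nonneg_left hs₁n two_pos.le)
    nlinarith [mul_le_mul_of_nonneg_right hsn hN0]
  have hh : (0 : ℝ) < h := lt_of_lt_of_le (by positivity) hsize
  exact avg_not_blockPositive_le_of_norm (wt_mem_stdSimplex _) (wt_mem_stdSimplex _)
    (by exact_mod_cast hh) (lt_of_lt_of_le (by positivity) hN)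
    (mul_add_le_of_le_testSize hε hε1 (by linarith) hs₁n hsize hN hQ)

variable {I : Finset (Fin k)} {arms : List (Fin k)}

lemma pr_firstDifferent_armTest_fail_le (S : Fin s → Fin n) (b : ℝ) (hε : 0 < ε) (hε1 : ε ≤ 1)
    (hn : 2 ≤ n) (hm : 2 ≤ m) (hI : IsHiddenPartition ε D I) (h₁ : a₁ ∈ I)
    (harms : ∃ i ∈ arms, i ∈ Iᶜ) (hs : s ≤ 2 * sketchSize n m ε)
    (hQ : ∑ z, wt (law D (drawFlat S a₁)) z ^ 2 ≤ 1000 / sketchSize n m ε) :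
    pr (law D (firstDifferent
        (armTest S ε (testError m) b (testSize findConst n m ε) a₁) arms))
      (fun o => ¬ ∃ j ∈ Iᶜ, o = some j) ≤ arms.length * testError m ^ 3 := by
  obtain ⟨i₀, hi₀, hi₀'⟩ := harms
  refine (pr_mono fun o _ ho => ?_).trans
    (pr_firstDifferent_ne_find_le (fun i => i ∈ Iᶜ) arms fun i _ => ?_)
  · rintro rfl
    apply ho
    cases hf : arms.find? (fun i => decide (i ∈ Iᶜ)) with
    | none =>
      rw [List.find?_eq_none] at hf
      exact absurd (decide_eq_true hi₀') (hf i₀ hi₀)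
    | some j => exact ⟨j, by simpa using List.find?_some hf, rfl⟩
  · by_cases hi : i ∈ Iᶜ
    · rw [decide_eq_true hi]
      exact pr_armTest_alt_le S b hε hε1 hn hm (hI.le_tv a₁ h₁ i hi) hs hQ
    · simpa only [decide_eq_false hi, ne_eq, Bool.not_eq_false] using
        pr_armTest_null_le S ε b (testError_pos (by omega)) _
          (hI.eq_of_mem i (by simpa using hi) a₁ h₁)

lemma avg_sum_sq_div_count_le {α : Type*} [Fintype α] [DecidableEq α] {p : α → ℝ}
    (hp : p ∈ stdSimplex ℝ α) (s : ℕ) :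
    avg p s (fun l => ∑ x, p x ^ 2 * (1 / ((l.count x : ℝ) + 1))) ≤ 1 / (s + 1) := by
  simp only [avg_sum, avg_mul_left]
  calc ∑ x, p x ^ 2 * avg p s (fun l => 1 / ((l.count x : ℝ) + 1))
      ≤ ∑ x, p x * (1 / ((s : ℝ) + 1)) := by
        refine Finset.sum_le_sum fun x _ => ?_
        rw [mul_one_div, le_div_iff₀ (by positivity)]
        linarith [mul_le_mul_of_nonneg_left (mul_avg_inv_count_le hp x s) (hp.1 x)]
    _ = 1 / (s + 1) := by rw [← Finset.sum_mul, hp.2, one_mul]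

lemma pr_iid_firstDifferent_fail_le (b : ℝ) (hε : 0 < ε) (hε1 : ε ≤ 1) (hn : 2 ≤ n) (hm : 2 ≤ m)
    (hI : IsHiddenPartition ε D I) (h₁ : a₁ ∈ I) (harms : ∃ i ∈ arms, i ∈ Iᶜ)
    (hs : s ≤ 2 * sketchSize n m ε) :
    pr ((iidPMF (D a₁) s).bind fun S => law D (firstDifferent
        (armTest S ε (testError m) b (testSize findConst n m ε) a₁) arms))
      (fun o => ¬ ∃ j ∈ Iᶜ, o = some j) ≤
      sketchSize n m ε / 1000 * (1 / (s + 1)) + arms.length * testError m ^ 3 := by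
  have hp := wt_mem_stdSimplex (D a₁)
  have hs₁ : 0 < sketchSize n m ε := two_pos.trans_le (two_le_sketchSize hε hε1 hn hm)
  have hδ := testError_pos (m := m) (by omega)
  refine (pr_iid_bind_le (D a₁) (g := fun l => sketchSize n m ε / 1000 *
    (∑ x, wt (D a₁) x ^ 2 * (1 / ((l.count x : ℝ) + 1))) + arms.length * testError m ^ 3)
    fun S => ?_).trans ?_
  · rw [← sum_drawFlat_sq]
    by_cases hQ : ∑ z, wt (law D (drawFlat S a₁)) z ^ 2 ≤ 1000 / sketchSize n m ε
    · exact (pr_firstDifferent_armTest_fail_le S b hε hε1 hn hm hI h₁ harms hs hQ).trans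
        (le_add_of_nonneg_left (by positivity))
    · have hbad : 1 ≤ sketchSize n m ε / 1000 * ∑ z, wt (law D (drawFlat S a₁)) z ^ 2 := by
        rw [not_le, div_lt_iff₀ hs₁] at hQ
        linarith
      exact (pr_le_one _ _).trans (hbad.trans (le_add_of_nonneg_right (by positivity)))
  · rw [avg_add, avg_mul_left, avg_const hp]
    gcongr
    exact avg_sum_sq_div_count_le hp s

lemma pr_findOneUnknown_fail_le (hε : 0 < ε) (hε1 : ε ≤ 1) (hn : 2 ≤ n)
    (hI : IsHiddenPartition ε D I) (h₁ : a₁ ∈ I) (harms : ∃ i ∈ arms, i ∈ Iᶜ) :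
    pr (law D (findOneUnknown equivTest findConst ε a₁ arms))
      (fun o => ¬ ∃ j ∈ Iᶜ, o = some j) ≤ 0.262 := by
  have hlen : 1 ≤ arms.length := List.length_pos_of_mem harms.choose_spec.1
  have hm : 2 ≤ arms.length + 1 := by omega
  have hs₁ := two_le_sketchSize hε hε1 hn hm
  rw [findOneUnknown_eq, law_bind, law_rand]
  set s₁ := sketchSize n (arms.length + 1) ε
  set η := (arms.length : ℝ) * testError (arms.length + 1) ^ 3
  have hη0 : 0 ≤ η := by have := testError_pos arms.length.succ_pos; positivity
  obtain ⟨J, hJ, hJ_le, hJ_ge⟩ := exists_descFactorial_bound hs₁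
  set μ := (ProbabilityTheory.poissonMeasure s₁.toNNReal).toPMF
  have hsum : HasSum (fun s => (μ s).toReal *
      ((s.descFactorial 3 : ℝ) / J + (s₁ / 1000 * (1 / ((s : ℝ) + 1)) + η)))
      (s₁ ^ 3 / J + (s₁ / 1000 * ((1 - Real.exp (-s₁)) / s₁) + 1 * η)) := by
    have hmoment := (hasSum_poisson_descFactorial (r := s₁) (by linarith) 3).div_const (J : ℝ)
    have hinv := (hasSum_poisson_inv (r := s₁) (by linarith)).mul_left (s₁ / 1000)
    have hconst := (hasSum_toReal μ).mul_right η
    exact (hmoment.add (hinv.add hconst)).congr_fun fun s => by ring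
  refine (pr_bind_le_of_hasSum (fun s _ => ?_) hsum).trans ?_
  · split_ifs with h
    · exact (pr_le_one _ _).trans ((hJ_ge s h).trans (le_add_of_nonneg_right (by positivity)))
    · rw [law_bind, law_iid, law_draw]
      exact (pr_iid_firstDifferent_fail_le _ hε hε1 hn hm hI h₁ harms (not_lt.1 h)).trans
        (le_add_of_nonneg_left (by positivity))
  · have hflat : s₁ / 1000 * ((1 - Real.exp (-s₁)) / s₁) ≤ 1 / 1000 := by
      rw [div_mul_div_comm, mul_comm, mul_div_mul_right _ _ (by linarith)]
      linarith [Real.exp_pos (-s₁)]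
    have hη_le : η ≤ 1 / 54000 := by
      refine (mul_testError_cube_le _).trans (one_div_le_one_div_of_le (by norm_num) ?_)
      have : (1 : ℝ) ≤ arms.length := by exact_mod_cast hlen
      linarith
    linarith

end FindOneUnknown

/-! ### The random subset -/

section RandomSubset

lemma descFactorial_mul_pow_le (k b t : ℕ) :
    (k - b).descFactorial t * k ^ t ≤ k.descFactorial t * (k - b) ^ t := by
  induction t with
  | zero => simp
  | succ t ih =>
    have hfactor : (k - b - t) * k ≤ (k - t) * (k - b) := by
      rw [Nat.sub_mul (k - b), Nat.sub_mul k t, mul_comm k]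
      exact Nat.sub_le_sub_left (Nat.mul_le_mul_left t (Nat.sub_le k b)) _
    calc (k - b).descFactorial (t + 1) * k ^ (t + 1)
        = (k - b - t) * k * ((k - b).descFactorial t * k ^ t) := by
          rw [Nat.descFactorial_succ]; ring
      _ ≤ (k - t) * (k - b) * (k.descFactorial t * (k - b) ^ t) := Nat.mul_le_mul hfactor ih
      _ = k.descFactorial (t + 1) * (k - b) ^ (t + 1) := by rw [Nat.descFactorial_succ]; ring

lemma choose_mul_pow_le (k b t : ℕ) : (k - b).choose t * k ^ t ≤ k.choose t * (k - b) ^ t := by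
  have h := descFactorial_mul_pow_le k b t
  rw [Nat.descFactorial_eq_factorial_mul_choose, Nat.descFactorial_eq_factorial_mul_choose,
    mul_assoc, mul_assoc] at h
  exact Nat.le_of_mul_le_mul_left h t.factorial_pos

lemma choose_div_choose_le_exp {k b t : ℕ} (hb : b ≤ k) (ht : t ≤ k) :
    ((k - b).choose t : ℝ) / k.choose t ≤ Real.exp (-(t * (b / k))) := by
  rcases k.eq_zero_or_pos with rfl | hk
  · obtain rfl : t = 0 := by omega
    simp
  have hchoose : (0 : ℝ) < k.choose t := by exact_mod_cast Nat.choose_pos ht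
  have hratio : ((k - b).choose t : ℝ) * k ^ t ≤ k.choose t * (k - b) ^ t := by
    rw [← Nat.cast_sub hb]
    exact_mod_cast choose_mul_pow_le k b t
  calc ((k - b).choose t : ℝ) / k.choose t
      ≤ (k - b) ^ t / k ^ t := by
        rw [div_le_div_iff₀ hchoose (by positivity), mul_comm (_ ^ t)]
        exact hratio
    _ = (1 - b / k) ^ t := by rw [← div_pow, sub_div, div_self (by positivity)]
    _ ≤ Real.exp (-(b / k)) ^ t :=
        pow_le_pow_left₀ (sub_nonneg.2 (div_le_one_of_le₀ (by exact_mod_cast hb) k.cast_nonneg))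
          (Real.one_sub_le_exp_neg _) t
    _ = Real.exp (-(t * (b / k))) := by rw [← Real.exp_nat_mul, mul_neg]

lemma exp_neg_nine_le : Real.exp (-9) ≤ 1 / 512 := by
  have htwo : (2 : ℝ) ≤ Real.exp 1 := by linarith [Real.add_one_le_exp (1 : ℝ)]
  calc Real.exp (-9) = 1 / Real.exp 1 ^ 9 := by
        rw [← Real.exp_nat_mul, Real.exp_neg, one_div]; norm_num
    _ ≤ 1 / 2 ^ 9 := by gcongr
    _ = 1 / 512 := by norm_num

variable {k r : ℕ}

lemma card_of_mem_randomSubset {J : Finset (Fin k)} (hJ : J ∈ (randomSubset k r).support) :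
    J.card = subsetSize k r := by
  rw [randomSubset, PMF.mem_support_uniformOfFinset_iff] at hJ
  exact (Finset.mem_powersetCard.1 hJ).2

lemma pr_randomSubset_disjoint_le_choose (B : Finset (Fin k)) :
    pr (randomSubset k r) (fun J => Disjoint J B) ≤
      ((k - B.card).choose (subsetSize k r) : ℝ) / k.choose (subsetSize k r) := by
  set t := subsetSize k r with ht
  rw [pr, randomSubset]
  refine (congrArg ENNReal.toReal (PMF.toOuterMeasure_uniformOfFinset_apply _ _)).trans_le ?_
  rw [ENNReal.toReal_div, Finset.card_powersetCard, Finset.card_univ, Fintype.card_fin, ← ht]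
  have hcard : (Finset.powersetCard t Bᶜ).card = (k - B.card).choose t := by
    rw [Finset.card_powersetCard, Finset.card_compl, Fintype.card_fin]
  simp only [ENNReal.toReal_natCast, ← hcard]
  gcongr
  intro J hJ
  obtain ⟨hJt, hJB⟩ := (@Finset.mem_filter _ _ (_) _ _).1 hJ
  exact Finset.mem_powersetCard.2 ⟨fun x hx => Finset.mem_compl.2 (Finset.disjoint_left.1 hJB hx),
    (Finset.mem_powersetCard.1 hJt).2⟩

lemma pr_randomSubset_disjoint_le (hr : 0 < r) {B : Finset (Fin k)} (hB : r ≤ B.card) :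
    pr (randomSubset k r) (fun J => Disjoint J B) ≤ 1 / 512 := by
  have hBk : B.card ≤ k := (Finset.card_le_univ B).trans_eq (Fintype.card_fin k)
  refine (pr_randomSubset_disjoint_le_choose B).trans ?_
  rcases le_total ⌈(9 * k / r : ℝ)⌉₊ k with hle | hle
  · have ht : (9 * k / r : ℝ) ≤ subsetSize k r := by
      rw [subsetSize, min_eq_left hle]
      exact Nat.le_ceil _
    have hk : (0 : ℝ) < k := by exact_mod_cast (by omega : 0 < k)
    refine (choose_div_choose_le_exp hBk (min_le_right _ _)).trans
      ((Real.exp_le_exp.2 (neg_le_neg ?_)).trans exp_neg_nine_le)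
    calc (9 : ℝ) = 9 * k / r * (r / k) := by field_simp
      _ ≤ subsetSize k r * (B.card / k) := by gcongr
  · rw [subsetSize, min_eq_right hle, Nat.choose_eq_zero_of_lt (by omega)]
    norm_num

lemma le_subsetSize (hr : 0 < r) : (k : ℝ) / r ≤ subsetSize k r := by
  have hr' : (1 : ℝ) ≤ r := by exact_mod_cast hr
  rw [subsetSize, Nat.cast_min, le_min_iff]
  refine ⟨le_trans ?_ (Nat.le_ceil _), div_le_self k.cast_nonneg hr'⟩
  gcongr
  linarith [k.cast_nonneg (α := ℝ)]

lemma subsetSize_le (hr : 0 < r) (hrk : r ≤ k) : (subsetSize k r : ℝ) ≤ 10 * (k / r) := by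
  have hone : 1 ≤ (k : ℝ) / r := (one_le_div (by positivity)).2 (by exact_mod_cast hrk)
  calc (subsetSize k r : ℝ) ≤ (⌈(9 * k / r : ℝ)⌉₊ : ℝ) := Nat.cast_le.2 (min_le_left _ _)
    _ ≤ 9 * (k / r) + 1 := by
        rw [← mul_div_assoc]
        exact (Nat.ceil_lt_add_one (by positivity)).le
    _ ≤ 10 * (k / r) := by linarith

lemma two_le_subsetSize (hr : 0 < r) (hrk : r ≤ k) (hk : 2 ≤ k) : 2 ≤ subsetSize k r := by
  have hrk' : (r : ℝ) ≤ k := by exact_mod_cast hrk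
  have htwo : (2 : ℝ) ≤ 9 * k / r := by
    rw [le_div_iff₀ (by positivity)]
    linarith [r.cast_nonneg (α := ℝ)]
  exact le_min (by exact_mod_cast htwo.trans (Nat.le_ceil _)) hk

end RandomSubset

/-! ### The cost of the first stage -/

section FindStage

variable {k n r m : ℕ} {ε : ℝ}

lemma mul_div_sqrt_sketchSize_le (hε : 0 < ε) (hn : 0 < n) (hm : 0 < m) :
    m * (n / (√(sketchSize n m ε) * ε ^ 2)) ≤
      (n * m / ε ^ 2 : ℝ) ^ (2 / 3 : ℝ) + m * √n / ε ^ 2 := by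
  set y : ℝ := n * m / ε ^ 2
  have hy : 0 < y := by positivity
  have hfactor (s : ℝ) : m * (n / (√s * ε ^ 2)) = y / √s := by
    rw [mul_div_assoc', mul_comm (√s), ← div_div, mul_comm (m : ℝ)]
  rcases min_choice (n : ℝ) (y ^ (2 / 3 : ℝ)) with h | h
  · calc m * (n / (√(sketchSize n m ε) * ε ^ 2)) = m * (n / √n) / ε ^ 2 := by
          rw [sketchSize, h, ← div_div, mul_div_assoc]
      _ = m * √n / ε ^ 2 := by rw [Real.div_sqrt]
      _ ≤ y ^ (2 / 3 : ℝ) + m * √n / ε ^ 2 := le_add_of_nonneg_left (by positivity)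
  · calc m * (n / (√(sketchSize n m ε) * ε ^ 2)) = y ^ (1 : ℝ) / y ^ (1 / 3 : ℝ) := by
          rw [hfactor, sketchSize, h, Real.sqrt_eq_rpow, ← Real.rpow_mul hy.le, Real.rpow_one]
          norm_num
      _ = y ^ (2 / 3 : ℝ) := by rw [← Real.rpow_sub hy]; norm_num
      _ ≤ y ^ (2 / 3 : ℝ) + m * √n / ε ^ 2 := le_add_of_nonneg_right (by positivity)

lemma log_testError_le (hk : 2 ≤ k) (hm : 0 < m) (hmk : (m : ℝ) ≤ 11 * k) :
    Real.log (1 / testError m) ≤ 10 * Real.log k := by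
  have hk' : (2 : ℝ) ≤ k := by exact_mod_cast hk
  calc Real.log (1 / testError m) ≤ Real.log (2 ^ 9 * k) := by
        rw [testError, one_div_one_div]
        exact Real.log_le_log (by positivity) (by linarith)
    _ = 9 * Real.log 2 + Real.log k := by
        rw [Real.log_mul (by norm_num) (by positivity), Real.log_pow]
        norm_num
    _ ≤ 10 * Real.log k := by linarith [Real.log_le_log two_pos hk']

lemma testSize_lt (hε : 0 < ε) (hε1 : ε ≤ 1) (hn : 2 ≤ n) (hm : 2 ≤ m) :
    (testSize findConst n m ε : ℝ) <
      10 ^ 9 * (n / (√(sketchSize n m ε) * ε ^ 2)) * Real.log (1 / testError m) + 1 := by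
  have hs := two_le_sketchSize hε hε1 hn hm
  have hΛ := three_le_log_testError hm
  have heq : findConst * n * sketchSize n m ε ^ (-(1 / 2) : ℝ) * Real.log (1 / testError m) /
      ε ^ 2 = 10 ^ 9 * (n / (√(sketchSize n m ε) * ε ^ 2)) * Real.log (1 / testError m) := by
    rw [Real.rpow_neg (by linarith), ← Real.sqrt_eq_rpow, findConst]
    field_simp
  rw [testSize, heq]
  exact Nat.ceil_lt_add_one (by positivity)

lemma findOneUnknown_cost_le_log (hε : 0 < ε) (hε1 : ε ≤ 1) (hn : 2 ≤ n) (hm : 2 ≤ m) :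
    2 * sketchSize n m ε + m * (2 * testSize findConst n m ε) ≤
      3 * 10 ^ 9 * Real.log (1 / testError m) *
        ((n * m / ε ^ 2 : ℝ) ^ (2 / 3 : ℝ) + m * √n / ε ^ 2) := by
  have hΛ := three_le_log_testError hm
  have htests := mul_div_sqrt_sketchSize_le hε (by omega : 0 < n) (by omega : 0 < m)
  have hsketch : sketchSize n m ε ≤ (n * m / ε ^ 2 : ℝ) ^ (2 / 3 : ℝ) := min_le_right _ _
  have hsize := mul_le_mul_of_nonneg_left (testSize_lt hε hε1 hn hm).le m.cast_nonneg (α := ℝ)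
  have hmY : (m : ℝ) ≤ m * √n / ε ^ 2 := by
    have hsqrt : 1 ≤ √(n : ℝ) := Real.one_le_sqrt.2 (by exact_mod_cast one_le_two.trans hn)
    rw [le_div_iff₀ (by positivity)]
    exact mul_le_mul_of_nonneg_left ((pow_le_one₀ hε.le hε1).trans hsqrt) m.cast_nonneg
  set Λ := Real.log (1 / testError m)
  set X := (n * m / ε ^ 2 : ℝ) ^ (2 / 3 : ℝ)
  set Y := m * √n / ε ^ 2
  have hXY : X + Y ≤ Λ * (X + Y) := le_mul_of_one_le_left (by positivity) (by linarith)
  have hscaled := mul_le_mul_of_nonneg_left htests (by linarith : 0 ≤ Λ)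
  have hX : 0 ≤ X := by positivity
  linarith

lemma rpow_add_le_mul_max (hr : 0 < r) (hmk : (m : ℝ) ≤ 11 * (k / r)) :
    (n * m / ε ^ 2 : ℝ) ^ (2 / 3 : ℝ) + m * √n / ε ^ 2 ≤
      22 * max ((n * k / (r * ε ^ 2) : ℝ) ^ (2 / 3 : ℝ)) (k * √n / (r * ε ^ 2)) := by
  have hpow : (n * m / ε ^ 2 : ℝ) ^ (2 / 3 : ℝ) ≤ 11 * (n * k / (r * ε ^ 2)) ^ (2 / 3 : ℝ) := by
    calc (n * m / ε ^ 2 : ℝ) ^ (2 / 3 : ℝ) ≤ (n * (11 * (k / r)) / ε ^ 2) ^ (2 / 3 : ℝ) := by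
          gcongr
      _ = 11 ^ (2 / 3 : ℝ) * (n * k / (r * ε ^ 2)) ^ (2 / 3 : ℝ) := by
          rw [← Real.mul_rpow (by norm_num) (by positivity)]
          congr 1
          ring
      _ ≤ 11 * (n * k / (r * ε ^ 2)) ^ (2 / 3 : ℝ) := by
          gcongr
          exact Real.rpow_le_self_of_one_le (by norm_num) (by norm_num)
  have hlin : m * √n / ε ^ 2 ≤ 11 * (k * √n / (r * ε ^ 2)) := by
    calc m * √n / ε ^ 2 ≤ 11 * (k / r) * √n / ε ^ 2 := by gcongr
      _ = 11 * (k * √n / (r * ε ^ 2)) := by ring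
  linarith [le_max_left ((n * k / (r * ε ^ 2) : ℝ) ^ (2 / 3 : ℝ)) (k * √n / (r * ε ^ 2)),
    le_max_right ((n * k / (r * ε ^ 2) : ℝ) ^ (2 / 3 : ℝ)) (k * √n / (r * ε ^ 2))]

lemma findOneUnknown_cost_le (hε : 0 < ε) (hε1 : ε ≤ 1) (hn : 2 ≤ n) (hk : 2 ≤ k)
    (hr : 0 < r) (hm : 2 ≤ m) (hmk : (m : ℝ) ≤ 11 * (k / r)) :
    2 * sketchSize n m ε + m * (2 * testSize findConst n m ε) ≤ 10 ^ 12 * costFind n k r ε := by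
  have hk_div : (k : ℝ) / r ≤ k := div_le_self k.cast_nonneg (by exact_mod_cast hr)
  have hlog := one_half_le_log hk
  have hcost := costFind_nonneg n k r ε
  set Z := max ((n * k / (r * ε ^ 2) : ℝ) ^ (2 / 3 : ℝ)) (k * √n / (r * ε ^ 2)) with hZ
  calc 2 * sketchSize n m ε + m * (2 * testSize findConst n m ε)
      ≤ 3 * 10 ^ 9 * Real.log (1 / testError m) *
          ((n * m / ε ^ 2 : ℝ) ^ (2 / 3 : ℝ) + m * √n / ε ^ 2) :=
        findOneUnknown_cost_le_log hε hε1 hn hm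
    _ ≤ 3 * 10 ^ 9 * (10 * Real.log k) * (22 * Z) := by
        gcongr
        · exact log_testError_le hk (by omega) (hmk.trans (by linarith))
        · exact rpow_add_le_mul_max hr hmk
    _ = 66 * 10 ^ 10 * costFind n k r ε := by rw [costFind, ← hZ]; ring
    _ ≤ 10 ^ 12 * costFind n k r ε := by gcongr; norm_num

/-- The first stage: Find-One-Unknown on a random subset for smaller cluster size `r`. -/
def findStage (n k r : ℕ) (ε : ℝ) (a₁ : Fin k) : SampleAlg k n (Option (Fin k)) :=
  (rand (randomSubset k r)).bind fun J =>
    findOneUnknown equivTest findConst ε a₁ (J.erase a₁).toList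

variable {D : Fin k → PMF (Fin n)}

lemma length_erase_toList_le (J : Finset (Fin k)) (a : Fin k) :
    (J.erase a).toList.length ≤ J.card := by
  rw [Finset.length_toList]
  exact Finset.card_erase_le

lemma card_le_length_erase_toList_add_one (J : Finset (Fin k)) (a : Fin k) :
    J.card ≤ (J.erase a).toList.length + 1 := by
  rw [Finset.length_toList]
  exact Nat.sub_le_iff_le_add.1 Finset.pred_card_le_card_erase

lemma pr_findStage_fail_le {I : Finset (Fin k)} (hε : 0 < ε) (hε1 : ε ≤ 1) (hn : 2 ≤ n)
    (hI : IsHiddenPartition ε D I) {a₁ : Fin k} (h₁ : a₁ ∈ I) (hr : 0 < r) (hrI : r ≤ Iᶜ.card) :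
    pr (law D (findStage n k r ε a₁)) (fun o => ¬ ∃ j ∈ Iᶜ, o = some j) ≤ 0.265 := by
  rw [findStage, law_bind, law_rand]
  calc _ ≤ pr (randomSubset k r) (fun J => Disjoint J Iᶜ) + 0.262 := by
        refine pr_bind_le_add _ (by norm_num) fun J _ hJ => ?_
        obtain ⟨i, hiJ, hi⟩ := Finset.not_disjoint_iff.1 hJ
        have hne : i ≠ a₁ := fun h => Finset.mem_compl.1 hi (h ▸ h₁)
        exact pr_findOneUnknown_fail_le hε hε1 hn hI h₁
          ⟨i, Finset.mem_toList.2 (Finset.mem_erase.2 ⟨hne, hiJ⟩), hi⟩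
    _ ≤ 1 / 512 + 0.262 := by gcongr; exact pr_randomSubset_disjoint_le hr hrI
    _ ≤ 0.265 := by norm_num

lemma pr_findStage_eq_le (hr : 0 < r) (hk : 0 < k) (ε : ℝ) (a₁ : Fin k) :
    pr (law D (findStage n k r ε a₁)) (fun o => ∃ j, o = some j ∧ D j = D a₁) ≤
      r / (27000 * k) := by
  rw [findStage, law_bind, law_rand]
  refine pr_bind_le fun J hJ => (pr_findOneUnknown_eq_le _ _ _ _).trans ?_
  have hcard : (subsetSize k r : ℝ) ≤ (J.erase a₁).toList.length + 1 := by
    rw [← card_of_mem_randomSubset hJ]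
    exact_mod_cast card_le_length_erase_toList_add_one J a₁
  calc 1 / (27000 * (((J.erase a₁).toList.length : ℝ) + 1)) ≤ 1 / (27000 * (k / r)) := by
        gcongr
        exact (le_subsetSize hr).trans hcard
    _ = r / (27000 * k) := by field_simp

lemma costLE_armTest {s : ℕ} (S : Fin s → Fin n) (ε δ b : ℝ) (s₂ : ℕ) (a₁ i : Fin k) :
    CostLE D (armTest S ε δ b s₂ a₁ i) (2 * s₂) := by
  have hflat (j : Fin k) : CostLE D (drawFlat S j) 1 :=
    (costLE_draw j).bind (N := 0) fun x _ => costLE_rand_bind fun _ _ => costLE_ret _ _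
  refine ((costLE_iid (hflat a₁) s₂).bind fun X _ =>
    (costLE_iid (hflat i) s₂).bind (N := 0) fun Y _ => costLE_rand _).mono ?_
  omega

lemma costLE_findOneUnknown (a₁ : Fin k) (arms : List (Fin k)) :
    CostLE D (findOneUnknown equivTest findConst ε a₁ arms)
      (⌊2 * sketchSize n (arms.length + 1) ε⌋₊ +
        arms.length * (2 * testSize findConst n (arms.length + 1) ε)) := by
  rw [findOneUnknown_eq]
  refine costLE_rand_bind fun s _ => ?_
  split_ifs with h
  · exact costLE_ret _ _
  · refine CostLE.bind ((costLE_iid (costLE_draw a₁) s).mono ?_) fun S _ =>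
      costLE_firstDifferent (fun i => costLE_armTest S _ _ _ _ a₁ i) arms
    rw [mul_one]
    exact Nat.le_floor (not_lt.1 h)

lemma costLE_findStage (hε : 0 < ε) (hε1 : ε ≤ 1) (hn : 2 ≤ n) (hk : 2 ≤ k) (hr : 0 < r)
    (hrk : r ≤ k) (a₁ : Fin k) :
    CostLE D (findStage n k r ε a₁) ⌊10 ^ 12 * costFind n k r ε⌋₊ := by
  refine costLE_rand_bind fun J hJ => (costLE_findOneUnknown a₁ _).mono (Nat.le_floor ?_)
  have hle := length_erase_toList_le J a₁
  have hge := card_le_length_erase_toList_add_one J a₁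
  rw [card_of_mem_randomSubset hJ] at hle hge
  have hm := (two_le_subsetSize hr hrk hk).trans hge
  set l := (J.erase a₁).toList.length
  have hmk : ((l + 1 : ℕ) : ℝ) ≤ 11 * (k / r) := by
    have hone : 1 ≤ (k : ℝ) / r := (one_le_div (by positivity)).2 (by exact_mod_cast hrk)
    have hle' : (l : ℝ) ≤ subsetSize k r := by exact_mod_cast hle
    push_cast
    linarith [subsetSize_le hr hrk]
  have hs := two_le_sketchSize hε hε1 hn hm
  calc ((⌊2 * sketchSize n (l + 1) ε⌋₊ + l * (2 * testSize findConst n (l + 1) ε) : ℕ) : ℝ)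
      ≤ 2 * sketchSize n (l + 1) ε + (l + 1 : ℕ) * (2 * testSize findConst n (l + 1) ε) := by
        push_cast
        gcongr
        · exact Nat.floor_le (by positivity)
        · exact le_add_of_nonneg_right zero_le_one
    _ ≤ 10 ^ 12 * costFind n k r ε := findOneUnknown_cost_le hε hε1 hn hk hr hm hmk

end FindStage

/-! ### The two-stage algorithm -/

section IsHiddenPartition

variable {k n : ℕ} {ε : ℝ} {D : Fin k → PMF (Fin n)} {I : Finset (Fin k)}

lemma tv_comm (P Q : PMF (Fin n)) : tv P Q = tv Q P := by
  simp only [tv, abs_sub_comm]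

lemma IsHiddenPartition.compl (h : IsHiddenPartition ε D I) : IsHiddenPartition ε D Iᶜ where
  nonempty := h.nonempty_compl
  nonempty_compl := by rw [compl_compl]; exact h.nonempty
  eq_of_mem := h.eq_of_mem_compl
  eq_of_mem_compl := by rw [compl_compl]; exact h.eq_of_mem
  le_tv a ha b hb := by
    rw [compl_compl] at hb
    rw [tv_comm]
    exact h.le_tv b hb a ha

lemma IsHiddenPartition.smallerSize_pos (h : IsHiddenPartition ε D I) : 0 < smallerSize I :=
  lt_min h.nonempty.card_pos h.nonempty_compl.card_pos

lemma smallerSize_le (I : Finset (Fin k)) : smallerSize I ≤ k :=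
  (min_le_left _ _).trans ((Finset.card_le_univ I).trans_eq (Fintype.card_fin k))

lemma IsHiddenPartition.two_le_k (h : IsHiddenPartition ε D I) : 2 ≤ k :=
  two_le_of_mem_of_mem_compl h.nonempty.choose_spec h.nonempty_compl.choose_spec

lemma IsHiddenPartition.two_le_n (h : IsHiddenPartition ε D I) (hε : 0 < ε) : 2 ≤ n := by
  obtain ⟨a, ha⟩ := h.nonempty
  obtain ⟨b, hb⟩ := h.nonempty_compl
  by_contra! hn
  have : Subsingleton (Fin n) := Fin.subsingleton_iff_le_one.2 (by omega)
  have heq_one (P : PMF (Fin n)) (x : Fin n) : P x = 1 := by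
    rw [← P.tsum_coe, tsum_eq_single x fun y hy => absurd (Subsingleton.elim y x) hy]
  have htv := h.le_tv a ha b hb
  simp only [tv, heq_one, sub_self, abs_zero, Finset.sum_const_zero, mul_zero] at htv
  linarith

lemma IsHiddenPartition.exists_mem (h : IsHiddenPartition ε D I) (a₁ : Fin k) :
    ∃ I' : Finset (Fin k), IsHiddenPartition ε D I' ∧ a₁ ∈ I' ∧
      ({I', I'ᶜ} : Finset (Finset (Fin k))) = {I, Iᶜ} ∧ smallerSize I' = smallerSize I := by
  by_cases ha : a₁ ∈ I
  · exact ⟨I, h, ha, rfl, rfl⟩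
  · exact ⟨Iᶜ, h.compl, Finset.mem_compl.2 ha, by rw [compl_compl, Finset.pair_comm],
      by rw [smallerSize, smallerSize, compl_compl, min_comm]⟩

end IsHiddenPartition

section TwoStage

variable {k n r : ℕ} {ε : ℝ} {D : Fin k → PMF (Fin n)} {I : Finset (Fin k)}

/-- The second stage, given the outcome of the first one. -/
def finishStage (ε : ℝ) (a₁ : Fin k) : Option (Fin k) → SampleAlg k n (Finset (Finset (Fin k)))
  | none => .ret {Finset.univ, ∅}
  | some a₂ => multiLFHT lfhtTest lfhtConst ε a₁ a₂

lemma twoStage_eq (r : ℕ) (a₁ : Fin k) :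
    twoStage equivTest lfhtTest findConst lfhtConst r ε a₁ =
      (findStage n k r ε a₁).bind (finishStage ε a₁) := by
  change (SampleAlg.random _ fun J => SampleAlg.bind _ _) =
    SampleAlg.random _ fun J => SampleAlg.bind _ _
  congr 1

lemma costLE_finishStage (hε : 0 < ε) (hε1 : ε ≤ 1) (hk : 2 ≤ k) (a₁ : Fin k)
    (o : Option (Fin k)) : CostLE D (finishStage ε a₁ o) ⌊10 ^ 32 * lfhtSize n k ε⌋₊ := by
  cases o with
  | none => exact costLE_ret _ _
  | some a₂ =>
    obtain ⟨N, hN, hle⟩ := exists_costLE_multiLFHT (D := D) hε hε1 hk a₁ a₂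
    exact hN.mono (Nat.le_floor hle)

lemma pr_finishStage_le (hε : 0 < ε) (hε1 : ε ≤ 1) (hI : IsHiddenPartition ε D I) {a₁ : Fin k}
    (h₁ : a₁ ∈ I) {o : Option (Fin k)} (ho : ∃ j ∈ Iᶜ, o = some j) :
    pr (law D (finishStage ε a₁ o)) (· ≠ {I, Iᶜ}) ≤ 1 / 100 := by
  obtain ⟨j, hj, rfl⟩ := ho
  exact pr_multiLFHT_lfhtConst_le hε hε1 hI h₁ hj

lemma pr_twoStage_le (hε : 0 < ε) (hε1 : ε ≤ 1) (hI : IsHiddenPartition ε D I) (a₁ : Fin k) :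
    pr (law D (twoStage equivTest lfhtTest findConst lfhtConst (smallerSize I) ε a₁))
      (· ≠ {I, Iᶜ}) ≤ 1 / 3 := by
  obtain ⟨I', hI', h₁, hpair, hsize⟩ := hI.exists_mem a₁
  rw [← hpair, ← hsize, twoStage_eq, law_bind]
  calc _ ≤ pr (law D (findStage n k (smallerSize I') ε a₁)) (fun o => ¬ ∃ j ∈ I'ᶜ, o = some j) +
          1 / 100 :=
        pr_bind_le_add _ (by norm_num) fun o _ ho =>
          pr_finishStage_le hε hε1 hI' h₁ (not_not.1 ho)
    _ ≤ 0.265 + 1 / 100 := by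
        gcongr
        exact pr_findStage_fail_le hε hε1 (hI'.two_le_n hε) hI' h₁ hI'.smallerSize_pos
          (min_le_right _ _)
    _ ≤ 1 / 3 := by norm_num

lemma costLE_twoStage (hε : 0 < ε) (hε1 : ε ≤ 1) (hI : IsHiddenPartition ε D I) (a₁ : Fin k) :
    CostLE D (twoStage equivTest lfhtTest findConst lfhtConst (smallerSize I) ε a₁)
      ⌊10 ^ 32 * (costFind n k (smallerSize I) ε + lfhtSize n k ε)⌋₊ := by
  have hfind := costFind_nonneg n k (smallerSize I) ε
  have hlfht := lfhtSize_nonneg n k ε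
  rw [twoStage_eq]
  refine ((costLE_findStage hε hε1 (hI.two_le_n hε) hI.two_le_k hI.smallerSize_pos
    (smallerSize_le I) a₁).bind fun o _ => costLE_finishStage hε hε1 hI.two_le_k a₁ o).mono
    (Nat.le_floor ?_)
  push_cast
  linarith [Nat.floor_le (by positivity : 0 ≤ 10 ^ 12 * costFind n k (smallerSize I) ε),
    Nat.floor_le (by positivity : 0 ≤ 10 ^ 32 * lfhtSize n k ε)]

end TwoStage

/-! ### Searching for the smaller cluster size -/

section Search

variable {k n : ℕ} {ε : ℝ} {D : Fin k → PMF (Fin n)} {I : Finset (Fin k)}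

lemma costFind_le_mul {q r : ℕ} {a b : ℝ} (hqr : 1 / (q : ℝ) ≤ a * (1 / r)) (ha : 0 ≤ a)
    (hab : a ≤ b) (hpow : a ^ (2 / 3 : ℝ) ≤ b) : costFind n k q ε ≤ b * costFind n k r ε := by
  have hscale (x : ℝ) (hx : 0 ≤ x) : x / (q * ε ^ 2) ≤ a * (x / (r * ε ^ 2)) := by
    calc x / (q * ε ^ 2) = x / ε ^ 2 * (1 / q) := by ring
      _ ≤ x / ε ^ 2 * (a * (1 / r)) := by gcongr
      _ = a * (x / (r * ε ^ 2)) := by ring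
  unfold costFind
  rw [← mul_assoc]
  refine mul_le_mul_of_nonneg_right (max_le ?_ ?_) (Real.log_natCast_nonneg k)
  · calc (n * k / (q * ε ^ 2) : ℝ) ^ (2 / 3 : ℝ)
        ≤ (a * (n * k / (r * ε ^ 2))) ^ (2 / 3 : ℝ) := by
          gcongr
          exact hscale _ (by positivity)
      _ = a ^ (2 / 3 : ℝ) * (n * k / (r * ε ^ 2)) ^ (2 / 3 : ℝ) :=
          Real.mul_rpow ha (by positivity)
      _ ≤ _ := mul_le_mul hpow (le_max_left _ _) (by positivity) (ha.trans hab)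
  · exact (hscale _ (by positivity)).trans
      (mul_le_mul hab (le_max_right _ _) (by positivity) (ha.trans hab))

lemma costFind_two_mul_le (n k r : ℕ) (ε : ℝ) :
    costFind n k (2 * r) ε ≤ 2 / 3 * costFind n k r ε := by
  refine costFind_le_mul (a := 1 / 2) (by push_cast; exact (by ring : _ = _).le) (by norm_num)
    (by norm_num) (le_of_pow_le_pow_left₀ three_ne_zero (by norm_num) ?_)
  rw [← Real.rpow_natCast, ← Real.rpow_mul (by norm_num)]
  norm_num

lemma costFind_le_two_mul {q r : ℕ} (hq : 0 < q) (hr : 0 < r) (hrq : r ≤ 2 * q) :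
    costFind n k q ε ≤ 2 * costFind n k r ε := by
  have hrq' : (r : ℝ) ≤ 2 * q := by exact_mod_cast hrq
  refine costFind_le_mul ?_ zero_le_two le_rfl
    (Real.rpow_le_self_of_one_le one_le_two (by norm_num))
  rw [mul_one_div, div_le_div_iff₀ (by positivity) (by positivity)]
  linarith

lemma sum_costFind_le (n k : ℕ) (ε : ℝ) {j L : ℕ} (h : j ≤ L) :
    ∑ i ∈ Finset.Ico j L, costFind n k (2 ^ i) ε ≤ 3 * costFind n k (2 ^ j) ε := by
  suffices ∑ i ∈ Finset.Ico j L, costFind n k (2 ^ i) ε + 3 * costFind n k (2 ^ L) ε ≤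
      3 * costFind n k (2 ^ j) ε by
    linarith [costFind_nonneg n k (2 ^ L) ε]
  induction L, h using Nat.le_induction with
  | base => simp
  | succ L hL ih =>
    rw [Finset.sum_Ico_succ_top hL, pow_succ']
    linarith [costFind_two_mul_le n k (2 ^ L) ε]

/-- Run the first stage with the guesses `2 ^ (L - 1), …, 2, 1` of the smaller cluster size, until
a distribution that differs from that of `a₁` is found. -/
def search (n k : ℕ) (ε : ℝ) (a₁ : Fin k) : ℕ → SampleAlg k n (Option (Fin k))
  | 0 => .ret none
  | L + 1 => (findStage n k (2 ^ L) ε a₁).bind fun o =>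
    match o with
    | some j => .ret (some j)
    | none => search n k ε a₁ L

/-- The event, for an outcome and a number of samples drawn, that an index in `J` has been found
with at most `B` samples. -/
def FoundWithin (J : Finset (Fin k)) (B : ℝ) (p : Option (Fin k) × ℕ) : Prop :=
  (∃ j ∈ J, p.1 = some j) ∧ (p.2 : ℝ) ≤ B

variable {a₁ : Fin k} {j L : ℕ}

lemma le_of_mem_support_run_findStage (hε : 0 < ε) (hε1 : ε ≤ 1) (hI : IsHiddenPartition ε D I)
    (hL : 2 ^ L ≤ k) {p : Option (Fin k) × ℕ}
    (hp : p ∈ ((findStage n k (2 ^ L) ε a₁).run D).support) :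
    (p.2 : ℝ) ≤ 10 ^ 12 * costFind n k (2 ^ L) ε :=
  (costLE_findStage hε hε1 (hI.two_le_n hε) hI.two_le_k (by positivity) hL a₁).cast_le
    (mul_nonneg (by norm_num) (costFind_nonneg _ _ _ _)) hp

lemma pr_search_succ_fail_le (hε : 0 < ε) (hε1 : ε ≤ 1) (hI : IsHiddenPartition ε D I)
    (h₁ : a₁ ∈ I) (hL : 2 ^ L ≤ Iᶜ.card) (hLk : 2 ^ L ≤ k) :
    pr ((search n k ε a₁ (L + 1)).run D)
      (fun p => ¬ FoundWithin Iᶜ (10 ^ 12 * costFind n k (2 ^ L) ε) p) ≤ 0.265 := by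
  rw [search, run_bind]
  refine (pr_bind_le_add (fun p => ¬ ∃ j ∈ Iᶜ, p.1 = some j) le_rfl fun p hp hG => ?_).trans ?_
  · obtain ⟨j, hj, hpj⟩ := not_not.1 hG
    simp only [hpj, SampleAlg.run, PMF.pure_map]
    refine (pr_pure_of_not ?_).le
    exact not_not.2 ⟨⟨j, hj, rfl⟩,
      by simpa using le_of_mem_support_run_findStage hε hε1 hI hLk hp⟩
  · rw [add_zero]
    exact (pr_law _ _).symm.trans_le
      (pr_findStage_fail_le hε hε1 (hI.two_le_n hε) hI h₁ (by positivity) hL)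

lemma pr_search_succ_fail_le_add (hε : 0 < ε) (hε1 : ε ≤ 1) (hI : IsHiddenPartition ε D I)
    (h₁ : a₁ ∈ I) (hLk : 2 ^ L ≤ k) {B : ℝ} (hB : 0 ≤ B) :
    pr ((search n k ε a₁ (L + 1)).run D)
        (fun p => ¬ FoundWithin Iᶜ (B + 10 ^ 12 * costFind n k (2 ^ L) ε) p) ≤
      2 ^ L / (27000 * k) +
        pr ((search n k ε a₁ L).run D) (fun p => ¬ FoundWithin Iᶜ B p) := by
  have hwrong := pr_findStage_eq_le (D := D) (r := 2 ^ L) (by positivity) a₁.pos ε a₁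
  rw [pr_law] at hwrong
  push_cast at hwrong
  rw [search, run_bind]
  refine (pr_bind_le_add (fun p => ∃ j, p.1 = some j ∧ D j = D a₁) (pr_nonneg _ _)
    fun p hp hG => ?_).trans (add_le_add_left hwrong _)
  have hcost := le_of_mem_support_run_findStage hε hε1 hI hLk hp
  rw [pr_map]
  rcases hp1 : p.1 with _ | j
  · refine pr_mono fun q _ hq hfound => hq ⟨hfound.1, ?_⟩
    push_cast
    linarith [hfound.2]
  · have hj : j ∈ Iᶜ := Finset.mem_compl.2 fun hj => hG ⟨j, hp1, hI.eq_of_mem j hj a₁ h₁⟩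
    simp only [SampleAlg.run]
    rw [pr_pure_of_not]
    · exact pr_nonneg _ _
    · refine not_not.2 ⟨⟨j, hj, rfl⟩, ?_⟩
      push_cast
      linarith

lemma pr_search_fail_le (hε : 0 < ε) (hε1 : ε ≤ 1) (hI : IsHiddenPartition ε D I)
    (h₁ : a₁ ∈ I) (hj : 2 ^ j ≤ Iᶜ.card) (hL : j ≤ L) (hLk : 2 ^ L ≤ k) :
    pr ((search n k ε a₁ (L + 1)).run D) (fun p => ¬ FoundWithin Iᶜ
        (10 ^ 12 * ∑ i ∈ Finset.Ico j (L + 1), costFind n k (2 ^ i) ε) p) ≤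
      0.265 + 2 ^ (L + 1) / (27000 * k) := by
  induction L, hL using Nat.le_induction with
  | base =>
    rw [Nat.Ico_succ_singleton, Finset.sum_singleton]
    exact (pr_search_succ_fail_le hε hε1 hI h₁ hj hLk).trans
      (le_add_of_nonneg_right (by positivity))
  | succ L hL ih =>
    have hsum : 0 ≤ 10 ^ 12 * ∑ i ∈ Finset.Ico j (L + 1), costFind n k (2 ^ i) ε :=
      mul_nonneg (by norm_num) (Finset.sum_nonneg fun i _ => costFind_nonneg _ _ _ _)
    rw [Finset.sum_Ico_succ_top (by omega), mul_add]
    calc _ ≤ (2 : ℝ) ^ (L + 1) / (27000 * k) + (0.265 + 2 ^ (L + 1) / (27000 * k)) :=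
          (pr_search_succ_fail_le_add hε hε1 hI h₁ hLk hsum).trans
            (add_le_add_right (ih ((Nat.pow_le_pow_right two_pos L.le_succ).trans hLk)) _)
      _ = 0.265 + 2 ^ (L + 1 + 1) / (27000 * k) := by ring

/-- The two-stage algorithm for unknown smaller cluster size. -/
def searchTwoStage (n k : ℕ) (ε : ℝ) : SampleAlg k n (Finset (Finset (Fin k))) :=
  if h : 0 < k then
    (search n k ε ⟨0, h⟩ (Nat.log 2 k + 1)).bind (finishStage ε ⟨0, h⟩)
  else .ret ∅

lemma pr_search_log_fail_le (hε : 0 < ε) (hε1 : ε ≤ 1) (hI : IsHiddenPartition ε D I)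
    (h₁ : a₁ ∈ I) :
    pr ((search n k ε a₁ (Nat.log 2 k + 1)).run D)
      (fun p => ¬ FoundWithin Iᶜ (6 * 10 ^ 12 * costFind n k (smallerSize I) ε) p) ≤ 0.266 := by
  set r := smallerSize I
  have hr : 0 < r := hI.smallerSize_pos
  have hj : 2 ^ Nat.log 2 r ≤ r := Nat.pow_log_le_self 2 hr.ne'
  have hL : 2 ^ Nat.log 2 k ≤ k := Nat.pow_log_le_self 2 a₁.pos.ne'
  have hjL : Nat.log 2 r ≤ Nat.log 2 k := Nat.log_mono_right (smallerSize_le I)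
  have hsum : ∑ i ∈ Finset.Ico (Nat.log 2 r) (Nat.log 2 k + 1), costFind n k (2 ^ i) ε ≤
      6 * costFind n k r ε := by
    have hhead : costFind n k (2 ^ Nat.log 2 r) ε ≤ 2 * costFind n k r ε :=
      costFind_le_two_mul (by positivity) hr
        (by rw [← pow_succ']; exact (Nat.lt_pow_succ_log_self one_lt_two r).le)
    linarith [sum_costFind_le n k ε (hjL.trans (Nat.le_succ _))]
  calc _ ≤ 0.265 + (2 : ℝ) ^ (Nat.log 2 k + 1) / (27000 * k) := by
        refine (pr_mono fun p _ hp hfound => hp ⟨hfound.1, hfound.2.trans ?_⟩).trans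
          (pr_search_fail_le hε hε1 hI h₁ (hj.trans (min_le_right _ _)) hjL hL)
        linarith
    _ ≤ 0.265 + 2 * k / (27000 * k) := by
        rw [pow_succ']
        gcongr
        exact_mod_cast hL
    _ ≤ 0.266 := by
        rw [mul_div_mul_right _ _ (by exact_mod_cast a₁.pos.ne')]
        norm_num

end Search

section SampleBound

variable {k n : ℕ} {ε c : ℝ} {D : Fin k → PMF (Fin n)} {I : Finset (Fin k)}

lemma sampleBound_twoStage (hc : 0 < c) (hε : 0 < ε) (hε1 : ε ≤ 1) (hI : IsHiddenPartition ε D I)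
    {a₁ : Fin k} {p : Finset (Finset (Fin k)) × ℕ} (hp : p ∈ ((twoStage equivTest lfhtTest findConst
      lfhtConst (smallerSize I) ε a₁).run D).support) :
    SampleBound c (10 ^ 32 * max 1 (1 / c) ^ 2) n k (smallerSize I) ε p.2 :=
  sampleBound_of_le hε hε1 hc (by norm_num) ((costLE_twoStage hε hε1 hI a₁).cast_le
    (mul_nonneg (by norm_num) (add_nonneg (costFind_nonneg _ _ _ _) (lfhtSize_nonneg _ _ _))) hp)

lemma pr_searchTwoStage_le (hc : 0 < c) (hε : 0 < ε) (hε1 : ε ≤ 1)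
    (hI : IsHiddenPartition ε D I) :
    pr ((searchTwoStage n k ε).run D) (fun p => ¬ (p.1 = {I, Iᶜ} ∧
      SampleBound c (10 ^ 32 * max 1 (1 / c) ^ 2) n k (smallerSize I) ε p.2)) ≤ 1 / 3 := by
  have hk := hI.two_le_k
  rw [searchTwoStage, dif_pos (by omega)]
  set a₁ : Fin k := ⟨0, by omega⟩
  obtain ⟨I', hI', h₁, hpair, hsize⟩ := hI.exists_mem a₁
  rw [← hpair, ← hsize, run_bind]
  set r := smallerSize I'
  calc _ ≤ pr ((search n k ε a₁ (Nat.log 2 k + 1)).run D)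
          (fun p => ¬ FoundWithin I'ᶜ (6 * 10 ^ 12 * costFind n k r ε) p) + 1 / 100 := by
        refine pr_bind_le_add _ (by norm_num) fun p _ hp => ?_
        obtain ⟨hfound, hcost⟩ := not_not.1 hp
        refine le_trans ?_ (pr_finishStage_le hε hε1 hI' h₁ hfound)
        rw [pr_map, pr_law]
        refine pr_mono fun q hq hE hout => hE ⟨hout, sampleBound_of_le hε hε1 hc (by norm_num) ?_⟩
        have hfinish := (costLE_finishStage hε hε1 hk a₁ p.1).cast_le
          (mul_nonneg (by norm_num) (lfhtSize_nonneg n k ε)) hq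
        push_cast
        linarith [costFind_nonneg n k r ε]
    _ ≤ 0.266 + 1 / 100 := by
        gcongr
        exact pr_search_log_fail_le hε hε1 hI' h₁
    _ ≤ 1 / 3 := by norm_num

end SampleBound

lemma two_thirds_le_prob {k n : ℕ} {α : Type} {D : Fin k → PMF (Fin n)} {A : SampleAlg k n α}
    {E : α → ℕ → Prop} (h : pr (A.run D) (fun p => ¬ E p.1 p.2) ≤ 1 / 3) :
    2 / 3 ≤ A.prob D E := by
  have heq : (2 / 3 : ℝ≥0∞) = ENNReal.ofReal (2 / 3) := by
    rw [ENNReal.ofReal_div_of_pos (by norm_num)]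
    norm_num
  rw [heq]
  exact ofReal_le_toOuterMeasure (h.trans (by norm_num))

end

end TwoClustering

theorem theoremC3 :
    -- The two-stage algorithm, which is told `r`: worst-case number of samples.
    (∃ (test : EquivalenceTest) (lfht : LFHTest) (C₁ C₂ : ℝ), 0 < C₁ ∧ 0 < C₂ ∧
      ∀ c : ℝ, 0 < c → ∃ C : ℝ, 0 < C ∧
        ∀ (n k r : ℕ) (ε : ℝ) (D : Fin k → PMF (Fin n)) (I : Finset (Fin k)) (a₁ : Fin k),
          0 < ε → ε ≤ 1 → IsHiddenPartition ε D I → smallerSize I = r →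
          2 / 3 ≤ (twoStage test lfht C₁ C₂ r ε a₁).prob D (fun out _ => out = {I, Iᶜ}) ∧
          ∀ p ∈ ((twoStage test lfht C₁ C₂ r ε a₁).run D).support,
            SampleBound c C n k r ε p.2) ∧
    -- An algorithm that is not told `r`, and takes no more samples up to constants.
    (∃ alg : ∀ n k : ℕ, ℝ → SampleAlg k n (Finset (Finset (Fin k))),
      ∀ c : ℝ, 0 < c → ∃ C : ℝ, 0 < C ∧
        ∀ (n k : ℕ) (ε : ℝ) (D : Fin k → PMF (Fin n)) (I : Finset (Fin k)),
          0 < ε → ε ≤ 1 → IsHiddenPartition ε D I →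
          2 / 3 ≤ (alg n k ε).prob D
            (fun out N => out = {I, Iᶜ} ∧ SampleBound c C n k (smallerSize I) ε N)) := by
  constructor
  · refine ⟨equivTest, lfhtTest, findConst, lfhtConst, by norm_num [findConst],
      by norm_num [lfhtConst], fun c hc => ⟨10 ^ 32 * max 1 (1 / c) ^ 2, by positivity, ?_⟩⟩
    rintro n k r ε D I a₁ hε hε1 hI rfl
    refine ⟨two_thirds_le_prob ?_, fun p hp => sampleBound_twoStage hc hε hε1 hI hp⟩
    exact (pr_law _ _).symm.trans_le (pr_twoStage_le hε hε1 hI a₁)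
  · refine ⟨searchTwoStage, fun c hc => ⟨10 ^ 32 * max 1 (1 / c) ^ 2, by positivity, ?_⟩⟩
    exact fun n k ε D I hε hε1 hI => two_thirds_le_prob (pr_searchTwoStage_le hc hε hε1 hI)
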